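/- **Setting.** Let $N\ge 0$ be an integer, $a=2^{-N}$, $L\in a\mathbb N$ with $L\ge 1$, and let $\Lambda=(a\mathbb Z)^2/(L\mathbb Z)^2$ with torus distance $|x-y|_L=\min_{w\in\mathbb Z^2}|x-y+Lw|$. Write $\int_\Lambda dx=a^2\sum_{x\in\Lambda}$, $\Lambda^*=\frac{2\pi}{L}\mathbb Z^2\cap(-\frac{\pi}{a},\frac{\pi}{a}]^2$, $\int_{\Lambda^*}dk=L^{-2}\sum_{k\in\Lambda^*}$, $\delta(x)=a^{-2}\mathbf 1_{x=0}$, and let $\hat e_0,\hat e_1$ be the coordinate unit vectors. Bosonic labels are $b=(x,\mu,\epsilon)\in\Lambda_B=\Lambda\times\{0,1\}\times\{\pm\}$ and fermionic labels are $\eta=(x,s)\in\Lambda_F=\Lambda\times\{1,2\}$; $\int db=\sum_{\mu,\epsilon}\int_\Lambda dx$, $\int d\eta=\sum_s\int_\Lambda dx$. Let $$\gamma_0=\begin{pmatrix}1&0\\0&-1\end{pmatrix},\qquad \gamma_1=\begin{pmatrix}0&-i\\i&0\end{pmatrix},\qquad \gamma_5=i\gamma_0\gamma_1 .$$ *Cutoff.*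 $\chi$ is a smooth function, non-negative and non-increasing on $[0,\infty)$, equal to $1$ on $[0,\frac12]$ and to $0$ on $[1,\infty)$, of Gevrey class 2: $\|\chi^{(j)}\|_\infty\le AB^j(j!)^2$ for all $j\ge0$ and some $A,B>0$. Set $\chi_j(t)=\chi(2^{-j}t)$. *Fermion propagator.* For $m\in[-1,1]$ let $D(k)=-i\sum_\mu\gamma_\mu 2^N\sin(2^{-N}k_\mu)+m+2\sum_\mu2^N\sin^2(2^{-N-1}k_\mu)$ (Wilson parameter $r=1$). For $0\le h\le N$ let $g^{(h,N]}=\sum_{j=h+1}^N g^{(j)}$ with $g^{(j)}(x)=\int_{\Lambda^*}dk\,e^{-ik\cdot x}f_j(|k|)D(k)^{-1}$, where $f_j=\chi_j-\chi_{j-1}$ for $j<N$ and $f_N=1-\chi_{N-1}$ (modes with $f_j(|k|)=0$ do not contribute). For $\eta=(x,s)$, $\eta'=(y,s')$ put $g^{(h,N]}_{\eta,\eta'}=g^{(h,N]}_{s,s'}(x-y)$. *Bubbles.* Let $Z\in\mathbb R$ with $|Z-1|\le\frac12$. For $b=(y,\mu,\epsilon)$, $\eta=(x,s)$, $\eta'=(x',s')$,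 $$c_b(\eta,\eta')=\begin{cases}\tfrac12\delta(x-y)\,\delta(x'-y-a\hat e_\mu)\,(\gamma_\mu-1)_{s,s'}&\epsilon=+\\[2pt]-\tfrac12\delta(x'-y)\,\delta(x-y-a\hat e_\mu)\,(\gamma_\mu+1)_{s,s'}&\epsilon=-\end{cases},\qquad c^5_b(\eta,\eta')=\tfrac12\epsilon Z\,\delta(x-y)\,\delta(x'-y)\,(\gamma_\mu\gamma_5)_{s,s'} .$$ The vector bubble $\Pi^{(h,N]}$ and the chiral bubble $\Pi^{(h,N]}_5$ are $$\Pi^{(h,N]}_\sharp(b_1,b_2)=\tfrac12\int d\eta_1d\eta_1'd\eta_2d\eta_2'\;c_{b_1}(\eta_1,\eta_1')\,c^\sharp_{b_2}(\eta_2,\eta_2')\,g^{(h,N]}_{\eta_1',\eta_2}\,g^{(h,N]}_{\eta_2',\eta_1},$$ with $c^\sharp=c$ if $\sharp$ is blank and $c^\sharp=c^5$ if $\sharp=5$, and $$\hat\Pi^{(h,N]}_{\sharp;\mu,\nu}(p)=\tfrac12\sum_{\epsilon,\epsilon'=\pm}\epsilon\epsilon'\int_\Lambda\int_\Lambda\frac{dx\,dy}{L^2}\,e^{-ip\cdot(x-y)}\,\Pi^{(h,N]}_\sharp\big((x,\mu,\epsilon),(y,\nu,\epsilon')\big),\qquad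 p\in\Lambda^* .$$ *Kernels, norms and boson propagator.* For $V,W:\Lambda_B^2\to\mathbb C$ let $(V*W)(b,b')=\int db''\,V(b,b'')W(b'',b')$ and, for $\kappa>0$, with $x,y$ the sites of $b,b'$, $$\|V\|_1^w=\frac1{L^2}\int db\,db'\,e^{\frac\kappa2\sqrt{|x-y|_L}}\,|V(b,b')| .$$ To $\tilde v:\{0,1\}^2\times\Lambda\to\mathbb C$, written $\tilde v_{\mu,\nu}(x)$, associate the kernel $v((x,\mu,\epsilon),(y,\nu,\epsilon'))=\epsilon\epsilon'\,\tilde v_{\mu,\nu}(x-y)$. Let $\nabla_\alpha v$ be the kernel associated in this way with $x\mapsto2^N(\tilde v_{\mu,\nu}(x+a\hat e_\alpha)-\tilde v_{\mu,\nu}(x))$, put $\|\nabla v\|_1^w=\sum_\alpha\|\nabla_\alpha v\|_1^w$, and let $v\,\hat\Pi_\sharp(0)$ be the kernel associated with $\sum_\alpha\tilde v_{\mu,\alpha}(x)\,\hat\Pi_{\sharp;\alpha,\nu}(0)$. For $M\in[1,2)$, $g^A$ is the kernel associated with $$g^A_{\mu,\nu}(x)=\delta_{\mu,\nu}\int_{\Lambda^*}dk\,\frac{e^{-ik\cdot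 x}}{\sum_\alpha|\sigma_\alpha(k)|^2+M^2},\qquad \sigma_\alpha(k)=i2^N\big(e^{-i2^{-N}k_\alpha}-1\big).$$ **Statement.** For every cutoff $\chi$ as above there are $\kappa_0>0$ and constants $C_\Pi,C'_\Pi\ge1$, depending only on $\chi$, such that for all $\kappa\in(0,\kappa_0]$, all integers $0\le h\le N$, all $L\in2^{-N}\mathbb N$ with $L\ge1$, all $m\in[-1,1]$ and all $Z$ with $|Z-1|\le\frac12$: 1. $\hat\Pi^{(h,N]}_{\mu,\nu}(0)=\delta_{\mu,\nu}\hat\Pi^{(h,N]}_{0,0}(0)$ and $\hat\Pi^{(h,N]}_{5;\mu,\nu}(0)=\varepsilon_{\mu,\nu}\hat\Pi^{(h,N]}_{5;0,1}(0)$ for all $\mu,\nu\in\{0,1\}$, where $\varepsilon_{0,1}=-\varepsilon_{1,0}=1$ and $\varepsilon_{0,0}=\varepsilon_{1,1}=0$. 2. $|\hat\Pi^{(h,N]}_{\sharp;\mu,\nu}(0)|\le C_\Pi$ for all $\mu,\nu$ and for both bubbles. 3. For every $\tilde v:\{0,1\}^2\times\Lambda\to\mathbb C$, with associated kernel $v$,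 and for both bubbles, $$\big\|v*\Pi^{(h,N]}_\sharp-v\,\hat\Pi^{(h,N]}_\sharp(0)\big\|_1^w\le C_\Pi\,2^{-h}\,\|\nabla v\|_1^w .$$ 4. For every $M\in[1,2)$ and for both bubbles, $\|g^A*\Pi^{(h,N]}_\sharp\|_1^w\le C'_\Pi$. -/

import Mathlib

namespace LatticeQED

noncomputable section

/-! Geometry. The lattice spacing is `a = 2 ^ (-N)`, the lattice has `n` sites per side, so the
side length is `L = n * a`, and the lattice is `(a ℤ / L ℤ) ^ 2`. A site is stored through the pair
of residues modulo `n` of its integer coordinates `x / a`. The same type indexes the dual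
lattice `((2 π / L) ℤ) ^ 2 ∩ (-π / a, π / a] ^ 2`. -/

/-- Sites of the periodic lattice (and, by duality, lattice momenta). -/
abbrev Site (n : ℕ) := Fin 2 → ZMod n

/-- The side length `L = n * 2 ^ (-N)`. -/
def side (N n : ℕ) : ℝ := (n : ℝ) / 2 ^ N

/-- The `μ`-th real coordinate of a site, chosen in `(-L/2, L/2]`. -/
def coord (N : ℕ) {n : ℕ} (x : Site n) (μ : Fin 2) : ℝ := ((x μ).valMinAbs : ℝ) / 2 ^ N

/-- The torus length of `x`: `min over w ∈ ℤ ^ 2` of the Euclidean length of `x + L w`.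
Since `coord` picks the representative of least absolute value in each coordinate,
the minimum is attained at that representative. -/
def torusNorm (N : ℕ) {n : ℕ} (x : Site n) : ℝ := Real.sqrt (∑ μ, coord N x μ ^ 2)

/-- The `μ`-th component of the momentum `k`, in `(-π / a, π / a]`. -/
def mom (N : ℕ) {n : ℕ} (k : Site n) (μ : Fin 2) : ℝ :=
  2 * Real.pi * ((k μ).valMinAbs : ℝ) / side N n

/-- The Euclidean length of the momentum `k`. -/
def momNorm (N : ℕ) {n : ℕ} (k : Site n) : ℝ := Real.sqrt (∑ μ, mom N k μ ^ 2)

/-- The phase `exp (-i k · x)`. -/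
def phase (N : ℕ) {n : ℕ} (k x : Site n) : ℂ :=
  Complex.exp (-Complex.I * ((∑ μ, mom N k μ * coord N x μ : ℝ) : ℂ))

/-- The lattice unit vector in direction `μ` (of physical length `a`). -/
def unitVec {n : ℕ} (μ : Fin 2) : Site n := Pi.single μ 1

/-- `∫ dx f x = a ^ 2 * ∑ x, f x`. -/
def siteInt (N : ℕ) {n : ℕ} [NeZero n] {E : Type*} [AddCommMonoid E] [Module ℝ E]
    (f : Site n → E) : E :=
  (((2 : ℝ) ^ N)⁻¹ ^ 2) • ∑ x, f x

/-- `∫ dk f k = L ^ (-2) * ∑ k, f k` over the dual lattice. -/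
def dualInt (N : ℕ) {n : ℕ} [NeZero n] {E : Type*} [AddCommMonoid E] [Module ℝ E]
    (f : Site n → E) : E :=
  ((side N n ^ 2)⁻¹) • ∑ k, f k

/-- Bosonic labels `b = (x, μ, ε)`, with `ε = ±1`. -/
abbrev BLabel (n : ℕ) := Site n × Fin 2 × ℤˣ

/-- Fermionic labels `η = (x, s)`. -/
abbrev FLabel (n : ℕ) := Site n × Fin 2

/-- Integration over bosonic labels. -/
def bInt (N : ℕ) {n : ℕ} [NeZero n] {E : Type*} [AddCommMonoid E] [Module ℝ E]
    (f : BLabel n → E) : E :=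
  ∑ μ : Fin 2, ∑ ε : ℤˣ, siteInt N (fun x => f (x, μ, ε))

/-- Integration over fermionic labels. -/
def fInt (N : ℕ) {n : ℕ} [NeZero n] {E : Type*} [AddCommMonoid E] [Module ℝ E]
    (f : FLabel n → E) : E :=
  ∑ s : Fin 2, siteInt N (fun x => f (x, s))

/-- The periodic lattice delta function, `2 ^ (2 N)` at the origin and `0` elsewhere. -/
def siteDelta (N : ℕ) {n : ℕ} (x : Site n) : ℂ := if x = 0 then (2 : ℂ) ^ (2 * N) else 0

/-- The sign `ε` as a complex number. -/
def sgn (ε : ℤˣ) : ℂ := ((ε : ℤ) : ℂ)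

/-! Dirac matrices and propagators. -/

/-- The Euclidean gamma matrices `γ₀, γ₁`. -/
def gam : Fin 2 → Matrix (Fin 2) (Fin 2) ℂ :=
  ![!![1, 0; 0, -1], !![0, -Complex.I; Complex.I, 0]]

/-- `γ₅ = i γ₀ γ₁`. -/
def gamFive : Matrix (Fin 2) (Fin 2) ℂ := Complex.I • (gam 0 * gam 1)

/-- `s_μ(k) = 2 ^ N sin (2 ^ (-N) k_μ)`. -/
def sinMom (N : ℕ) {n : ℕ} (k : Site n) (μ : Fin 2) : ℝ :=
  2 ^ N * Real.sin (mom N k μ / 2 ^ N)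

/-- The momentum-dependent Wilson mass (with Wilson parameter `r = 1`):
`M_N(k) = 2 ∑ μ, 2 ^ N sin ^ 2 (2 ^ (-N-1) k_μ)`. -/
def wilsonMass (N : ℕ) {n : ℕ} (k : Site n) : ℝ :=
  2 * ∑ μ, 2 ^ N * Real.sin (mom N k μ / 2 ^ (N + 1)) ^ 2

/-- The lattice Dirac operator in momentum space, `-i ∑ μ, γ_μ s_μ(k) + m + M_N(k)`. -/
def diracOp (N : ℕ) {n : ℕ} (m : ℝ) (k : Site n) : Matrix (Fin 2) (Fin 2) ℂ :=
  -(Complex.I • ∑ μ, (sinMom N k μ : ℂ) • gam μ) +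
    ((m + wilsonMass N k : ℝ) : ℂ) • (1 : Matrix (Fin 2) (Fin 2) ℂ)

/-- Admissible cutoff functions: non-increasing on `[0, ∞)`, non-negative there,
equal to `1` on `[0, 1/2]` and to `0` on `[1, ∞)`, and of Gevrey class 2. -/
structure IsCutoff (χ : ℝ → ℝ) : Prop where
  nonneg : ∀ t, 0 ≤ t → 0 ≤ χ t
  antitone : AntitoneOn χ (Set.Ici 0)
  eq_one : ∀ t ∈ Set.Icc (0 : ℝ) (1 / 2), χ t = 1
  eq_zero : ∀ t ∈ Set.Ici (1 : ℝ), χ t = 0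
  smooth : ContDiff ℝ (⊤ : ℕ∞) χ
  gevrey : ∃ A B : ℝ, 0 < A ∧ 0 < B ∧
    ∀ (j : ℕ) (t : ℝ), |iteratedDeriv j χ t| ≤ A * B ^ j * (Nat.factorial j : ℝ) ^ 2

/-- The cutoff selecting the momentum scale `j`, for `1 ≤ j ≤ N`: it is
`χ(2 ^ (-j) t) - χ(2 ^ (-(j-1)) t)` for `j < N` and `1 - χ(2 ^ (-(N-1)) t)` for `j = N`. -/
def scaleCutoff (χ : ℝ → ℝ) (N j : ℕ) (t : ℝ) : ℝ :=
  (if j = N then 1 else χ (t / 2 ^ j)) - χ (t / 2 ^ (j - 1))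

/-- The single-scale fermion propagator `g^{(j)}(x)`, for `1 ≤ j ≤ N`. If `m = 0` the Dirac operator
is not invertible at `k = 0`, where the cutoff vanishes, so that this mode does not contribute. -/
def scaleProp (χ : ℝ → ℝ) (N : ℕ) {n : ℕ} [NeZero n] (m : ℝ) (j : ℕ) (x : Site n) :
    Matrix (Fin 2) (Fin 2) ℂ :=
  dualInt N fun k : Site n =>
    (phase N k x * (scaleCutoff χ N j (momNorm N k) : ℂ)) • (diracOp N m k)⁻¹

/-- The propagator `g^{(h,N]} = ∑ j from h + 1 to N of g^{(j)}`. -/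
def fermiProp (χ : ℝ → ℝ) (N : ℕ) {n : ℕ} [NeZero n] (m : ℝ) (h : ℕ) (x : Site n) :
    Matrix (Fin 2) (Fin 2) ℂ :=
  ∑ j ∈ Finset.Icc (h + 1) N, scaleProp χ N m j x

/-- The propagator as a function of two fermionic labels. -/
def fermiKernel (χ : ℝ → ℝ) (N : ℕ) {n : ℕ} [NeZero n] (m : ℝ) (h : ℕ) (η η' : FLabel n) : ℂ :=
  fermiProp χ N m h (η.1 - η'.1) η.2 η'.2

/-- `σ_μ(k) = i 2 ^ N (exp (-i 2 ^ (-N) k_μ) - 1)`. -/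
def sigmaMom (N : ℕ) {n : ℕ} (k : Site n) (μ : Fin 2) : ℂ :=
  Complex.I * 2 ^ N * (Complex.exp (-Complex.I * ((mom N k μ / 2 ^ N : ℝ) : ℂ)) - 1)

/-- The boson propagator of mass `M` in the Feynman gauge (gauge-fixing parameter `ξ = 1`). -/
def bosonProp (N : ℕ) {n : ℕ} [NeZero n] (M : ℝ) (μ ν : Fin 2) (x : Site n) : ℂ :=
  dualInt N fun k : Site n =>
    phase N k x / ((∑ α, ‖sigmaMom N k α‖ ^ 2 + M ^ 2 : ℝ) : ℂ) * (if μ = ν then 1 else 0)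

/-! Kernels of two bosonic labels. -/

/-- The kernel `((x, μ, ε), (y, ν, ε')) ↦ ε ε' v_{μ,ν}(x - y)`. -/
def signKernel {n : ℕ} (v : Fin 2 → Fin 2 → Site n → ℂ) (b b' : BLabel n) : ℂ :=
  sgn b.2.2 * sgn b'.2.2 * v b.2.1 b'.2.1 (b.1 - b'.1)

/-- The boson propagator as a kernel of two bosonic labels. -/
def bosonKernel (N : ℕ) {n : ℕ} [NeZero n] (M : ℝ) : BLabel n → BLabel n → ℂ :=
  signKernel (bosonProp N M)

/-- The forward discrete derivative in direction `α`. -/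
def latticeDeriv (N : ℕ) {n : ℕ} (α : Fin 2) (v : Fin 2 → Fin 2 → Site n → ℂ) :
    Fin 2 → Fin 2 → Site n → ℂ :=
  fun μ ν x => 2 ^ N * (v μ ν (x + unitVec α) - v μ ν x)

/-- Convolution of kernels, `(V * W)(b, b') = ∫ db'' V(b, b'') W(b'', b')`. -/
def conv (N : ℕ) {n : ℕ} [NeZero n] (V W : BLabel n → BLabel n → ℂ) (b b' : BLabel n) : ℂ :=
  bInt N fun b'' => V b b'' * W b'' b'

/-- The weighted norm
`L ^ (-2) ∫ db db' exp ((κ / 2) sqrt |x - y|) |V(b, b')|`, with `x, y` the sites of `b, b'`. -/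
def wNorm (κ : ℝ) (N : ℕ) {n : ℕ} [NeZero n] (V : BLabel n → BLabel n → ℂ) : ℝ :=
  (side N n ^ 2)⁻¹ * bInt N fun b => bInt N fun b' =>
    Real.exp (κ / 2 * Real.sqrt (torusNorm N (b.1 - b'.1))) * ‖V b b'‖

/-- `‖∇v‖ = ∑ α, ‖∇_α v‖` for the kernel `v` generated by the given function. -/
def gradNorm (κ : ℝ) (N : ℕ) {n : ℕ} [NeZero n] (v : Fin 2 → Fin 2 → Site n → ℂ) : ℝ :=
  ∑ α, wNorm κ N (signKernel (latticeDeriv N α v))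

/-! Bare vertices and bubbles. -/

/-- The bare vector vertex `c_b(η, η')`. -/
def vertex (N : ℕ) {n : ℕ} (b : BLabel n) (η η' : FLabel n) : ℂ :=
  if b.2.2 = 1 then
    1 / 2 * siteDelta N (η.1 - b.1) * siteDelta N (η'.1 - b.1 - unitVec b.2.1) *
      (gam b.2.1 - 1) η.2 η'.2
  else
    -(1 / 2) * siteDelta N (η'.1 - b.1) * siteDelta N (η.1 - b.1 - unitVec b.2.1) *
      (gam b.2.1 + 1) η.2 η'.2

/-- The bare chiral vertex `c^5_b(η, η')`, with chiral renormalization `Z`. -/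
def chiralVertex (N : ℕ) {n : ℕ} (Z : ℝ) (b : BLabel n) (η η' : FLabel n) : ℂ :=
  1 / 2 * sgn b.2.2 * (Z : ℂ) * siteDelta N (η.1 - b.1) * siteDelta N (η'.1 - b.1) *
    (gam b.2.1 * gamFive) η.2 η'.2

/-- The two bubbles under consideration. -/
inductive BubbleKind where
  | vector : BubbleKind
  | chiral : BubbleKind

/-- The second vertex of the bubble. -/
def secondVertex (N : ℕ) {n : ℕ} (Z : ℝ) : BubbleKind → BLabel n → FLabel n → FLabel n → ℂ
  | BubbleKind.vector => vertex N
  | BubbleKind.chiral => chiralVertex N Z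

/-- The non-interacting bubble `Π^{(h,N]}` or `Π_5^{(h,N]}`. -/
def bubble (χ : ℝ → ℝ) (N : ℕ) {n : ℕ} [NeZero n] (m Z : ℝ) (h : ℕ) (t : BubbleKind)
    (b₁ b₂ : BLabel n) : ℂ :=
  1 / 2 * fInt N fun η₁ : FLabel n => fInt N fun η₁' : FLabel n =>
    fInt N fun η₂ : FLabel n => fInt N fun η₂' : FLabel n =>
      vertex N b₁ η₁ η₁' * secondVertex N Z t b₂ η₂ η₂' *
        fermiKernel χ N m h η₁' η₂ * fermiKernel χ N m h η₂' η₁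

/-- The Fourier transform of the bubble,
`(1/2) ∑ ε ε', ε ε' L ^ (-2) ∫ dx dy exp (-i p · (x - y)) Π((x, μ, ε), (y, ν, ε'))`. -/
def bubbleHat (χ : ℝ → ℝ) (N : ℕ) {n : ℕ} [NeZero n] (m Z : ℝ) (h : ℕ) (t : BubbleKind)
    (p : Site n) (μ ν : Fin 2) : ℂ :=
  1 / 2 * ∑ ε : ℤˣ, ∑ ε' : ℤˣ, sgn ε * sgn ε' *
    (((side N n ^ 2)⁻¹ : ℝ) : ℂ) * siteInt N fun x : Site n => siteInt N fun y : Site n =>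
      phase N p (x - y) * bubble χ N m Z h t (x, μ, ε) (y, ν, ε')

/-- The kernel `v Π̂(0)`, the product being that of the `2 × 2` matrices indexed by directions:
`((x, μ, ε), (y, ν, ε')) ↦ ε ε' ∑ α, v_{μ,α}(x - y) Π̂_{α,ν}(0)`. -/
def mulBubbleZero (χ : ℝ → ℝ) (N : ℕ) {n : ℕ} [NeZero n] (m Z : ℝ) (h : ℕ) (t : BubbleKind)
    (v : Fin 2 → Fin 2 → Site n → ℂ) : BLabel n → BLabel n → ℂ :=
  signKernel fun μ ν x => ∑ α, v μ α x * bubbleHat χ N m Z h t (0 : Site n) α ν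

/-- The antisymmetric tensor with `ε_{0,1} = 1`. -/
def epsTensor : Matrix (Fin 2) (Fin 2) ℂ := !![0, 1; -1, 0]

end

end LatticeQED

open LatticeQED

/-! Everything rests on one decay estimate. A single-scale propagator is a Fourier sum of symbols
cutoff · numerator / denominator, and its kernel at scale j is bounded by C 2^j exp(-c ∑_μ √(2^j
|x_μ|)), uniformly in the lattice (`IsCutoff.exists_kernel_decay`). Along each coordinate line of
momenta the symbol is the sampling of a smooth function of size O(2^{-j}), whose r-th derivative
gains 2^{-jr} up to a Gevrey growth r!² (`gevreyAt_symbol`). Summation by parts turns these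
derivatives into bounds of order r!² on (2^j |x_μ|)^r times the kernel, for all r, and summing over
r yields the stretched exponential (`mul_exp_sqrt_le`). The Dirac determinant and the boson
denominator are both of the form `latDen`, so one argument covers the fermions, the boson and the
gradient of the boson.

Estimate 3. The bubble depends only on the difference of its base points, so v * Π - v Π̂(0) is the
integral of the increments v(z - u) - v(z) against Π(u). An increment costs |u| times the gradient
of v (`siteInt_weight_sub_le`), and it remains to bound the weighted first moment of Π by 2^{-h}. By
the elementary inequality 2|XY| ≤ |X|² + |Y|² this reduces to the moment of |g|². Scale j
contributes 4^j (amplitude squared) · 2^{-j} (length) · 4^{-j} (area) = 2^{-j}, which is summable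
over j > h. That the zeroth moment of Π is really Π̂(0), with the correct sign for each orientation,
is charge conjugation: the bubble summed over its first orientation with sign and integrated is odd
in the second orientation (`sum_sgn_mul_siteInt_bubbleProfile_eq`).

Symmetry and bound of Π̂(0). By orthogonality of the phases Π̂(0) is a single momentum sum of spin
traces divided by the squared determinant D². Reflections k_μ → -k_μ kill the off-diagonal vector
entries, and the exchange of the coordinates identifies the diagonal ones; since γ₀γ₅ = iγ₁ and γ₁γ₅
= -iγ₀, the chiral structure follows from the same traces. Power counting alone would give a
logarithmic divergence, as the trace is of order D. Its leading part 2(s₁² - s₀²) is however odd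
under the exchange of the coordinates and sums to zero exactly on the lattice. The remainder is O(1
+ a²D²), whose sum over momenta converges uniformly (`IsCutoff.norm_quarter_dualInt_le`).

Estimate 4 follows from the other two with v = g^A, whose weighted norm and gradient norm are
bounded uniformly in the lattice. -/

namespace LatticeQED
open Filter Topology

/-! ### Gevrey bounds of class 2: sums, products and reciprocals -/

/-- `f` is smooth at `t` and its derivatives there satisfy Gevrey bounds of class 2. -/
def GevreyAt (f : ℝ → ℝ) (t A B : ℝ) : Prop :=
  ContDiffAt ℝ (⊤ : ℕ∞) f t ∧
    ∀ n : ℕ, |iteratedDeriv n f t| ≤ A * B ^ n * (Nat.factorial n : ℝ) ^ 2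

theorem factorial_mul_sub_le {n i : ℕ} (hi : i ≤ n) :
    ((i.factorial : ℝ) * ((n - i).factorial : ℝ)) ≤ (n.factorial : ℝ) := by
  have := Nat.le_of_dvd n.factorial_pos (Nat.factorial_mul_factorial_dvd_factorial hi)
  exact_mod_cast this

/-- One factor i!(n-i)! cancels the binomial coefficient and the other is at most n!. No binomial is
left over, so that the recursion in `GevreyAt.inv` is a geometric sum. -/
theorem choose_mul_factorial_sq_le {n i : ℕ} (hi : i ≤ n) :
    (n.choose i : ℝ) * ((i.factorial : ℝ) ^ 2 * ((n - i).factorial : ℝ) ^ 2) ≤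
      (n.factorial : ℝ) ^ 2 := by
  have h1 := factorial_mul_sub_le hi
  have h2 : (n.choose i : ℝ) * (i.factorial : ℝ) * ((n - i).factorial : ℝ) = n.factorial := by
    exact_mod_cast Nat.choose_mul_factorial_mul_factorial hi
  calc (n.choose i : ℝ) * ((i.factorial : ℝ) ^ 2 * ((n - i).factorial : ℝ) ^ 2)
      = ((n.choose i : ℝ) * (i.factorial : ℝ) * ((n - i).factorial : ℝ)) *
          ((i.factorial : ℝ) * ((n - i).factorial : ℝ)) := by ring
    _ ≤ (n.factorial : ℝ) * n.factorial := by
        rw [h2]; exact mul_le_mul_of_nonneg_left h1 (by positivity)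
    _ = _ := by ring

namespace GevreyAt

variable {f g : ℝ → ℝ} {t A A' B B' : ℝ}

theorem contDiffAt_nat (hf : GevreyAt f t A B) (n : ℕ) : ContDiffAt ℝ n f t :=
  hf.1.of_le (by exact_mod_cast le_top)

theorem congr (hf : GevreyAt f t A B) (h : g =ᶠ[𝓝 t] f) : GevreyAt g t A B :=
  ⟨hf.1.congr_of_eventuallyEq h, fun n => by rw [h.iteratedDeriv_eq n]; exact hf.2 n⟩

theorem nonneg (hf : GevreyAt f t A B) : 0 ≤ A := by
  have := (abs_nonneg _).trans (hf.2 0)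
  simpa using this

theorem mono (hf : GevreyAt f t A B) (hA : A ≤ A') (hB : 0 ≤ B) (hB' : B ≤ B') :
    GevreyAt f t A' B' := by
  refine ⟨hf.1, fun n => (hf.2 n).trans ?_⟩
  have := hf.nonneg
  have := this.trans hA
  gcongr

theorem add (hf : GevreyAt f t A B) (hg : GevreyAt g t A' B) :
    GevreyAt (fun s => f s + g s) t (A + A') B := by
  refine ⟨hf.1.add hg.1, fun n => ?_⟩
  have := iteratedDeriv_add (hf.contDiffAt_nat n) (hg.contDiffAt_nat n)
  rw [show (fun s => f s + g s) = f + g from rfl, this]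
  refine (abs_add_le _ _).trans ((add_le_add (hf.2 n) (hg.2 n)).trans (le_of_eq (by ring)))

theorem const_mul (hf : GevreyAt f t A B) (c : ℝ) :
    GevreyAt (fun s => c * f s) t (|c| * A) B := by
  refine ⟨contDiffAt_const.mul hf.1, fun n => ?_⟩
  rw [iteratedDeriv_const_mul_field, abs_mul]
  refine (mul_le_mul_of_nonneg_left (hf.2 n) (abs_nonneg _)).trans (le_of_eq (by ring))

/-- In the Leibniz formula the binomial coefficients are spent on expanding (B + B')^n, so the rates
add; the factorials only need i!(n-i)! ≤ n!. -/
theorem mul (hf : GevreyAt f t A B) (hg : GevreyAt g t A' B') (hB : 0 ≤ B) (hB' : 0 ≤ B') :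
    GevreyAt (fun s => f s * g s) t (A * A') (B + B') := by
  refine ⟨hf.1.mul hg.1, fun n => ?_⟩
  have hA := hf.nonneg
  have hA' := hg.nonneg
  have := iteratedDeriv_mul (hf.contDiffAt_nat n) (hg.contDiffAt_nat n)
  rw [show (fun s => f s * g s) = f * g from rfl, this]
  refine (Finset.abs_sum_le_sum_abs _ _).trans ?_
  rw [add_pow, Finset.mul_sum, Finset.sum_mul]
  refine Finset.sum_le_sum fun i hi => ?_
  have hi : i ≤ n := Nat.lt_succ_iff.1 (Finset.mem_range.1 hi)
  rw [abs_mul, abs_mul, Nat.abs_cast]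
  have h1 := factorial_mul_sub_le hi
  calc (n.choose i : ℝ) * |iteratedDeriv i f t| * |iteratedDeriv (n - i) g t|
      ≤ (n.choose i : ℝ) * (A * B ^ i * (i.factorial : ℝ) ^ 2) *
          (A' * B' ^ (n - i) * ((n - i).factorial : ℝ) ^ 2) := by
        gcongr
        · exact hf.2 i
        · exact hg.2 _
    _ = A * A' * (B ^ i * B' ^ (n - i) * (n.choose i : ℝ)) *
          ((i.factorial : ℝ) * ((n - i).factorial : ℝ)) ^ 2 := by ring
    _ ≤ _ := by gcongr

/-- Relative Gevrey bounds pass to the reciprocal. -/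
theorem inv {K b : ℝ} (hK : 0 < K) (hb : 0 ≤ b) (h0 : f t ≠ 0)
    (hf : GevreyAt f t (|f t| * K) b) :
    GevreyAt (fun s => (f s)⁻¹) t |f t|⁻¹ ((1 + K) * b) := by
  have hsm : ContDiffAt ℝ (⊤ : ℕ∞) (fun s => (f s)⁻¹) t := hf.1.inv h0
  refine ⟨hsm, fun n => ?_⟩
  have hpos : 0 < |f t| := abs_pos.2 h0
  induction n using Nat.strong_induction_on with
  | _ n ih =>
    rcases Nat.eq_zero_or_pos n with rfl | hn
    · simp
    -- Differentiating f⁻¹ · f = 1 expresses the n-th derivative of f⁻¹ through its lower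
    -- derivatives.
    have hone : (fun s => (f s)⁻¹) * f =ᶠ[𝓝 t] fun _ => (1 : ℝ) := by
      filter_upwards [hf.1.continuousAt.eventually_ne h0] with s hs
      exact inv_mul_cancel₀ hs
    have h1 : iteratedDeriv n ((fun s => (f s)⁻¹) * f) t = 0 := by
      rw [hone.iteratedDeriv_eq n, iteratedDeriv_const, if_neg hn.ne']
    rw [iteratedDeriv_mul (hsm.of_le (by exact_mod_cast le_top)) (hf.contDiffAt_nat n),
      Finset.sum_range_succ] at h1
    simp only [Nat.choose_self, Nat.cast_one, one_mul, Nat.sub_self, iteratedDeriv_zero] at h1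
    have h2 : iteratedDeriv n (fun s => (f s)⁻¹) t * f t = -∑ i ∈ Finset.range n,
        n.choose i * iteratedDeriv i (fun s => (f s)⁻¹) t * iteratedDeriv (n - i) f t := by
      linarith
    have h3 : |iteratedDeriv n (fun s => (f s)⁻¹) t| * |f t| ≤
        b ^ n * (n.factorial : ℝ) ^ 2 * ((∑ i ∈ Finset.range n, (1 + K) ^ i) * K) := by
      rw [← abs_mul, h2, abs_neg, Finset.sum_mul, Finset.mul_sum]
      refine (Finset.abs_sum_le_sum_abs _ _).trans (Finset.sum_le_sum fun i hi => ?_)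
      have hi : i < n := Finset.mem_range.1 hi
      rw [abs_mul, abs_mul, Nat.abs_cast]
      calc (n.choose i : ℝ) * |iteratedDeriv i (fun s => (f s)⁻¹) t| * |iteratedDeriv (n - i) f t|
          ≤ (n.choose i : ℝ) * (|f t|⁻¹ * ((1 + K) * b) ^ i * (i.factorial : ℝ) ^ 2) *
            (|f t| * K * b ^ (n - i) * ((n - i).factorial : ℝ) ^ 2) := by
            gcongr
            · exact ih i hi
            · exact hf.2 _
        _ = (b ^ i * b ^ (n - i)) * ((1 + K) ^ i * K) * (|f t|⁻¹ * |f t|) * ((n.choose i : ℝ) *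
              ((i.factorial : ℝ) ^ 2 * ((n - i).factorial : ℝ) ^ 2)) := by
            rw [mul_pow]; ring
        _ ≤ (b ^ i * b ^ (n - i)) * ((1 + K) ^ i * K) * (|f t|⁻¹ * |f t|) *
              (n.factorial : ℝ) ^ 2 := by
            gcongr
            exact choose_mul_factorial_sq_le hi.le
        _ = _ := by
            rw [← pow_add, Nat.add_sub_cancel' hi.le, inv_mul_cancel₀ hpos.ne']; ring
    -- The ratio 1 + K is the one that closes the recursion: K ∑_{i<n} (1+K)^i = (1+K)^n - 1.
    have h4 : (∑ i ∈ Finset.range n, (1 + K) ^ i) * K = (1 + K) ^ n - 1 := by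
      have := geom_sum_mul (1 + K) n
      simpa using this
    rw [h4] at h3
    have h5 : |iteratedDeriv n (fun s => (f s)⁻¹) t| * |f t| ≤
        b ^ n * (n.factorial : ℝ) ^ 2 * (1 + K) ^ n := by
      refine h3.trans (mul_le_mul_of_nonneg_left (by linarith) (by positivity))
    calc |iteratedDeriv n (fun s => (f s)⁻¹) t|
        = |iteratedDeriv n (fun s => (f s)⁻¹) t| * |f t| * |f t|⁻¹ := by
          field_simp
      _ ≤ b ^ n * (n.factorial : ℝ) ^ 2 * (1 + K) ^ n * |f t|⁻¹ := by gcongr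
      _ = _ := by rw [mul_pow]; ring

theorem comp_add_const {c : ℝ} (hf : GevreyAt f (t + c) A B) :
    GevreyAt (fun s => f (s + c)) t A B := by
  refine ⟨hf.1.comp t (contDiffAt_id.add contDiffAt_const), fun n => ?_⟩
  rw [iteratedDeriv_comp_add_const]
  exact hf.2 n

end GevreyAt

theorem gevreyAt_const (c t B : ℝ) (hB : 0 ≤ B) : GevreyAt (fun _ => c) t |c| B := by
  refine ⟨contDiffAt_const, fun n => ?_⟩
  rw [iteratedDeriv_const]
  split_ifs with h
  · simp [h]
  · rw [abs_zero]; positivity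

/-! ### Gevrey bounds of a radial cutoff along a coordinate line -/

section Radial

variable (χ : ℝ → ℝ) (q : ℝ)

/-- The family of functions spanned by the derivatives of `t ↦ χ √(t² + q²)`. -/
noncomputable def radialTerm (i a b : ℕ) (t : ℝ) : ℝ :=
  iteratedDeriv i χ √(t ^ 2 + q ^ 2) * (t / √(t ^ 2 + q ^ 2)) ^ a * (√(t ^ 2 + q ^ 2))⁻¹ ^ b

variable {χ q}

theorem hasDerivAt_radius {t : ℝ} (ht : 0 < t ^ 2 + q ^ 2) :
    HasDerivAt (fun s : ℝ => √(s ^ 2 + q ^ 2)) (t / √(t ^ 2 + q ^ 2)) t := by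
  have h := (((hasDerivAt_id t).pow 2).add_const (q ^ 2)).sqrt (by simpa using ht.ne')
  refine h.congr_deriv ?_
  simp
  field_simp

theorem contDiffAt_radialTerm (hχ : ContDiff ℝ (⊤ : ℕ∞) χ) (i a b : ℕ) {t : ℝ}
    (ht : 0 < t ^ 2 + q ^ 2) : ContDiffAt ℝ (⊤ : ℕ∞) (radialTerm χ q i a b) t := by
  have hu : ContDiffAt ℝ (⊤ : ℕ∞) (fun s : ℝ => √(s ^ 2 + q ^ 2)) t :=
    ((contDiffAt_id.pow 2).add contDiffAt_const).sqrt ht.ne'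
  have hne : √(t ^ 2 + q ^ 2) ≠ 0 := (Real.sqrt_pos.2 ht).ne'
  have h1 : ContDiff ℝ (⊤ : ℕ∞) (iteratedDeriv i χ) := by
    rw [iteratedDeriv_eq_iterate]
    exact hχ.iterate_deriv i
  exact (((h1.contDiffAt.comp t hu).mul ((contDiffAt_id.div hu hne).pow a)).mul
    ((hu.inv hne).pow b))

/-- With u the radius and y = t/u one has u' = y, y' = (1 - y²)/u and (1/u)' = -y/u². The family is
therefore closed under differentiation, with coefficients linear in the exponents. -/
theorem hasDerivAt_radialTerm (hχ : ContDiff ℝ (⊤ : ℕ∞) χ) (i a b : ℕ) {t : ℝ}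
    (ht : 0 < t ^ 2 + q ^ 2) :
    HasDerivAt (radialTerm χ q i a b)
      (radialTerm χ q (i + 1) (a + 1) b t + (a * radialTerm χ q i (a - 1) (b + 1) t +
        -((a + b : ℝ) * radialTerm χ q i (a + 1) (b + 1) t))) t := by
  have hu := hasDerivAt_radius ht
  have hpos : 0 < √(t ^ 2 + q ^ 2) := Real.sqrt_pos.2 ht
  have h1 : HasDerivAt (iteratedDeriv i χ) (iteratedDeriv (i + 1) χ √(t ^ 2 + q ^ 2))
      √(t ^ 2 + q ^ 2) := by
    rw [iteratedDeriv_succ]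
    exact ((hχ.differentiable_iteratedDeriv i (by exact_mod_cast WithTop.coe_lt_top _))
      _).hasDerivAt
  have hc := h1.comp t hu
  have hy := ((hasDerivAt_id t).div hu hpos.ne').pow a
  have hv := (hu.inv hpos.ne').pow b
  refine ((hc.mul hy).mul hv).congr_deriv ?_
  simp only [radialTerm, Function.comp, id, Pi.pow_apply, Pi.inv_apply, Pi.div_apply,
    Pi.mul_apply]
  have hsq : √(t ^ 2 + q ^ 2) ^ 2 = t ^ 2 + q ^ 2 := Real.sq_sqrt ht.le
  generalize √(t ^ 2 + q ^ 2) = u at *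
  rcases a with _ | a <;> rcases b with _ | b <;> simp [pow_succ] <;> field_simp <;> ring

/-- The auxiliary index l dominates all three exponents; a differentiation raises it by one and
costs (l+1)² (B+6). Here B(i+1)² comes from differentiating `χ`, and 6 from the coefficients a ≤ l
and a + b ≤ 2l, doubled because each extra power of 1/u costs a factor 2. -/
theorem abs_iteratedDeriv_radialTerm_le (hχ : ContDiff ℝ (⊤ : ℕ∞) χ) {A B : ℝ} (hA : 0 ≤ A)
    (hB : 0 ≤ B) (hb : ∀ (j : ℕ) (t : ℝ), |iteratedDeriv j χ t| ≤ A * B ^ j * (j.factorial : ℝ) ^ 2)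
    {t : ℝ} (ht : 1 / 4 ≤ t ^ 2 + q ^ 2) (n : ℕ) :
    ∀ i a b l : ℕ, i ≤ l → a ≤ l → b ≤ l →
      |iteratedDeriv n (radialTerm χ q i a b) t| ≤
        A * B ^ i * (i.factorial : ℝ) ^ 2 * 2 ^ b * (B + 6) ^ n *
          (((l + n).factorial : ℝ) / l.factorial) ^ 2 := by
  have hpos : 0 < t ^ 2 + q ^ 2 := by linarith
  induction n with
  | zero =>
    intro i a b l hi ha hbl
    have hu : 1 / 2 ≤ √(t ^ 2 + q ^ 2) := by
      rw [show (1 / 2 : ℝ) = √(1 / 4) by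
        rw [show (1 / 4 : ℝ) = (1 / 2) ^ 2 by norm_num, Real.sqrt_sq (by norm_num)]]
      exact Real.sqrt_le_sqrt ht
    have hu0 : 0 < √(t ^ 2 + q ^ 2) := by linarith
    have h1 : |t / √(t ^ 2 + q ^ 2)| ≤ 1 := by
      rw [abs_div, abs_of_pos hu0, div_le_one hu0]
      exact Real.abs_le_sqrt (by nlinarith [sq_nonneg q])
    have h2 : (√(t ^ 2 + q ^ 2))⁻¹ ≤ 2 := by
      rw [inv_le_comm₀ hu0 (by norm_num)]; linarith
    have hl : (l.factorial : ℝ) ≠ 0 := by positivity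
    simp only [iteratedDeriv_zero, pow_zero, mul_one, add_zero, div_self hl, one_pow]
    unfold radialTerm
    rw [abs_mul, abs_mul, abs_pow, abs_pow, abs_of_pos (inv_pos.2 hu0)]
    calc _ ≤ (A * B ^ i * (i.factorial : ℝ) ^ 2) * 1 ^ a * 2 ^ b := by
          gcongr
          exact hb _ _
      _ = _ := by ring
  | succ n ih =>
    intro i a b l hi ha hbl
    have hev : deriv (radialTerm χ q i a b) =ᶠ[𝓝 t]
        (radialTerm χ q (i + 1) (a + 1) b + ((a : ℝ) • radialTerm χ q i (a - 1) (b + 1) +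
          (-(a + b : ℝ)) • radialTerm χ q i (a + 1) (b + 1))) := by
      have hopen : ∀ᶠ s in 𝓝 t, 0 < s ^ 2 + q ^ 2 := by
        have : ContinuousAt (fun s : ℝ => s ^ 2 + q ^ 2) t := by fun_prop
        exact this.eventually (lt_mem_nhds hpos)
      filter_upwards [hopen] with s hs
      rw [(hasDerivAt_radialTerm hχ i a b hs).deriv]
      simp only [Pi.add_apply, Pi.smul_apply, smul_eq_mul]
      ring
    have hsm : ∀ i a b, ContDiffAt ℝ (n : ℕ) (radialTerm χ q i a b) t := fun i a b =>
      (contDiffAt_radialTerm hχ i a b hpos).of_le (by exact_mod_cast le_top)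
    have hsm' : ∀ (c : ℝ) (i a b), ContDiffAt ℝ (n : ℕ) (c • radialTerm χ q i a b) t :=
      fun c i a b => (hsm i a b).const_smul c
    have hsm'' : ∀ (c d : ℝ) (i a b i' a' b'), ContDiffAt ℝ (n : ℕ)
        (c • radialTerm χ q i a b + d • radialTerm χ q i' a' b') t :=
      fun c d i a b i' a' b' => (hsm' c i a b).add (hsm' d i' a' b')
    rw [iteratedDeriv_succ', hev.iteratedDeriv_eq n,
      iteratedDeriv_add (hsm _ _ _) (hsm'' _ _ _ _ _ _ _ _),
      iteratedDeriv_add (hsm' _ _ _ _) (hsm' _ _ _ _),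
      iteratedDeriv_const_smul_field, iteratedDeriv_const_smul_field]
    have e1 := ih (i + 1) (a + 1) b (l + 1) (by omega) (by omega) (by omega)
    have e2 := ih i (a - 1) (b + 1) (l + 1) (by omega) (by omega) (by omega)
    have e3 := ih i (a + 1) (b + 1) (l + 1) (by omega) (by omega) (by omega)
    have hil : (i : ℝ) ≤ l := by exact_mod_cast hi
    have hal : (a : ℝ) ≤ l := by exact_mod_cast ha
    have hbl' : (b : ℝ) ≤ l := by exact_mod_cast hbl
    have hl0 : (0 : ℝ) ≤ l := by positivity
    set Q := (((l + 1 + n).factorial : ℝ) / (l + 1).factorial) ^ 2 with hQ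
    have hQ' : (((l + (n + 1)).factorial : ℝ) / l.factorial) ^ 2 = ((l : ℝ) + 1) ^ 2 * Q := by
      rw [hQ, show l + (n + 1) = l + 1 + n by ring, Nat.factorial_succ l]
      push_cast
      have : (l.factorial : ℝ) ≠ 0 := by positivity
      field_simp
    set W := A * B ^ i * (i.factorial : ℝ) ^ 2 * 2 ^ b * (B + 6) ^ n * Q with hW
    have hW0 : 0 ≤ W := by positivity
    have f1 : |iteratedDeriv n (radialTerm χ q (i + 1) (a + 1) b) t| ≤
        B * ((l : ℝ) + 1) ^ 2 * W := by
      refine e1.trans ?_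
      rw [Nat.factorial_succ]
      push_cast
      calc _ = B * ((i : ℝ) + 1) ^ 2 * W := by rw [hW]; ring
        _ ≤ _ := by gcongr
    have f2 : |iteratedDeriv n (radialTerm χ q i (a - 1) (b + 1)) t| ≤ 2 * W :=
      e2.trans (le_of_eq (by rw [hW]; ring))
    have f3 : |iteratedDeriv n (radialTerm χ q i (a + 1) (b + 1)) t| ≤ 2 * W :=
      e3.trans (le_of_eq (by rw [hW]; ring))
    calc _ ≤ |iteratedDeriv n (radialTerm χ q (i + 1) (a + 1) b) t| +
          (|(a : ℝ)| * |iteratedDeriv n (radialTerm χ q i (a - 1) (b + 1)) t| +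
           |-(a + b : ℝ)| * |iteratedDeriv n (radialTerm χ q i (a + 1) (b + 1)) t|) := by
          refine (abs_add_le _ _).trans (add_le_add le_rfl ((abs_add_le _ _).trans ?_))
          rw [smul_eq_mul, smul_eq_mul, abs_mul, abs_mul]
      _ ≤ B * ((l : ℝ) + 1) ^ 2 * W + (l * (2 * W) + (2 * l) * (2 * W)) := by
          rw [abs_neg, Nat.abs_cast, abs_of_nonneg (by positivity : (0 : ℝ) ≤ a + b)]
          gcongr
          linarith
      _ ≤ (B + 6) * ((l : ℝ) + 1) ^ 2 * W := by nlinarith [mul_nonneg hl0 hW0, sq_nonneg (l : ℝ)]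
      _ = _ := by rw [hQ', hW]; ring

/-- The function `t ↦ χ √(t² + q²)` inherits the Gevrey bounds of a cutoff `χ`. -/
theorem gevreyAt_radial {A B : ℝ} (hχ : ContDiff ℝ (⊤ : ℕ∞) χ) (hA : 1 ≤ A) (hB : 0 ≤ B)
    (hone : ∀ t ∈ Set.Icc (0 : ℝ) (1 / 2), χ t = 1)
    (hb : ∀ (j : ℕ) (t : ℝ), |iteratedDeriv j χ t| ≤ A * B ^ j * (j.factorial : ℝ) ^ 2) (t : ℝ) :
    GevreyAt (fun s => χ √(s ^ 2 + q ^ 2)) t A (B + 6) := by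
  by_cases ht : 1 / 4 ≤ t ^ 2 + q ^ 2
  · have heq : (fun s => χ √(s ^ 2 + q ^ 2)) = radialTerm χ q 0 0 0 := by
      ext s; simp [radialTerm]
    rw [heq]
    refine ⟨contDiffAt_radialTerm hχ 0 0 0 (by linarith), fun n => ?_⟩
    have := abs_iteratedDeriv_radialTerm_le hχ (by linarith) hB hb ht n 0 0 0 0 le_rfl le_rfl le_rfl
    simpa using this
  · have hev : (fun s => χ √(s ^ 2 + q ^ 2)) =ᶠ[𝓝 t] fun _ => (1 : ℝ) := by
      have : ContinuousAt (fun s : ℝ => s ^ 2 + q ^ 2) t := by fun_prop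
      filter_upwards [this.eventually (gt_mem_nhds (not_le.1 ht))] with s hs
      refine hone _ ⟨Real.sqrt_nonneg _, ?_⟩
      rw [Real.sqrt_le_left (by norm_num)]
      norm_num at hs ⊢
      linarith
    refine ((gevreyAt_const 1 t (B + 6) (by linarith)).congr hev).mono ?_ (by linarith) le_rfl
    simpa using hA

end Radial


/-! ### Rescaling and periodisation -/

theorem contDiff_of_gevreyAt {f : ℝ → ℝ} {A B : ℝ} (hf : ∀ t, GevreyAt f t A B) :
    ContDiff ℝ (⊤ : ℕ∞) f :=
  contDiff_iff_contDiffAt.2 fun t => (hf t).1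

theorem GevreyAt.comp_const_mul {f : ℝ → ℝ} {A B : ℝ} (hf : ∀ t, GevreyAt f t A B) (c t : ℝ) :
    GevreyAt (fun s => f (c * s)) t A (|c| * B) := by
  refine ⟨((contDiff_of_gevreyAt hf).comp (contDiff_const.mul contDiff_id)).contDiffAt,
    fun n => ?_⟩
  rw [iteratedDeriv_comp_const_mul ((contDiff_of_gevreyAt hf).of_le (by exact_mod_cast le_top))]
  simp only
  rw [abs_mul, abs_pow]
  calc |c| ^ n * |iteratedDeriv n f (c * t)| ≤ |c| ^ n * (A * B ^ n * (n.factorial : ℝ) ^ 2) := by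
        gcongr; exact (hf _).2 n
    _ = _ := by rw [mul_pow]; ring

/-- The representative of `t` modulo `P` of least absolute value. -/
noncomputable def centeredRep (P t : ℝ) : ℝ := t - P * round (t / P)

theorem abs_centeredRep_le (P t : ℝ) (hP : 0 < P) (z : ℤ) :
    |centeredRep P t| ≤ |t - P * z| := by
  have h := round_le (t / P) z
  have e : ∀ w : ℝ, |t - P * w| = P * |t / P - w| := fun w => by
    rw [← abs_of_pos hP, ← abs_mul, abs_of_pos hP, mul_sub, mul_div_cancel₀ _ hP.ne']
  rw [centeredRep, e, e]
  exact mul_le_mul_of_nonneg_left h hP.le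

theorem abs_centeredRep_le_half (P t : ℝ) (hP : 0 < P) : |centeredRep P t| ≤ P / 2 := by
  have h := abs_sub_round (t / P)
  have e : |centeredRep P t| = P * |t / P - round (t / P)| := by
    rw [centeredRep, ← abs_of_pos hP, ← abs_mul, abs_of_pos hP, mul_sub, mul_div_cancel₀ _ hP.ne']
  rw [e]
  nlinarith

/-- Only absolute values agree: at |t| = P/2 the rounding may select the opposite endpoint of the
cell. This suffices because the cutoff is even in each momentum component. -/
theorem abs_centeredRep_add_int_mul {P t : ℝ} (hP : 0 < P) (z : ℤ) (ht : |t| ≤ P / 2) :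
    |centeredRep P (t + P * z)| = |t| := by
  refine le_antisymm ((abs_centeredRep_le P _ hP z).trans (by simp)) ?_
  set w : ℤ := round ((t + P * z) / P) - z with hw
  have e : centeredRep P (t + P * z) = t - P * w := by
    rw [centeredRep, hw]; push_cast; ring
  rw [e]
  by_cases h0 : w = 0
  · simp [h0]
  · have h1 : (1 : ℝ) ≤ |(w : ℝ)| := by exact_mod_cast Int.one_le_abs h0
    have h2 : |P * (w : ℝ)| ≤ |t - P * w| + |t| := by
      have := abs_sub (t) (t - P * (w : ℝ))
      rw [sub_sub_cancel] at this
      linarith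
    rw [abs_mul, abs_of_pos hP] at h2
    nlinarith

/-- Inside a cell the periodic extension is locally a translate of φ. Near a cell boundary it
vanishes, as the support of φ stops at b < P/2. -/
theorem gevreyAt_periodize {φ : ℝ → ℝ} {A B P b : ℝ} (hP : 0 < P) (hb : b < P / 2)
    (hB : 0 ≤ B) (hφ : ∀ t, GevreyAt φ t A B) (h0 : ∀ t, b ≤ |t| → φ t = 0) (t : ℝ) :
    GevreyAt (fun s => φ (centeredRep P s)) t A B := by
  by_cases ht : |centeredRep P t| < P / 2
  · set m : ℤ := round (t / P) with hm
    have hev : (fun s => φ (centeredRep P s)) =ᶠ[𝓝 t] fun s => φ (s + -(P * m)) := by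
      have hc : ContinuousAt (fun s : ℝ => |s - P * m|) t := by fun_prop
      filter_upwards [hc.eventually (gt_mem_nhds ht)] with s hs
      -- Another rounding integer would force P ≤ |s - P m| + |centeredRep P s| < P.
      have : round (s / P) = m := by
        by_contra hne
        have h1 : (1 : ℝ) ≤ |((round (s / P) - m : ℤ) : ℝ)| := by
          exact_mod_cast Int.one_le_abs (sub_ne_zero.2 hne)
        have h2 := abs_centeredRep_le_half P s hP
        have h3 : |P * ((round (s / P) - m : ℤ) : ℝ)| ≤ |s - P * m| + |centeredRep P s| := by
          have := abs_sub (s - P * m) (centeredRep P s)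
          refine le_trans (le_of_eq ?_) this
          congr 1
          rw [centeredRep]; push_cast; ring
        rw [abs_mul, abs_of_pos hP] at h3
        nlinarith
      simp only [centeredRep, this, sub_eq_add_neg]
    exact (GevreyAt.comp_add_const (hφ _)).congr hev
  · have hev : (fun s => φ (centeredRep P s)) =ᶠ[𝓝 t] fun _ => (0 : ℝ) := by
      have hc : ContinuousAt (fun s : ℝ => |t - s|) t := by fun_prop
      have hlt : |t - t| < P / 2 - b := by simpa using hb
      filter_upwards [hc.eventually (gt_mem_nhds hlt)] with s hs
      apply h0
      have h1 := abs_centeredRep_le P t hP (round (s / P))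
      have h2 : |t - P * (round (s / P) : ℝ)| ≤ |t - s| + |centeredRep P s| := by
        rw [centeredRep]
        refine le_trans (le_of_eq ?_) (abs_add_le _ _)
        congr 1; ring
      linarith [not_lt.1 ht]
    have := (gevreyAt_const 0 t B hB).congr hev
    exact this.mono (by simpa using (hφ t).nonneg) hB le_rfl

theorem abs_iteratedDeriv_cos_mul_le (c : ℝ) (n : ℕ) (t : ℝ) :
    |iteratedDeriv n (fun s => Real.cos (c * s)) t| ≤ |c| ^ n := by
  rw [iteratedDeriv_comp_const_mul Real.contDiff_cos]
  simp only
  rw [abs_mul, abs_pow]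
  exact mul_le_of_le_one_right (by positivity) (Real.abs_iteratedDeriv_cos_le_one n _)

theorem abs_iteratedDeriv_sin_mul_le (c : ℝ) (n : ℕ) (t : ℝ) :
    |iteratedDeriv n (fun s => Real.sin (c * s)) t| ≤ |c| ^ n := by
  rw [iteratedDeriv_comp_const_mul Real.contDiff_sin]
  simp only
  rw [abs_mul, abs_pow]
  exact mul_le_of_le_one_right (by positivity) (Real.abs_iteratedDeriv_sin_le_one n _)

theorem one_le_factorial_sq (n : ℕ) : (1 : ℝ) ≤ (n.factorial : ℝ) ^ 2 :=
  one_le_pow₀ (by exact_mod_cast n.factorial_pos)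

/-- A convenient way to get Gevrey bounds from bounds without factorials. -/
theorem gevreyAt_of_le {f : ℝ → ℝ} {t A B : ℝ} (hA : 0 ≤ A) (hB : 0 ≤ B)
    (hf : ContDiffAt ℝ (⊤ : ℕ∞) f t)
    (h : ∀ n, |iteratedDeriv n f t| ≤ A * B ^ n) : GevreyAt f t A B :=
  ⟨hf, fun n => (h n).trans (le_mul_of_one_le_right (by positivity) (one_le_factorial_sq n))⟩

/-! ### Lattice sines and versines relative to the denominator -/

section Trig

/-- The lattice sine `2^N sin (2^{-N} t)`. -/
noncomputable def latSin (N : ℕ) (t : ℝ) : ℝ := 2 ^ N * Real.sin (((2 : ℝ) ^ N)⁻¹ * t)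

/-- The lattice versine `2^N (1 - cos (2^{-N} t))`. -/
noncomputable def latVer (N : ℕ) (t : ℝ) : ℝ := 2 ^ N * (1 - Real.cos (((2 : ℝ) ^ N)⁻¹ * t))

theorem latVer_nonneg (N : ℕ) (t : ℝ) : 0 ≤ latVer N t :=
  mul_nonneg (by positivity) (by linarith [Real.cos_le_one (((2 : ℝ) ^ N)⁻¹ * t)])

theorem latVer_le (N : ℕ) (t : ℝ) : latVer N t ≤ 2 * 2 ^ N := by
  have := Real.neg_one_le_cos (((2 : ℝ) ^ N)⁻¹ * t)
  have h : (0 : ℝ) < 2 ^ N := by positivity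
  unfold latVer
  nlinarith

/-- This identity makes the Dirac determinant a polynomial in the versines, affine along each
coordinate line. -/
theorem latSin_sq (N : ℕ) (t : ℝ) :
    latSin N t ^ 2 = 2 * (2 ^ N * latVer N t) - latVer N t ^ 2 := by
  unfold latSin latVer
  rw [mul_pow, Real.sin_sq]; ring

theorem latSin_sq_le (N : ℕ) (t : ℝ) : latSin N t ^ 2 ≤ 2 * (2 ^ N * latVer N t) := by
  rw [latSin_sq]; nlinarith [sq_nonneg (latVer N t)]

theorem latVer_sq_le (N : ℕ) (t : ℝ) : latVer N t ^ 2 ≤ 2 * (2 ^ N * latVer N t) := by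
  nlinarith [latVer_nonneg N t, latVer_le N t]

theorem contDiff_latSin (N : ℕ) : ContDiff ℝ (⊤ : ℕ∞) (latSin N) := by
  unfold latSin; fun_prop

theorem contDiff_latVer (N : ℕ) : ContDiff ℝ (⊤ : ℕ∞) (latVer N) := by
  unfold latVer; fun_prop

theorem abs_iteratedDeriv_latSin_le (N n : ℕ) (t : ℝ) :
    |iteratedDeriv n (latSin N) t| ≤ 2 ^ N * ((2 : ℝ) ^ N)⁻¹ ^ n := by
  have h := abs_iteratedDeriv_sin_mul_le (((2 : ℝ) ^ N)⁻¹) n t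
  rw [abs_of_pos (by positivity : (0 : ℝ) < ((2 : ℝ) ^ N)⁻¹)] at h
  unfold latSin
  rw [iteratedDeriv_const_mul_field, abs_mul, abs_of_pos (by positivity)]
  gcongr

theorem abs_iteratedDeriv_latVer_le (N n : ℕ) (t : ℝ) (hn : 0 < n) :
    |iteratedDeriv n (latVer N) t| ≤ 2 ^ N * ((2 : ℝ) ^ N)⁻¹ ^ n := by
  have h := abs_iteratedDeriv_cos_mul_le (((2 : ℝ) ^ N)⁻¹) n t
  rw [abs_of_pos (by positivity : (0 : ℝ) < ((2 : ℝ) ^ N)⁻¹)] at h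
  unfold latVer
  rw [iteratedDeriv_const_mul_field, abs_mul, abs_of_pos (by positivity),
    iteratedDeriv_const_sub hn, iteratedDeriv_neg, abs_neg]
  gcongr

theorem deriv_latVer (N : ℕ) (t : ℝ) : deriv (latVer N) t = ((2 : ℝ) ^ N)⁻¹ * latSin N t := by
  unfold latVer latSin
  have h : HasDerivAt (fun s : ℝ => ((2 : ℝ) ^ N)⁻¹ * s) (((2 : ℝ) ^ N)⁻¹) t := by
    simpa using (hasDerivAt_id t).const_mul (((2 : ℝ) ^ N)⁻¹)
  rw [((h.cos.const_sub 1).const_mul _).deriv]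
  ring

/-- The n-th derivative of a lattice trigonometric function has size a^{n-1} with a ≤ 2^{-j}. The
order n = 0 is excluded, since there 2^N may exceed 2^j. -/
theorem pow_scale_le {N j n : ℕ} (hj : j ≤ N) (hn : 0 < n) :
    (2 : ℝ) ^ N * ((2 : ℝ) ^ N)⁻¹ ^ n ≤ 2 ^ j * ((2 : ℝ) ^ j)⁻¹ ^ n := by
  obtain ⟨k, rfl⟩ := Nat.exists_eq_succ_of_ne_zero hn.ne'
  have e : ∀ M : ℕ, (2 : ℝ) ^ M * ((2 : ℝ) ^ M)⁻¹ ^ (k + 1) = ((2 : ℝ) ^ M)⁻¹ ^ k := fun M => by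
    rw [pow_succ, mul_comm, mul_assoc, inv_mul_cancel₀ (by positivity), mul_one]
  rw [Nat.succ_eq_add_one, e, e]
  have : (2 : ℝ) ^ j ≤ 2 ^ N := pow_le_pow_right₀ (by norm_num) hj
  gcongr

variable {N j : ℕ} {d t D : ℝ}

/-- Converts the scale 2^j into √D, so that numerators and derivatives are all measured relative to
the denominator. -/
theorem scale_le_sqrt (hd : 0 < d) (hd1 : d ≤ 1) (hD : d * 4 ^ j ≤ D) : (2 : ℝ) ^ j ≤ √D / d := by
  rw [le_div_iff₀ hd]
  apply Real.le_sqrt_of_sq_le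
  have : ((2 : ℝ) ^ j * d) ^ 2 = d * (d * 4 ^ j) := by
    rw [mul_pow, ← pow_mul, mul_comm j 2, pow_mul]; norm_num; ring
  rw [this]
  have h4 : 0 < d * (4 : ℝ) ^ j := by positivity
  nlinarith

theorem gevreyAt_latSin (hj : j ≤ N) (hd : 0 < d) (hd1 : d ≤ 1) (hD : d * 4 ^ j ≤ D)
    (hv : 2 ^ N * latVer N t ≤ D) : GevreyAt (latSin N) t (√D * (2 / d)) ((2 : ℝ) ^ j)⁻¹ := by
  refine gevreyAt_of_le (by positivity) (by positivity) (contDiff_latSin N).contDiffAt fun n => ?_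
  have h2 := scale_le_sqrt hd hd1 hD
  rcases Nat.eq_zero_or_pos n with rfl | hn
  · simp only [iteratedDeriv_zero, pow_zero, mul_one]
    have hD0 : 0 ≤ D := le_trans (by positivity) hD
    have h1 : |latSin N t| ≤ √(4 * D) :=
      Real.abs_le_sqrt ((latSin_sq_le N t).trans (by linarith))
    rw [show (4 : ℝ) * D = 2 ^ 2 * D by ring, Real.sqrt_mul (by norm_num),
      Real.sqrt_sq (by norm_num)] at h1
    refine h1.trans ?_
    rw [mul_comm]
    gcongr
    rw [le_div_iff₀ hd]; linarith
  · refine ((abs_iteratedDeriv_latSin_le N n t).trans (pow_scale_le hj hn)).trans ?_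
    gcongr
    refine h2.trans ?_
    rw [div_eq_mul_inv, div_eq_mul_inv]
    gcongr
    have : 0 < d⁻¹ := by positivity
    linarith

theorem gevreyAt_latVer (hj : j ≤ N) (hd : 0 < d) (hd1 : d ≤ 1) (hD : d * 4 ^ j ≤ D)
    (hv : 2 ^ N * latVer N t ≤ D) : GevreyAt (latVer N) t (√D * (2 / d)) ((2 : ℝ) ^ j)⁻¹ := by
  refine gevreyAt_of_le (by positivity) (by positivity) (contDiff_latVer N).contDiffAt fun n => ?_
  have h2 := scale_le_sqrt hd hd1 hD
  rcases Nat.eq_zero_or_pos n with rfl | hn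
  · simp only [iteratedDeriv_zero, pow_zero, mul_one]
    have hD0 : 0 ≤ D := le_trans (by positivity) hD
    have h1 : |latVer N t| ≤ √(4 * D) :=
      Real.abs_le_sqrt ((latVer_sq_le N t).trans (by linarith))
    rw [show (4 : ℝ) * D = 2 ^ 2 * D by ring, Real.sqrt_mul (by norm_num),
      Real.sqrt_sq (by norm_num)] at h1
    refine h1.trans ?_
    rw [mul_comm]
    gcongr
    rw [le_div_iff₀ hd]; linarith
  · refine ((abs_iteratedDeriv_latVer_le N n t hn).trans (pow_scale_le hj hn)).trans ?_
    gcongr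
    refine h2.trans ?_
    rw [div_eq_mul_inv, div_eq_mul_inv]
    gcongr
    have : 0 < d⁻¹ := by positivity
    linarith

/-- Relative Gevrey bounds of the denominator `α + β 4^N (1 - cos (2^{-N} t))`. -/
theorem gevreyAt_denominator {α β : ℝ} (hj : j ≤ N) (hd : 0 < d) (hd1 : d ≤ 1) (hα : 0 ≤ α)
    (hβ : 0 ≤ β) (hβ' : β ≤ 8) (hD : d * 4 ^ j ≤ α + β * (2 ^ N * latVer N t)) :
    GevreyAt (fun s => α + β * (2 ^ N * latVer N s)) t
      (|α + β * (2 ^ N * latVer N t)| * (8 / d)) ((2 : ℝ) ^ j)⁻¹ := by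
  have hsm : ContDiff ℝ (⊤ : ℕ∞) (fun s => α + β * (2 ^ N * latVer N s)) :=
    contDiff_const.add (contDiff_const.mul (contDiff_const.mul (contDiff_latVer N)))
  set D := α + β * (2 ^ N * latVer N t) with hDdef
  have hD0 : 0 < D := lt_of_lt_of_le (by positivity) hD
  have hx : 1 ≤ 8 / d := by rw [le_div_iff₀ hd]; linarith
  refine gevreyAt_of_le (by positivity) (by positivity) hsm.contDiffAt fun n => ?_
  have hjpos : (0 : ℝ) < 2 ^ j := by positivity
  have h44 : ((2 : ℝ) ^ j) ^ 2 = 4 ^ j := by rw [← pow_mul, mul_comm, pow_mul]; norm_num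
  have hder : 0 < n → iteratedDeriv n (fun s => α + β * (2 ^ N * latVer N s)) t =
      β * (2 ^ N * iteratedDeriv n (latVer N) t) := fun hn => by
    rw [iteratedDeriv_const_add hn, iteratedDeriv_const_mul_field, iteratedDeriv_const_mul_field]
  rcases n with _ | _ | n
  · simp only [iteratedDeriv_zero, pow_zero, mul_one, ← hDdef]
    exact le_mul_of_one_le_right (abs_nonneg _) hx
  -- The crude bound β 2^N on the first derivative is too large compared with D 2^{-j}. The
  -- inequality between sine and versine improves it to O(√D), and √D ≤ D / (d 2^j) because D ≥ d
  -- 4^j with d ≤ 1.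
  · rw [hder (by norm_num), zero_add, iteratedDeriv_one, deriv_latVer,
      mul_inv_cancel_left₀ (by positivity), pow_one, abs_of_pos hD0]
    apply abs_le_of_sq_le_sq _ (by positivity)
    have h1 : (β * latSin N t) ^ 2 ≤ 16 * D := by
      have e1 := latSin_sq_le N t
      have e2 : (0 : ℝ) ≤ 2 ^ N * latVer N t := mul_nonneg (by positivity) (latVer_nonneg N t)
      calc (β * latSin N t) ^ 2 = β * (β * latSin N t ^ 2) := by ring
        _ ≤ β * (β * (2 * (2 ^ N * latVer N t))) := by gcongr
        _ ≤ 8 * (β * (2 * (2 ^ N * latVer N t))) := by gcongr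
        _ ≤ 16 * D := by rw [hDdef]; linarith
    refine h1.trans ?_
    have h3 : 64 * D ≤ (D * (8 / d) * (2 ^ j)⁻¹) ^ 2 := by
      have : (D * (8 / d) * ((2 : ℝ) ^ j)⁻¹) ^ 2 = 64 * D * (D / (d ^ 2 * 4 ^ j)) := by
        rw [← h44]; field_simp; ring
      rw [this]
      refine le_mul_of_one_le_right (by positivity) ?_
      rw [le_div_iff₀ (by positivity)]
      have h4 : 0 < d * (4 : ℝ) ^ j := by positivity
      nlinarith
    linarith
  -- From order two on, 4^N 2^{-Nn} ≤ 4^j 2^{-jn} ≤ (D/d) 2^{-jn} suffices.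
  · rw [hder (by omega), abs_mul, abs_mul, abs_of_nonneg hβ, abs_of_pos (by positivity : (0:ℝ) < 2 ^ N),
      abs_of_pos hD0]
    have h1 := abs_iteratedDeriv_latVer_le N (n + 2) t (by omega)
    have h2 := pow_scale_le (n := n + 1) hj (by omega)
    have e : (2 : ℝ) ^ N * (2 ^ N * ((2 : ℝ) ^ N)⁻¹ ^ (n + 2)) = 2 ^ N * ((2 : ℝ) ^ N)⁻¹ ^ (n + 1) := by
      have : (2 : ℝ) ^ N ≠ 0 := by positivity
      rw [pow_succ _ (n + 1), mul_comm (_ ^ (n + 1)), mul_inv_cancel_left₀ this]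
    have e' : (2 : ℝ) ^ j * ((2 : ℝ) ^ j)⁻¹ ^ (n + 1) = 4 ^ j * ((2 : ℝ) ^ j)⁻¹ ^ (n + 2) := by
      rw [← h44, pow_succ _ (n + 1), mul_comm (((2 : ℝ) ^ j)⁻¹ ^ (n + 1)) (((2 : ℝ) ^ j)⁻¹), pow_two,
        mul_assoc, mul_inv_cancel_left₀ hjpos.ne']
    calc β * (2 ^ N * |iteratedDeriv (n + 2) (latVer N) t|)
        ≤ 8 * (2 ^ N * (2 ^ N * ((2 : ℝ) ^ N)⁻¹ ^ (n + 2))) := by gcongr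
      _ ≤ 8 * (4 ^ j * ((2 : ℝ) ^ j)⁻¹ ^ (n + 2)) := by rw [e, ← e']; gcongr
      _ ≤ 8 * (D / d * ((2 : ℝ) ^ j)⁻¹ ^ (n + 2)) := by
        gcongr
        rw [le_div_iff₀ hd]; linarith
      _ = _ := by ring

end Trig

/-! ### From Gevrey symbols to stretched exponential decay -/

/-- Gevrey bounds of a single-scale symbol `c · num / D`, where the denominator is bounded below on
the support of the cutoff `c`. -/
theorem gevreyAt_symbol {c num D : ℝ → ℝ} {A B K K' d : ℝ} {j : ℕ} (hK : 0 < K) (hK' : 0 ≤ K')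
    (hd : 0 < d) (hd1 : d ≤ 1) (hB : 0 ≤ B) (hDc : Continuous D)
    (hc : ∀ t, GevreyAt c t A (B * ((2 : ℝ) ^ j)⁻¹))
    (hDlow : ∀ t, c t ≠ 0 → d * 4 ^ j ≤ D t)
    (hD : ∀ t, d * 4 ^ j ≤ D t → GevreyAt D t (|D t| * K) ((2 : ℝ) ^ j)⁻¹)
    (hnum : ∀ t, d * 4 ^ j ≤ D t → GevreyAt num t (√(D t) * K') ((2 : ℝ) ^ j)⁻¹) (t : ℝ) :
    GevreyAt (fun s => c s * (num s * (D s)⁻¹)) t (A * K' * (d⁻¹ * ((2 : ℝ) ^ j)⁻¹))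
      ((B + 2 + K) * ((2 : ℝ) ^ j)⁻¹) := by
  have hA := (hc 0).nonneg
  -- By continuity the lower bound on D extends to the closed support of c; off that set the symbol
  -- vanishes in a neighbourhood of t.
  by_cases ht : t ∈ tsupport c
  · have hDt : d * 4 ^ j ≤ D t := by
      have hcl : IsClosed {s | d * 4 ^ j ≤ D s} := isClosed_le continuous_const hDc
      have : tsupport c ⊆ {s | d * 4 ^ j ≤ D s} :=
        closure_minimal (fun s hs => hDlow s hs) hcl
      exact this ht
    have hpos : 0 < D t := lt_of_lt_of_le (by positivity) hDt
    have hb : (0 : ℝ) ≤ ((2 : ℝ) ^ j)⁻¹ := by positivity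
    have h1 := (hD t hDt).inv hK hb hpos.ne'
    have h2 := (hnum t hDt).mul h1 hb (by positivity)
    have h3 := (hc t).mul h2 (by positivity) (by positivity)
    refine h3.mono ?_ (by positivity) (le_of_eq (by ring))
    rw [mul_assoc A]
    refine mul_le_mul_of_nonneg_left ?_ hA
    rw [abs_of_pos hpos]
    have hs : √(D t) * (D t)⁻¹ = (√(D t))⁻¹ := by
      have : 0 < √(D t) := Real.sqrt_pos.2 hpos
      nth_rewrite 2 [← Real.sq_sqrt hpos.le]
      field_simp
    have h5 := scale_le_sqrt hd hd1 hDt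
    have h6 : (√(D t))⁻¹ ≤ d⁻¹ * ((2 : ℝ) ^ j)⁻¹ := by
      rw [← mul_inv]
      apply inv_anti₀ (by positivity)
      rw [le_div_iff₀ hd] at h5
      linarith
    calc √(D t) * K' * (D t)⁻¹ = K' * (√(D t) * (D t)⁻¹) := by ring
      _ ≤ _ := by rw [hs]; gcongr
  · have hev : (fun s => c s * (num s * (D s)⁻¹)) =ᶠ[𝓝 t] fun _ => (0 : ℝ) := by
      filter_upwards [notMem_tsupport_iff_eventuallyEq.1 ht] with s hs
      simp [hs]
    refine ((gevreyAt_const 0 t _ ?_).congr hev).mono ?_ ?_ le_rfl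
    · positivity
    · simp only [abs_zero]; positivity
    · positivity

/-- Each difference is traded for one derivative and a factor h by the mean value inequality. -/
theorem abs_fwdDiff_iter_le {h M : ℝ} (hh : 0 ≤ h) (r : ℕ) :
    ∀ F : ℝ → ℝ, ContDiff ℝ (⊤ : ℕ∞) F → (∀ t, |iteratedDeriv r F t| ≤ M) →
      ∀ t, |((fwdDiff h)^[r] F) t| ≤ h ^ r * M := by
  induction r generalizing M with
  | zero => intro F _ hM t; simpa using hM t
  | succ r ih =>
    intro F hF hM t
    rw [Function.iterate_succ_apply]
    have hsm : ContDiff ℝ (⊤ : ℕ∞) (fun s => F (s + h)) :=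
      hF.comp (contDiff_id.add contDiff_const)
    have := ih (M := h * M) (fwdDiff h F) (hsm.sub hF) (fun s => ?_) t
    · refine this.trans (le_of_eq (by ring))
    · have e : iteratedDeriv r (fwdDiff h F) s =
          iteratedDeriv r F (s + h) - iteratedDeriv r F s := by
        rw [show fwdDiff h F = (fun s => F (s + h)) - F from rfl,
          iteratedDeriv_sub (hsm.contDiffAt.of_le (by exact_mod_cast le_top))
            (hF.contDiffAt.of_le (by exact_mod_cast le_top)), iteratedDeriv_comp_add_const]
      have hdiff : Differentiable ℝ (iteratedDeriv r F) :=
        hF.differentiable_iteratedDeriv r (by exact_mod_cast WithTop.coe_lt_top _)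
      have hlip := Convex.norm_image_sub_le_of_norm_deriv_le (𝕜 := ℝ) (f := iteratedDeriv r F)
        (s := Set.univ) (x := s) (y := s + h) (C := M) (fun x _ => hdiff x)
        (fun x _ => by rw [← iteratedDeriv_succ]; exact hM x) convex_univ trivial trivial
      rw [e]
      simpa [Real.norm_eq_abs, abs_of_nonneg hh, mul_comm] using hlip

/-- Bounds on all powers of `y` with Gevrey growth give stretched exponential decay. -/
theorem mul_exp_sqrt_le {G A B c y : ℝ} (hG : 0 ≤ G) (hA : 0 ≤ A) (hy : 0 ≤ y)
    (hB : 0 ≤ B) (hcB : c ^ 2 * B ≤ 1 / 2)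
    (h : ∀ r : ℕ, y ^ r * G ≤ A * B ^ r * (r.factorial : ℝ) ^ 2) :
    G * Real.exp (c * √y) ≤ 4 * A := by
  set z := c * √y with hz
  -- Only the even powers of z = c √y are integer powers of y, which is why the exponential is
  -- replaced by a hyperbolic cosine. The coefficients 1/(2r)! then absorb the growth r!².
  have h1 : Real.exp z ≤ 2 * Real.cosh z := by
    rw [Real.cosh_eq]; linarith [Real.exp_pos (-z)]
  have h2 := Real.hasSum_cosh z
  have h3 : HasSum (fun r : ℕ => A * (1 / 2 : ℝ) ^ r) (A * 2) := hasSum_geometric_two.mul_left A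
  have h4 : G * Real.cosh z ≤ A * 2 := by
    refine hasSum_le (fun r => ?_) (h2.mul_left G) h3
    have hz2 : z ^ (2 * r) = (c ^ 2) ^ r * y ^ r := by
      rw [pow_mul, hz, mul_pow, Real.sq_sqrt hy, mul_pow]
    rw [hz2]
    have hfac : (r.factorial : ℝ) ^ 2 ≤ ((2 * r).factorial : ℝ) := by
      have := factorial_mul_sub_le (n := 2 * r) (i := r) (by omega)
      rw [show 2 * r - r = r by omega] at this
      nlinarith
    have hp : (0 : ℝ) < ((2 * r).factorial : ℝ) := by positivity
    rw [← mul_div_assoc, div_le_iff₀ hp]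
    calc G * ((c ^ 2) ^ r * y ^ r) = (c ^ 2) ^ r * (y ^ r * G) := by ring
      _ ≤ (c ^ 2) ^ r * (A * B ^ r * (r.factorial : ℝ) ^ 2) :=
        mul_le_mul_of_nonneg_left (h r) (by positivity)
      _ = A * (c ^ 2 * B) ^ r * (r.factorial : ℝ) ^ 2 := by rw [mul_pow]; ring
      _ ≤ A * (1 / 2) ^ r * ((2 * r).factorial : ℝ) := by gcongr
  nlinarith


/-! ### Lattice Fourier phases and summation by parts -/

section Phase

variable (N : ℕ) {n : ℕ} [NeZero n]

theorem side_pos : 0 < side N n := by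
  have : (0 : ℝ) < n := by exact_mod_cast Nat.pos_of_ne_zero (NeZero.ne n)
  unfold side; positivity

/-- The phase is a character of the residue of k · x, so it does not depend on the chosen
representatives. Its symmetry in k and x and its multiplicativity are read off from this form. -/
theorem phase_eq_prod (k x : Site n) :
    phase N k x = ∏ μ, (ZMod.stdAddChar (-(k μ * x μ)) : ℂ) := by
  have h : ∀ μ, (ZMod.stdAddChar (-(k μ * x μ)) : ℂ) =
      Complex.exp (-Complex.I * ((mom N k μ * coord N x μ : ℝ) : ℂ)) := fun μ => by
    have e : -(k μ * x μ) = ((-((k μ).valMinAbs * (x μ).valMinAbs) : ℤ) : ZMod n) := by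
      push_cast [ZMod.coe_valMinAbs]; rfl
    rw [e, ZMod.stdAddChar_coe]
    congr 1
    have hn : (n : ℂ) ≠ 0 := by exact_mod_cast NeZero.ne n
    simp only [mom, coord, side]
    push_cast
    field_simp
  rw [Finset.prod_congr rfl fun μ _ => h μ, ← Complex.exp_sum, phase]
  congr 1
  push_cast
  rw [Finset.mul_sum]

theorem phase_comm (k x : Site n) : phase N k x = phase N x k := by
  simp only [phase_eq_prod, mul_comm]

theorem phase_add_right (k x y : Site n) : phase N k (x + y) = phase N k x * phase N k y := by
  simp only [phase_eq_prod, ← Finset.prod_mul_distrib, Pi.add_apply]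
  refine Finset.prod_congr rfl fun μ _ => ?_
  rw [← AddChar.map_add_eq_mul]
  congr 1; ring

theorem phase_add_left (k k' x : Site n) : phase N (k + k') x = phase N k x * phase N k' x := by
  rw [phase_comm, phase_add_right, phase_comm N x, phase_comm N x]

@[simp] theorem phase_zero_right (k : Site n) : phase N k 0 = 1 := by
  simp [phase_eq_prod]

@[simp] theorem phase_zero_left (x : Site n) : phase N 0 x = 1 := by
  simp [phase_eq_prod]

theorem norm_phase (k x : Site n) : ‖phase N k x‖ = 1 := by
  rw [phase, show -Complex.I * ((∑ μ, mom N k μ * coord N x μ : ℝ) : ℂ) =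
    ((-∑ μ, mom N k μ * coord N x μ : ℝ) : ℂ) * Complex.I by push_cast; ring]
  exact Complex.norm_exp_ofReal_mul_I _

theorem phase_neg_left (k x : Site n) : phase N (-k) x = phase N k (-x) := by
  simp [phase_eq_prod]

theorem sum_phase (k : Site n) :
    ∑ x : Site n, phase N k x = if k = 0 then (n : ℂ) ^ 2 else 0 := by
  have h : ∀ μ, ∑ z : ZMod n, (ZMod.stdAddChar (-(k μ * z)) : ℂ) = if k μ = 0 then (n : ℂ) else 0 := by
    intro μ
    have := AddChar.sum_mulShift (-(k μ)) (ZMod.isPrimitive_stdAddChar n)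
    simp only [ZMod.card, neg_eq_zero] at this
    rw [show (if k μ = 0 then (n : ℂ) else 0) = ((if k μ = 0 then n else 0 : ℕ) : ℂ) by
      split_ifs <;> simp, ← this]
    refine Finset.sum_congr rfl fun z _ => ?_
    congr 1; ring
  simp only [phase_eq_prod]
  rw [← Fintype.piFinset_univ, ← Finset.prod_univ_sum (fun _ => Finset.univ)
    (fun μ z => (ZMod.stdAddChar (-(k μ * z)) : ℂ))]
  simp only [h, Fin.prod_univ_two]
  have : k = 0 ↔ k 0 = 0 ∧ k 1 = 0 := by
    constructor
    · rintro rfl; simp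
    · rintro ⟨h0, h1⟩; ext i; fin_cases i <;> simpa
  by_cases h0 : k 0 = 0 <;> by_cases h1 : k 1 = 0 <;> simp [this, h0, h1, pow_two]

theorem phase_unitVec (k : Site n) (μ : Fin 2) : phase N k (unitVec μ) =
    Complex.exp (-Complex.I * ((mom N k μ / 2 ^ N : ℝ) : ℂ)) := by
  have e : phase N k (unitVec μ) = (ZMod.stdAddChar ((-((k μ).valMinAbs) : ℤ) : ZMod n) : ℂ) := by
    push_cast [ZMod.coe_valMinAbs]
    rw [phase_eq_prod, Finset.prod_eq_single μ]
    · simp [unitVec]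
    · intro ν _ hν; simp [unitVec, Pi.single_eq_of_ne hν]
    · simp
  rw [e, ZMod.stdAddChar_coe]
  congr 1
  have hn : (n : ℂ) ≠ 0 := by exact_mod_cast NeZero.ne n
  simp only [mom, side]
  push_cast
  field_simp

/-- Jordan's inequality: |e^{iθ} - 1| = 2 |sin(θ/2)| ≥ 2|θ|/π for |θ| ≤ π, with θ = 2π v / n and v
the centred representative. -/
theorem le_norm_phase_sub_one (x : Site n) (μ : Fin 2) :
    4 * |((x μ).valMinAbs : ℝ)| / n ≤ ‖phase N (-unitVec μ) x - 1‖ := by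
  have hn : (0 : ℝ) < n := by exact_mod_cast Nat.pos_of_ne_zero (NeZero.ne n)
  set v : ℝ := ((x μ).valMinAbs : ℝ) with hv
  have hvn : |v| ≤ n / 2 := by
    have h := ZMod.natAbs_valMinAbs_le (x μ)
    have h' : (x μ).valMinAbs.natAbs * 2 ≤ n := by omega
    have h2 : (((x μ).valMinAbs.natAbs : ℝ)) * 2 ≤ n := by exact_mod_cast h'
    rw [Nat.cast_natAbs, Int.cast_abs] at h2
    linarith
  have e : phase N (-unitVec μ) x = Complex.exp (Complex.I * ((2 * Real.pi * v / n : ℝ) : ℂ)) := by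
    have e1 : phase N (-unitVec μ) x = (ZMod.stdAddChar ((x μ).valMinAbs : ZMod n) : ℂ) := by
      rw [ZMod.coe_valMinAbs, phase_eq_prod, Finset.prod_eq_single μ]
      · simp [unitVec]
      · intro ν _ hν; simp [unitVec, Pi.single_eq_of_ne hν]
      · simp
    rw [e1, ZMod.stdAddChar_coe]
    congr 1
    push_cast
    rw [hv]
    push_cast
    ring
  rw [e, Complex.norm_exp_I_mul_ofReal_sub_one, Real.norm_eq_abs, abs_mul, abs_two]
  have h1 : |2 * Real.pi * v / n / 2| ≤ Real.pi / 2 := by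
    rw [show 2 * Real.pi * v / n / 2 = Real.pi * (v / n) by ring, abs_mul,
      abs_of_pos Real.pi_pos, abs_div, abs_of_pos hn]
    have : |v| / n ≤ 1 / 2 := by rw [div_le_iff₀ hn]; linarith
    nlinarith [Real.pi_pos]
  have h2 := Real.mul_abs_le_abs_sin h1
  refine le_trans (le_of_eq ?_) (mul_le_mul_of_nonneg_left h2 (by norm_num))
  rw [show 2 * Real.pi * v / n / 2 = Real.pi * (v / n) by ring, abs_mul,
      abs_of_pos Real.pi_pos, abs_div, abs_of_pos hn]
  have := Real.pi_pos
  field_simp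
  ring

/-- Summation by parts. -/
theorem sum_phase_mul_fwdDiff (φ : Site n → ℝ) (μ : Fin 2) (x : Site n) (r : ℕ) :
    ∑ k, phase N k x * (((fwdDiff (unitVec μ))^[r] φ k : ℝ) : ℂ) =
      (phase N (-unitVec μ) x - 1) ^ r * ∑ k, phase N k x * (φ k : ℂ) := by
  induction r generalizing φ with
  | zero => simp
  | succ r ih =>
    rw [Function.iterate_succ_apply, ih, pow_succ, mul_assoc]
    congr 1
    simp only [fwdDiff, Complex.ofReal_sub, mul_sub, Finset.sum_sub_distrib, sub_mul, one_mul]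
    congr 1
    rw [Finset.mul_sum]
    refine Fintype.sum_equiv (Equiv.addRight (unitVec μ)) _ _ fun k => ?_
    simp only [Equiv.coe_addRight]
    rw [← mul_assoc, ← phase_add_left]
    congr 2
    abel

/-- The support of a difference lies in the union of the support and one translate of it. The
resulting factor 2^r only affects the rate of the decay. -/
theorem card_support_fwdDiff_le (φ : Site n → ℝ) (e : Site n) (r : ℕ) :
    (Finset.univ.filter fun k => (fwdDiff e)^[r] φ k ≠ 0).card ≤
      2 ^ r * (Finset.univ.filter fun k => φ k ≠ 0).card := by
  induction r generalizing φ with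
  | zero =>
    rw [pow_zero, one_mul]
    exact Finset.card_le_card fun k hk =>
      Finset.mem_filter.2 ⟨Finset.mem_univ _, (Finset.mem_filter.1 hk).2⟩
  | succ r ih =>
    rw [Function.iterate_succ_apply]
    refine (ih _).trans ?_
    rw [pow_succ, mul_assoc]
    refine Nat.mul_le_mul_left _ ?_
    have hsub : (Finset.univ.filter fun k => fwdDiff e φ k ≠ 0) ⊆
        (Finset.univ.filter fun k => φ k ≠ 0) ∪
          (Finset.univ.filter fun k => φ k ≠ 0).image (fun k => k - e) := by
      intro k hk
      simp only [Finset.mem_filter, Finset.mem_univ, true_and, Finset.mem_union,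
        Finset.mem_image] at hk ⊢
      by_contra hcon
      push Not at hcon
      have h2 : φ (k + e) = 0 := by
        by_contra h3
        exact hcon.2 _ h3 (by simp)
      exact hk (by simp [fwdDiff, h2, hcon.1])
    refine (Finset.card_le_card hsub).trans ((Finset.card_union_le _ _).trans ?_)
    have := Finset.card_image_le (s := Finset.univ.filter fun k => φ k ≠ 0) (f := fun k => k - e)
    omega

theorem norm_sum_phase_le (φ : Site n → ℝ) (x : Site n) {S M : ℝ} (hM0 : 0 ≤ M)
    (hS : ((Finset.univ.filter fun k => φ k ≠ 0).card : ℝ) ≤ S) (hM : ∀ k, |φ k| ≤ M) :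
    ‖∑ k, phase N k x * (φ k : ℂ)‖ ≤ S * M := by
  refine (norm_sum_le _ _).trans ?_
  have : ∀ k, ‖phase N k x * (φ k : ℂ)‖ = |φ k| := fun k => by
    rw [norm_mul, norm_phase, one_mul, Complex.norm_real, Real.norm_eq_abs]
  simp only [this]
  rw [← Finset.sum_filter_of_ne (p := fun k => φ k ≠ 0) (fun k _ h => by simpa using h)]
  refine (Finset.sum_le_card_nsmul _ _ M fun k _ => hM k).trans ?_
  rw [nsmul_eq_mul]
  gcongr

/-- The scaled stretched distance `∑ μ √(2^j |x_μ|)`. -/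
noncomputable def stretch (j : ℕ) (x : Site n) : ℝ := ∑ μ, √(2 ^ j * |coord N x μ|)

theorem norm_sum_phase_mul_exp_le (φ : Site n → ℝ) (x : Site n) {S A B c : ℝ} {j : ℕ}
    (hA : 0 ≤ A) (hB : 0 ≤ B) (hcB : c ^ 2 * (Real.pi * B) ≤ 1 / 2)
    (hS : ((Finset.univ.filter fun k => φ k ≠ 0).card : ℝ) ≤ S)
    (h : ∀ μ r k, |(fwdDiff (unitVec μ))^[r] φ k| ≤
      A * (2 * Real.pi / side N n * (B * ((2 : ℝ) ^ j)⁻¹)) ^ r * (r.factorial : ℝ) ^ 2) :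
    ‖∑ k, phase N k x * (φ k : ℂ)‖ * Real.exp (c / 2 * stretch N j x) ≤ 4 * (S * A) := by
  have hn : (0 : ℝ) < n := by exact_mod_cast Nat.pos_of_ne_zero (NeZero.ne n)
  have hS0 : 0 ≤ S := le_trans (by positivity) hS
  have hs := side_pos N (n := n)
  set G := ‖∑ k, phase N k x * (φ k : ℂ)‖ with hG
  have key : ∀ μ, G * Real.exp (c * √(2 ^ j * |coord N x μ|)) ≤ 4 * (S * A) := by
    intro μ
    have hπ := Real.pi_pos
    refine mul_exp_sqrt_le (B := Real.pi * B) (norm_nonneg _) (by positivity) (by positivity)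
      (by positivity) hcB fun r => ?_
    have h1 := norm_sum_phase_le N ((fwdDiff (unitVec μ))^[r] φ) x (by positivity)
      (S := 2 ^ r * S) ((Nat.cast_le.2 (card_support_fwdDiff_le φ (unitVec μ) r)).trans
        (by push_cast; gcongr)) (h μ r)
    rw [sum_phase_mul_fwdDiff, norm_mul, norm_pow, ← hG] at h1
    have h2 := le_norm_phase_sub_one N x μ
    have h3 : (4 * |((x μ).valMinAbs : ℝ)| / n) ^ r * G ≤ _ :=
      (mul_le_mul_of_nonneg_right (pow_le_pow_left₀ (by positivity) h2 r) (norm_nonneg _)).trans h1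
    have e : (2 : ℝ) ^ j * |coord N x μ| =
        (n * 2 ^ j / (4 * 2 ^ N)) * (4 * |((x μ).valMinAbs : ℝ)| / n) := by
      rw [coord, abs_div, abs_of_pos (by positivity : (0 : ℝ) < 2 ^ N)]
      field_simp
    calc (2 ^ j * |coord N x μ|) ^ r * G
        = (n * 2 ^ j / (4 * 2 ^ N)) ^ r * ((4 * |((x μ).valMinAbs : ℝ)| / n) ^ r * G) := by
          rw [e, mul_pow]; ring
      _ ≤ (n * 2 ^ j / (4 * 2 ^ N)) ^ r * (2 ^ r * S *
            (A * (2 * Real.pi / side N n * (B * ((2 : ℝ) ^ j)⁻¹)) ^ r * (r.factorial : ℝ) ^ 2)) := by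
          gcongr
      _ = S * A * ((n * 2 ^ j / (4 * 2 ^ N)) * 2 *
            (2 * Real.pi / side N n * (B * ((2 : ℝ) ^ j)⁻¹))) ^ r * (r.factorial : ℝ) ^ 2 := by
          generalize (n * 2 ^ j / (4 * 2 ^ N) : ℝ) = a
          generalize (2 * Real.pi / side N n * (B * ((2 : ℝ) ^ j)⁻¹)) = b
          rw [mul_pow, mul_pow]; ring
      _ = _ := by
          congr 3
          -- Jordan's factor 1/4, the doubling of the support and the momentum spacing 2π/L combine
          -- into the rate π B.
          unfold side
          field_simp
          ring
  -- The bounds in the two directions are combined by their geometric mean, which halves the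
  -- constant c.
  have hp : (G * Real.exp (c / 2 * stretch N j x)) ^ 2 ≤ (4 * (S * A)) ^ 2 := by
    calc (G * Real.exp (c / 2 * stretch N j x)) ^ 2
        = (G * Real.exp (c * √(2 ^ j * |coord N x 0|))) *
          (G * Real.exp (c * √(2 ^ j * |coord N x 1|))) := by
          rw [mul_pow, ← Real.exp_nat_mul, mul_mul_mul_comm, ← Real.exp_add, ← pow_two]
          congr 2
          rw [stretch, Fin.sum_univ_two]; push_cast; ring
      _ ≤ (4 * (S * A)) * (4 * (S * A)) := by
          exact mul_le_mul (key 0) (key 1) (by positivity) (by positivity)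
      _ = _ := by ring
  exact abs_le_of_sq_le_sq' hp (by positivity) |>.2

end Phase


/-! ### Torus distance, lattice sums and counting of momenta -/

section Geometry

variable (N : ℕ) {n : ℕ}

theorem torusNorm_nonneg (x : Site n) : 0 ≤ torusNorm N x := Real.sqrt_nonneg _

@[simp] theorem torusNorm_zero : torusNorm N (0 : Site n) = 0 := by
  simp [torusNorm, coord]

theorem abs_coord_neg (x : Site n) (μ : Fin 2) : |coord N (-x) μ| = |coord N x μ| := by
  have h : |((-(x μ)).valMinAbs : ℝ)| = |((x μ).valMinAbs : ℝ)| := by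
    have := ZMod.natAbs_valMinAbs_neg (x μ)
    have h2 : (((-(x μ)).valMinAbs.natAbs : ℕ) : ℝ) = ((x μ).valMinAbs.natAbs : ℕ) := by rw [this]
    rwa [Nat.cast_natAbs, Nat.cast_natAbs, Int.cast_abs, Int.cast_abs] at h2
  simp only [coord, abs_div, Pi.neg_apply, h]

theorem torusNorm_neg (x : Site n) : torusNorm N (-x) = torusNorm N x := by
  unfold torusNorm
  congr 1
  refine Finset.sum_congr rfl fun μ _ => ?_
  rw [← sq_abs, abs_coord_neg, sq_abs]

theorem abs_coord_add_le (x y : Site n) (μ : Fin 2) :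
    |coord N (x + y) μ| ≤ |coord N x μ + coord N y μ| := by
  have h : |((x μ + y μ).valMinAbs : ℝ)| ≤ |((x μ).valMinAbs + (y μ).valMinAbs : ℝ)| := by
    have := ZMod.natAbs_valMinAbs_add_le (x μ) (y μ)
    have h2 : (((x μ + y μ).valMinAbs.natAbs : ℕ) : ℝ) ≤
      (((x μ).valMinAbs + (y μ).valMinAbs).natAbs : ℕ) := by exact_mod_cast this
    rw [Nat.cast_natAbs, Nat.cast_natAbs, Int.cast_abs, Int.cast_abs] at h2
    push_cast at h2
    exact h2
  simp only [coord, ← add_div, abs_div, Pi.add_apply]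
  gcongr

theorem sqrt_sum_sq_add_le (a b c d : ℝ) :
    √((a + c) ^ 2 + (b + d) ^ 2) ≤ √(a ^ 2 + b ^ 2) + √(c ^ 2 + d ^ 2) := by
  have h1 := Real.sq_sqrt (by positivity : 0 ≤ a ^ 2 + b ^ 2)
  have h2 := Real.sq_sqrt (by positivity : 0 ≤ c ^ 2 + d ^ 2)
  have h3 := Real.sqrt_nonneg (a ^ 2 + b ^ 2)
  have h4 := Real.sqrt_nonneg (c ^ 2 + d ^ 2)
  rw [Real.sqrt_le_left (by positivity)]
  have h5 : a * c + b * d ≤ √(a ^ 2 + b ^ 2) * √(c ^ 2 + d ^ 2) := by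
    apply le_of_sq_le_sq _ (by positivity)
    rw [mul_pow, h1, h2]
    nlinarith [sq_nonneg (a * d - b * c)]
  nlinarith

theorem torusNorm_add_le (x y : Site n) :
    torusNorm N (x + y) ≤ torusNorm N x + torusNorm N y := by
  unfold torusNorm
  simp only [Fin.sum_univ_two]
  refine le_trans (Real.sqrt_le_sqrt ?_) (sqrt_sum_sq_add_le _ _ _ _)
  exact add_le_add (sq_le_sq.2 (abs_coord_add_le N x y 0)) (sq_le_sq.2 (abs_coord_add_le N x y 1))

theorem torusNorm_sub_le (x y : Site n) :
    torusNorm N (x - y) ≤ torusNorm N x + torusNorm N y := by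
  rw [sub_eq_add_neg, ← torusNorm_neg N y]
  exact torusNorm_add_le N x (-y)

theorem torusNorm_le_abs_add_abs (x : Site n) :
    torusNorm N x ≤ |coord N x 0| + |coord N x 1| := by
  unfold torusNorm
  rw [Fin.sum_univ_two, Real.sqrt_le_left (by positivity), ← sq_abs, ← sq_abs (coord N x 1)]
  nlinarith [abs_nonneg (coord N x 0), abs_nonneg (coord N x 1)]

theorem abs_coord_unitVec_le (μ ν : Fin 2) :
    |coord N (unitVec μ : Site n) ν| ≤ if μ = ν then ((2 : ℝ) ^ N)⁻¹ else 0 := by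
  by_cases h : μ = ν
  · subst h
    simp only [coord, unitVec, Pi.single_eq_same, if_true]
    rw [abs_div, abs_of_pos (by positivity : (0 : ℝ) < 2 ^ N), inv_eq_one_div]
    gcongr
    have h2 : (1 : ZMod n).valMinAbs.natAbs ≤ 1 := by
      rcases Nat.eq_zero_or_pos n with rfl | hn
      · exact le_of_eq rfl
      · haveI : NeZero n := ⟨hn.ne'⟩
        have := ZMod.natAbs_min_of_le_div_two n (1 : ZMod n).valMinAbs 1
          (by rw [ZMod.coe_valMinAbs]; simp) (ZMod.natAbs_valMinAbs_le _)
        simpa using this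
    have h3 : (((1 : ZMod n).valMinAbs.natAbs : ℕ) : ℝ) ≤ 1 := by exact_mod_cast h2
    rwa [Nat.cast_natAbs, Int.cast_abs] at h3
  · simp [coord, unitVec, Pi.single_eq_of_ne (Ne.symm h), h]

theorem torusNorm_unitVec_le (μ : Fin 2) : torusNorm N (unitVec μ : Site n) ≤ ((2 : ℝ) ^ N)⁻¹ := by
  refine (torusNorm_le_abs_add_abs N _).trans ?_
  refine (add_le_add (abs_coord_unitVec_le N μ 0) (abs_coord_unitVec_le N μ 1)).trans ?_
  fin_cases μ <;> simp

theorem two_pow_mul_torusNorm_le (j : ℕ) (x : Site n) :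
    2 ^ j * torusNorm N x ≤ stretch N j x ^ 2 := by
  have h := torusNorm_le_abs_add_abs N x
  rw [stretch, Fin.sum_univ_two]
  have h0 := Real.sq_sqrt (by positivity : 0 ≤ (2 : ℝ) ^ j * |coord N x 0|)
  have h1 := Real.sq_sqrt (by positivity : 0 ≤ (2 : ℝ) ^ j * |coord N x 1|)
  have h2 : 2 ^ j * torusNorm N x ≤ 2 ^ j * (|coord N x 0| + |coord N x 1|) := by gcongr
  nlinarith [mul_nonneg (Real.sqrt_nonneg ((2 : ℝ) ^ j * |coord N x 0|))
    (Real.sqrt_nonneg ((2 : ℝ) ^ j * |coord N x 1|))]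

theorem stretch_nonneg (j : ℕ) (x : Site n) : 0 ≤ stretch N j x :=
  Finset.sum_nonneg fun _ _ => Real.sqrt_nonneg _

theorem sqrt_torusNorm_le_stretch (j : ℕ) (x : Site n) : √(torusNorm N x) ≤ stretch N j x := by
  rw [Real.sqrt_le_left (stretch_nonneg N j x)]
  refine le_trans ?_ (two_pow_mul_torusNorm_le N j x)
  exact le_mul_of_one_le_left (torusNorm_nonneg N x) (one_le_pow₀ (by norm_num))

variable [NeZero n]

/-- A given absolute value m is attained by at most the two residues ±m. -/
theorem sum_natAbs_valMinAbs_le (f : ℕ → ℝ) (hf : ∀ m, 0 ≤ f m) :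
    ∑ z : ZMod n, f z.valMinAbs.natAbs ≤ 2 * ∑ m ∈ Finset.range (n + 1), f m := by
  have hmaps : ∀ z ∈ (Finset.univ : Finset (ZMod n)),
      z.valMinAbs.natAbs ∈ Finset.range (n + 1) := fun z _ => by
    have := ZMod.natAbs_valMinAbs_le z
    rw [Finset.mem_range]; omega
  rw [← Finset.sum_fiberwise_of_maps_to hmaps, Finset.mul_sum]
  refine Finset.sum_le_sum fun m _ => ?_
  have h1 : ∀ z ∈ (Finset.univ.filter fun z : ZMod n => z.valMinAbs.natAbs = m),
      f z.valMinAbs.natAbs = f m := fun z hz => by rw [(Finset.mem_filter.1 hz).2]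
  rw [Finset.sum_congr rfl h1, Finset.sum_const, nsmul_eq_mul]
  refine mul_le_mul_of_nonneg_right ?_ (hf m)
  have hsub : (Finset.univ.filter fun z : ZMod n => z.valMinAbs.natAbs = m) ⊆
      {(m : ZMod n), -(m : ZMod n)} := by
    intro z hz
    have hz : z.valMinAbs.natAbs = m := (Finset.mem_filter.1 hz).2
    rw [Finset.mem_insert, Finset.mem_singleton]
    rcases Int.natAbs_eq z.valMinAbs with h | h
    · left; rw [← ZMod.coe_valMinAbs z, h, hz]; simp
    · right; rw [← ZMod.coe_valMinAbs z, h, hz]; simp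
  have := (Finset.card_le_card hsub).trans Finset.card_le_two
  exact_mod_cast this

/-- Comparison with the telescoping differences of 1/(1 + lam m); the bound does not depend on the
number of terms. -/
theorem sum_range_div_sq_le {lam : ℝ} (h0 : 0 ≤ lam) (M : ℕ) :
    ∑ m ∈ Finset.range (M + 1), lam / (1 + lam * m) ^ 2 ≤ lam + 1 - 1 / (1 + lam * M) := by
  induction M with
  | zero => simp
  | succ M ih =>
    rw [Finset.sum_range_succ]
    have h1 : 0 < 1 + lam * M := by positivity
    have h2 : 0 < 1 + lam * (M + 1 : ℕ) := by positivity
    have h3 : lam / (1 + lam * (M + 1 : ℕ)) ^ 2 ≤ 1 / (1 + lam * M) - 1 / (1 + lam * (M + 1 : ℕ)) := by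
      have : 1 / (1 + lam * M) - 1 / (1 + lam * (M + 1 : ℕ)) =
          lam / ((1 + lam * M) * (1 + lam * (M + 1 : ℕ))) := by
        push_cast at h2 ⊢
        field_simp
        ring
      rw [this]
      apply div_le_div_of_nonneg_left h0 (by positivity)
      rw [pow_two]
      gcongr
      linarith
    linarith

/-- The fourth-order term of the exponential series already controls y². -/
theorem exp_neg_sqrt_le {c y : ℝ} (hc : 0 < c) (hy : 0 ≤ y) :
    Real.exp (-(c * √y)) ≤ (2 + 48 / c ^ 4) / (1 + y) ^ 2 := by
  rw [le_div_iff₀ (by positivity), Real.exp_neg, inv_mul_le_iff₀ (Real.exp_pos _)]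
  have hz : 0 ≤ c * √y := by positivity
  have h1 : (c * √y) ^ 4 ≤ 24 * Real.exp (c * √y) := by
    have := Real.pow_div_factorial_le_exp (c * √y) hz 4
    rw [div_le_iff₀ (by positivity)] at this
    have e : ((4 : ℕ).factorial : ℝ) = 24 := by norm_num [Nat.factorial]
    rw [e] at this; linarith
  have h2 : 1 ≤ Real.exp (c * √y) := Real.one_le_exp hz
  have h3 : (c * √y) ^ 4 = c ^ 4 * y ^ 2 := by
    rw [mul_pow, show √y ^ 4 = (√y ^ 2) ^ 2 by ring, Real.sq_sqrt hy]
  have h4 : y ^ 2 ≤ 24 / c ^ 4 * Real.exp (c * √y) := by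
    rw [div_mul_eq_mul_div, le_div_iff₀ (by positivity)]
    linarith
  have h5 : (1 + y) ^ 2 ≤ 2 + 2 * y ^ 2 := by nlinarith [sq_nonneg (1 - y)]
  calc (1 + y) ^ 2 ≤ 2 + 2 * y ^ 2 := h5
    _ ≤ 2 * Real.exp (c * √y) + 2 * (24 / c ^ 4 * Real.exp (c * √y)) := by linarith
    _ = _ := by ring

/-- In units of 2^{-j} this is a Riemann sum of mesh 2^{j-N} for an integrable function; j ≤ N keeps
the mesh at most 1. -/
theorem sum_exp_neg_sqrt_valMinAbs_le {c : ℝ} (hc : 0 < c) {j : ℕ} (hj : j ≤ N) :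
    ((2 : ℝ) ^ N)⁻¹ * ∑ z : ZMod n, Real.exp (-(c * √(2 ^ j * |(z.valMinAbs : ℝ) / 2 ^ N|))) ≤
      4 * (2 + 48 / c ^ 4) * ((2 : ℝ) ^ j)⁻¹ := by
  set K := 2 + 48 / c ^ 4 with hK
  have hK0 : 0 < K := by positivity
  set lam : ℝ := 2 ^ j / 2 ^ N with hlam
  have hlam0 : 0 < lam := by positivity
  have hlam1 : lam ≤ 1 := by
    rw [hlam, div_le_one (by positivity)]
    exact pow_le_pow_right₀ (by norm_num) hj
  have h1 : ∀ z : ZMod n, Real.exp (-(c * √(2 ^ j * |(z.valMinAbs : ℝ) / 2 ^ N|))) ≤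
      K * (fun m : ℕ => 1 / (1 + lam * m) ^ 2) z.valMinAbs.natAbs := fun z => by
    refine (exp_neg_sqrt_le hc (by positivity)).trans (le_of_eq ?_)
    simp only
    rw [← hK, Nat.cast_natAbs, Int.cast_abs, abs_div, abs_of_pos (by positivity : (0 : ℝ) < 2 ^ N),
      hlam]
    ring
  have h2 := sum_natAbs_valMinAbs_le (n := n) (fun m : ℕ => 1 / (1 + lam * m) ^ 2)
    (fun m => by positivity)
  have h3 := sum_range_div_sq_le hlam0.le n
  have h4 : lam * ∑ m ∈ Finset.range (n + 1), (1 : ℝ) / (1 + lam * m) ^ 2 ≤ 2 := by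
    rw [Finset.mul_sum]
    have : 0 ≤ 1 / (1 + lam * n) := by positivity
    calc _ = ∑ m ∈ Finset.range (n + 1), lam / (1 + lam * m) ^ 2 := by
          refine Finset.sum_congr rfl fun m _ => by ring
      _ ≤ 2 := by linarith
  have e : ((2 : ℝ) ^ N)⁻¹ = ((2 : ℝ) ^ j)⁻¹ * lam := by rw [hlam]; field_simp
  calc _ ≤ ((2 : ℝ) ^ N)⁻¹ * (K * (2 * ∑ m ∈ Finset.range (n + 1), (1 : ℝ) / (1 + lam * m) ^ 2)) := by
        refine mul_le_mul_of_nonneg_left ?_ (by positivity)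
        refine (Finset.sum_le_sum fun z _ => h1 z).trans ?_
        rw [← Finset.mul_sum]
        exact mul_le_mul_of_nonneg_left h2 hK0.le
    _ = ((2 : ℝ) ^ j)⁻¹ * (K * (2 * (lam * ∑ m ∈ Finset.range (n + 1), (1 : ℝ) / (1 + lam * m) ^ 2))) := by
        rw [e]; ring
    _ ≤ ((2 : ℝ) ^ j)⁻¹ * (K * (2 * 2)) := by gcongr
    _ = _ := by ring

theorem siteInt_exp_neg_stretch_le {c : ℝ} (hc : 0 < c) {j : ℕ} (hj : j ≤ N) :
    siteInt N (fun x : Site n => Real.exp (-(c * stretch N j x))) ≤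
      (4 * (2 + 48 / c ^ 4)) ^ 2 * ((4 : ℝ) ^ j)⁻¹ := by
  have h := sum_exp_neg_sqrt_valMinAbs_le N (n := n) hc hj
  set T := ∑ z : ZMod n, Real.exp (-(c * √(2 ^ j * |(z.valMinAbs : ℝ) / 2 ^ N|))) with hT
  have e : ∑ x : Site n, Real.exp (-(c * stretch N j x)) = T ^ 2 := by
    have : ∀ x : Site n, Real.exp (-(c * stretch N j x)) =
        ∏ μ, Real.exp (-(c * √(2 ^ j * |((x μ).valMinAbs : ℝ) / 2 ^ N|))) := fun x => by
      rw [← Real.exp_sum, Finset.sum_neg_distrib, ← Finset.mul_sum]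
      rfl
    simp only [this]
    rw [← Fintype.piFinset_univ, ← Finset.prod_univ_sum (fun _ => Finset.univ)
      (fun (_ : Fin 2) (z : ZMod n) => Real.exp (-(c * √(2 ^ j * |(z.valMinAbs : ℝ) / 2 ^ N|))))]
    simp [hT]
  have hT0 : 0 ≤ T := Finset.sum_nonneg fun _ _ => (Real.exp_pos _).le
  rw [siteInt, e, smul_eq_mul, ← mul_pow]
  refine (pow_le_pow_left₀ (by positivity) h 2).trans (le_of_eq ?_)
  rw [mul_pow, inv_pow, ← pow_mul, mul_comm j 2, pow_mul]
  norm_num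

theorem card_valMinAbs_le {R : ℝ} (hR : 0 ≤ R) :
    ((Finset.univ.filter fun z : ZMod n => |(z.valMinAbs : ℝ)| ≤ R).card : ℝ) ≤ 2 * R + 1 := by
  have h : (Finset.univ.filter fun z : ZMod n => |(z.valMinAbs : ℝ)| ≤ R).card ≤
      (Finset.Icc (-⌊R⌋) ⌊R⌋).card := by
    refine Finset.card_le_card_of_injOn (fun z => z.valMinAbs) (fun z hz => ?_)
      (fun _ _ _ _ h => ZMod.injective_valMinAbs h)
    have hz := (Finset.mem_filter.1 hz).2
    have h2 : |z.valMinAbs| ≤ ⌊R⌋ := Int.le_floor.2 (by push_cast; exact hz)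
    exact Finset.mem_coe.2 (Finset.mem_Icc.2 (abs_le.1 h2))
  have h0 : 0 ≤ ⌊R⌋ := Int.floor_nonneg.2 hR
  have h3 : ((Finset.Icc (-⌊R⌋) ⌊R⌋).card : ℝ) = 2 * ⌊R⌋ + 1 := by
    rw [Int.card_Icc]
    have : ((⌊R⌋ + 1 - -⌊R⌋).toNat : ℤ) = 2 * ⌊R⌋ + 1 := by
      rw [Int.toNat_of_nonneg (by omega)]; ring
    exact_mod_cast this
  calc _ ≤ ((Finset.Icc (-⌊R⌋) ⌊R⌋).card : ℝ) := by exact_mod_cast h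
    _ ≤ _ := by rw [h3]; linarith [Int.floor_le R]

theorem card_site_le (p : ZMod n → Prop) [DecidablePred p] (q : Site n → Prop) [DecidablePred q]
    (h : ∀ k, q k → ∀ μ, p (k μ)) : (Finset.univ.filter q).card ≤ (Finset.univ.filter p).card ^ 2 := by
  have : Finset.univ.filter q ⊆ Fintype.piFinset fun _ => Finset.univ.filter p := by
    intro k hk
    rw [Fintype.mem_piFinset]
    exact fun μ => Finset.mem_filter.2 ⟨Finset.mem_univ _, h k (Finset.mem_filter.1 hk).2 μ⟩
  refine (Finset.card_le_card this).trans ?_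
  rw [Fintype.card_piFinset]
  simp

theorem abs_mom_le_momNorm (k : Site n) (μ : Fin 2) : |mom N k μ| ≤ momNorm N k := by
  apply Real.abs_le_sqrt
  exact Finset.single_le_sum (f := fun μ => mom N k μ ^ 2) (fun _ _ => sq_nonneg _)
    (Finset.mem_univ μ)

/-- The number of momenta of scale at most `2^j`. -/
theorem card_momNorm_le (hL : 1 ≤ side N n) {j : ℕ} (q : Site n → Prop) [DecidablePred q]
    (h : ∀ k, q k → momNorm N k ≤ 2 ^ j ∨ j = N) :
    ((Finset.univ.filter q).card : ℝ) ≤ 4 * (side N n ^ 2 * 4 ^ j) := by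
  have hs := side_pos N (n := n)
  have hn : (0 : ℝ) < n := by exact_mod_cast Nat.pos_of_ne_zero (NeZero.ne n)
  have h24 : ((2 : ℝ) ^ j) ^ 2 = 4 ^ j := by rw [← pow_mul, mul_comm, pow_mul]; norm_num
  -- The top scale has no upper cutoff; all n² = L² 4^N momenta are counted.
  by_cases hj : j = N
  · have h1 := card_site_le (n := n) (fun _ => True) q (fun _ _ _ => trivial)
    have h2 : ((Finset.univ.filter q).card : ℝ) ≤ (n : ℝ) ^ 2 := by
      refine (Nat.cast_le.2 h1).trans ?_
      simp
    refine h2.trans ?_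
    have : (n : ℝ) ^ 2 = side N n ^ 2 * 4 ^ j := by
      rw [← h24, hj, ← mul_pow, side, div_mul_cancel₀ _ (by positivity)]
    rw [this]
    linarith [show 0 ≤ side N n ^ 2 * 4 ^ j by positivity]
  · have hπ := Real.pi_gt_three
    set R := 2 ^ j * side N n / (2 * Real.pi) with hR
    have h1 := card_site_le (n := n) (fun z => |(z.valMinAbs : ℝ)| ≤ R) q (fun k hk μ => by
      have h2 := (abs_mom_le_momNorm N k μ).trans ((h k hk).resolve_right hj)
      rw [mom, abs_div, abs_mul, abs_of_pos (by positivity : 0 < 2 * Real.pi), abs_of_pos hs,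
        div_le_iff₀ hs] at h2
      rw [hR, le_div_iff₀ (by positivity)]
      linarith)
    have h2 := card_valMinAbs_le (n := n) (R := R) (by positivity)
    -- The extra 1 is the zero component, absorbed thanks to L ≥ 1.
    have h3 : 2 * R + 1 ≤ 2 * (2 ^ j * side N n) := by
      have h5 : (1 : ℝ) ≤ 2 ^ j := one_le_pow₀ (by norm_num)
      have h4 : 1 ≤ 2 ^ j * side N n := by nlinarith
      have h6 : 2 * R ≤ 2 ^ j * side N n := by
        rw [hR, mul_div_assoc', div_le_iff₀ (by positivity)]
        nlinarith
      linarith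
    calc ((Finset.univ.filter q).card : ℝ)
        ≤ ((Finset.univ.filter fun z : ZMod n => |(z.valMinAbs : ℝ)| ≤ R).card : ℝ) ^ 2 := by
          exact_mod_cast h1
      _ ≤ (2 * (2 ^ j * side N n)) ^ 2 := by
          refine pow_le_pow_left₀ (by positivity) (h2.trans h3) 2
      _ = _ := by rw [← h24]; ring

end Geometry


/-! ### Periodic denominators and cutoffs in momentum space -/

/-- The period `2π / a` of the momentum lattice. -/
noncomputable def momPeriod (N : ℕ) : ℝ := 2 * Real.pi * 2 ^ N

theorem momPeriod_pos (N : ℕ) : 0 < momPeriod N := by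
  have := Real.pi_pos
  unfold momPeriod; positivity

theorem latSin_add_int_mul (N : ℕ) (t : ℝ) (w : ℤ) :
    latSin N (t + momPeriod N * w) = latSin N t := by
  have : ((2 : ℝ) ^ N)⁻¹ * (t + momPeriod N * w) = ((2 : ℝ) ^ N)⁻¹ * t + w * (2 * Real.pi) := by
    unfold momPeriod; field_simp
  rw [latSin, this, Real.sin_add_int_mul_two_pi, latSin]

theorem latVer_add_int_mul (N : ℕ) (t : ℝ) (w : ℤ) :
    latVer N (t + momPeriod N * w) = latVer N t := by
  have : ((2 : ℝ) ^ N)⁻¹ * (t + momPeriod N * w) = ((2 : ℝ) ^ N)⁻¹ * t + w * (2 * Real.pi) := by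
    unfold momPeriod; field_simp
  rw [latVer, this, Real.cos_add_int_mul_two_pi, latVer]

theorem latVer_centeredRep (N : ℕ) (t : ℝ) :
    latVer N (centeredRep (momPeriod N) t) = latVer N t := by
  have := latVer_add_int_mul N t (-round (t / momPeriod N))
  rw [← this, centeredRep]
  congr 1; push_cast; ring

theorem sq_le_latVer (N : ℕ) {t : ℝ} (ht : |t| ≤ momPeriod N / 2) :
    2 / Real.pi ^ 2 * t ^ 2 ≤ 2 ^ N * latVer N t := by
  have h : |((2 : ℝ) ^ N)⁻¹ * t| ≤ Real.pi := by
    rw [abs_mul, abs_of_pos (by positivity), inv_mul_le_iff₀ (by positivity)]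
    refine ht.trans (le_of_eq ?_)
    unfold momPeriod; ring
  have h2 := Real.cos_le_one_sub_mul_cos_sq h
  have e : 2 / Real.pi ^ 2 * t ^ 2 =
      2 ^ N * (2 ^ N * (2 / Real.pi ^ 2 * (((2 : ℝ) ^ N)⁻¹ * t) ^ 2)) := by
    field_simp
  rw [e]
  unfold latVer
  gcongr
  linarith

/-- The common form of the fermionic and bosonic denominators. -/
noncomputable def latDen (N : ℕ) (al be ga t u : ℝ) : ℝ :=
  al + be * (2 ^ N * (latVer N t + latVer N u)) + ga * (latVer N t * latVer N u)

theorem latDen_comm (N : ℕ) (al be ga t u : ℝ) :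
    latDen N al be ga t u = latDen N al be ga u t := by
  unfold latDen; ring

/-- With u frozen, the denominator has the form treated in `gevreyAt_denominator`. -/
theorem latDen_eq (N : ℕ) (al be ga t u : ℝ) : latDen N al be ga t u =
    (al + be * (2 ^ N * latVer N u)) + (be + ga * (latVer N u / 2 ^ N)) * (2 ^ N * latVer N t) := by
  unfold latDen
  field_simp
  ring

/-- The cutoff functions, including the one for the lowest scale. -/
noncomputable def fullCutoff (χ : ℝ → ℝ) (N j : ℕ) (t : ℝ) : ℝ :=
  if j = 0 then χ t else scaleCutoff χ N j t

theorem IsCutoff.scaleCutoff_eq_zero {χ : ℝ → ℝ} (hχ : IsCutoff χ) {N j : ℕ} (hj : 0 < j) {t : ℝ}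
    (ht : 0 ≤ t) (h : t ≤ 2 ^ j / 4) : scaleCutoff χ N j t = 0 := by
  obtain ⟨i, rfl⟩ := Nat.exists_eq_succ_of_ne_zero hj.ne'
  have h2 : (0 : ℝ) < 2 ^ i := by positivity
  rw [Nat.succ_eq_add_one, pow_succ] at h
  have e1 : χ (t / 2 ^ (i + 1)) = 1 := by
    refine hχ.eq_one _ ⟨by positivity, ?_⟩
    rw [div_le_iff₀ (by positivity), pow_succ]; linarith
  have e2 : χ (t / 2 ^ i) = 1 := by
    refine hχ.eq_one _ ⟨by positivity, ?_⟩
    rw [div_le_iff₀ (by positivity)]; linarith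
  unfold scaleCutoff
  simp [e1, e2]

theorem IsCutoff.fullCutoff_eq_zero_of_le {χ : ℝ → ℝ} (hχ : IsCutoff χ) {N j : ℕ} (hjN : j < N)
    {t : ℝ} (h : 2 ^ j ≤ t) : fullCutoff χ N j t = 0 := by
  have h1 : ∀ i ≤ j, χ (t / 2 ^ i) = 0 := fun i hi => by
    refine hχ.eq_zero _ (Set.mem_Ici.2 ?_)
    rw [le_div_iff₀ (by positivity), one_mul]
    exact (pow_le_pow_right₀ (by norm_num) hi).trans h
  unfold fullCutoff scaleCutoff
  split_ifs with h0 h2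
  · have := h1 0 (by omega); simpa using this
  · omega
  · rw [h1 j le_rfl, h1 (j - 1) (by omega), sub_zero]

/-- The Gevrey bounds of the periodised single-scale cutoff along a coordinate direction. -/
theorem IsCutoff.exists_gevreyAt {χ : ℝ → ℝ} (hχ : IsCutoff χ) : ∃ A B : ℝ, 0 ≤ A ∧ 0 ≤ B ∧
    ∀ (N j : ℕ) (u : ℝ), 1 ≤ N → j ≤ N → ∀ t : ℝ,
      GevreyAt (fun s => fullCutoff χ N j √((centeredRep (momPeriod N) s) ^ 2 + u ^ 2)) t A
        (B * ((2 : ℝ) ^ j)⁻¹) := by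
  obtain ⟨A, B, hA, hB, hb⟩ := hχ.gevrey
  have hA1 : 1 ≤ A := by
    have := hb 0 0
    rw [iteratedDeriv_zero, hχ.eq_one 0 ⟨le_rfl, by norm_num⟩] at this
    simpa using this
  -- Only s < N is periodised, so that the support radius 2^s stays below half the period, π 2^N.
  -- The top scale is 1 minus the cutoff at s = N - 1 and is covered too.
  have base : ∀ (N s : ℕ) (u : ℝ), s < N → ∀ t,
      GevreyAt (fun t => χ (√((centeredRep (momPeriod N) t) ^ 2 + u ^ 2) / 2 ^ s)) t A
        ((B + 6) * ((2 : ℝ) ^ s)⁻¹) := by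
    intro N s u hs t
    have h2s : (0 : ℝ) < 2 ^ s := by positivity
    have e : ∀ t : ℝ, √(t ^ 2 + u ^ 2) / 2 ^ s =
        √((((2 : ℝ) ^ s)⁻¹ * t) ^ 2 + (((2 : ℝ) ^ s)⁻¹ * u) ^ 2) := fun t => by
      rw [mul_pow, mul_pow, ← mul_add, Real.sqrt_mul (by positivity), Real.sqrt_sq (by positivity),
        div_eq_inv_mul]
    have h1 : ∀ t, GevreyAt (fun t => χ (√(t ^ 2 + u ^ 2) / 2 ^ s)) t A
        ((B + 6) * ((2 : ℝ) ^ s)⁻¹) := by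
      intro t
      have := GevreyAt.comp_const_mul (gevreyAt_radial (q := ((2 : ℝ) ^ s)⁻¹ * u) hχ.smooth hA1 hB.le
        hχ.eq_one hb) (((2 : ℝ) ^ s)⁻¹) t
      simp only [e]
      rw [abs_of_pos (by positivity), mul_comm (((2 : ℝ) ^ s)⁻¹) (B + 6)] at this
      exact this
    refine gevreyAt_periodize (b := 2 ^ s) (momPeriod_pos N) ?_ (by positivity) h1 ?_ t
    · have : (2 : ℝ) ^ s < 2 ^ N := pow_lt_pow_right₀ (by norm_num) hs
      have := Real.pi_gt_three
      unfold momPeriod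
      nlinarith
    · intro t ht
      refine hχ.eq_zero _ (Set.mem_Ici.2 ?_)
      rw [le_div_iff₀ h2s, one_mul]
      refine ht.trans (Real.abs_le_sqrt ?_)
      nlinarith [sq_nonneg u]
  -- The amplitude 1 + 2A covers both a difference of two cutoffs and 1 minus a cutoff; the rate
  -- doubles because of the scale j - 1.
  refine ⟨1 + 2 * A, 2 * (B + 6), by positivity, by positivity, fun N j u hN hj t => ?_⟩
  have hle : (B + 6) * ((2 : ℝ) ^ j)⁻¹ ≤ 2 * (B + 6) * ((2 : ℝ) ^ j)⁻¹ := by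
    gcongr; linarith
  rcases Nat.eq_zero_or_pos j with rfl | hj0
  · have h := base N 0 u (by omega) t
    simp only [fullCutoff, if_true]
    simp only [pow_zero, div_one] at h
    exact h.mono (by linarith) (by positivity) (by simpa using hle)
  · have e2 : ((2 : ℝ) ^ (j - 1))⁻¹ = 2 * ((2 : ℝ) ^ j)⁻¹ := by
      obtain ⟨i, rfl⟩ := Nat.exists_eq_succ_of_ne_zero hj0.ne'
      rw [Nat.succ_eq_add_one, Nat.add_sub_cancel, pow_succ]
      field_simp
    have h1 := (base N (j - 1) u (by omega) t).const_mul (-1)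
    rw [e2, abs_neg, abs_one, one_mul, show (B + 6) * (2 * ((2 : ℝ) ^ j)⁻¹) =
      2 * (B + 6) * ((2 : ℝ) ^ j)⁻¹ by ring] at h1
    have e3 : ∀ s, fullCutoff χ N j s =
        (if j = N then 1 else χ (s / 2 ^ j)) + -1 * χ (s / 2 ^ (j - 1)) := fun s => by
      rw [fullCutoff, if_neg hj0.ne', scaleCutoff]; ring
    simp only [e3]
    by_cases hjN : j = N
    · simp only [hjN, if_true]
      rw [hjN] at h1
      have h0 := gevreyAt_const 1 t (2 * (B + 6) * ((2 : ℝ) ^ N)⁻¹) (by positivity)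
      exact (h0.add h1).mono (by simp; linarith) (by positivity) le_rfl
    · simp only [if_neg hjN]
      have h0 := (base N j u (by omega) t).mono le_rfl (by positivity) hle
      exact (h0.add h1).mono (by linarith) (by positivity) le_rfl

/-! ### Decay of single-scale kernels -/

section Decay

variable {N n : ℕ} [NeZero n]

theorem abs_mom_le (k : Site n) (μ : Fin 2) : |mom N k μ| ≤ momPeriod N / 2 := by
  have hn : (0 : ℝ) < n := by exact_mod_cast Nat.pos_of_ne_zero (NeZero.ne n)
  have h := ZMod.natAbs_valMinAbs_le (k μ)
  have h' : (k μ).valMinAbs.natAbs * 2 ≤ n := by omega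
  have h2 : (((k μ).valMinAbs.natAbs : ℝ)) * 2 ≤ n := by exact_mod_cast h'
  rw [Nat.cast_natAbs, Int.cast_abs] at h2
  have hπ := Real.pi_pos
  rw [mom, abs_div, abs_mul, abs_of_pos (by positivity : 0 < 2 * Real.pi),
    abs_of_pos (side_pos N), div_le_iff₀ (side_pos N)]
  have : momPeriod N / 2 * side N n = Real.pi * n := by
    unfold momPeriod side; field_simp
  rw [this]
  nlinarith

/-- Momentum components are taken in the centred cell, so a shift by z steps of 2π/L holds only up
to a multiple of the period. The symbols extended to the line are periodic and do not see it. -/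
theorem exists_mom_add_nsmul (k : Site n) (μ : Fin 2) (z : ℕ) : ∃ w : ℤ,
    mom N k μ + z * (2 * Real.pi / side N n) =
      mom N (k + z • unitVec μ : Site n) μ + momPeriod N * w := by
  have hn : (n : ℝ) ≠ 0 := by exact_mod_cast NeZero.ne n
  have h : (((k μ).valMinAbs + z : ℤ) : ZMod n) = (((k + z • unitVec μ : Site n) μ).valMinAbs : ℤ) := by
    push_cast [ZMod.coe_valMinAbs]
    simp [unitVec]
  obtain ⟨w, hw⟩ := (ZMod.intCast_eq_intCast_iff_dvd_sub _ _ _).1 h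
  refine ⟨-w, ?_⟩
  have hw' : (((k + z • unitVec μ : Site n) μ).valMinAbs : ℝ) = (k μ).valMinAbs + z + n * w := by
    have : ((k + z • unitVec μ : Site n) μ).valMinAbs = (k μ).valMinAbs + z + n * w := by linarith
    exact_mod_cast this
  rw [mom, mom, hw', momPeriod, side]
  push_cast
  field_simp
  ring

theorem mom_add_nsmul_of_ne (k : Site n) {μ ν : Fin 2} (h : ν ≠ μ) (z : ℕ) :
    mom N (k + z • unitVec μ) ν = mom N k ν := by
  simp [mom, unitVec, Pi.single_eq_of_ne h]

/-- The admissible numerators of a symbol of scale `j`. -/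
def IsNumerator (N j : ℕ) {n : ℕ} (num : Site n → ℝ) : Prop :=
  (num = fun _ => 2 ^ j) ∨ (∃ ν, num = fun k => latSin N (mom N k ν)) ∨
    ∃ ν, num = fun k => latVer N (mom N k ν)

/-- The denominator as a function on the momentum lattice. -/
noncomputable def siteDen (N : ℕ) {n : ℕ} (al be ga : ℝ) (k : Site n) : ℝ :=
  latDen N al be ga (mom N k 0) (mom N k 1)

theorem siteDen_eq (al be ga : ℝ) (k : Site n) (μ : Fin 2) :
    siteDen N al be ga k = latDen N al be ga (mom N k μ) (mom N k (1 - μ)) := by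
  fin_cases μ
  · rfl
  · exact latDen_comm _ _ _ _ _ _

theorem momNorm_eq (k : Site n) (μ : Fin 2) :
    momNorm N k = √(mom N k μ ^ 2 + mom N k (1 - μ) ^ 2) := by
  fin_cases μ
  · simp [momNorm]
  · simp [momNorm, add_comm]

/-- Both iterated differences are the same alternating binomial combination of the sampled values.
-/
theorem fwdDiff_iter_eq_of_sampling {φ : Site n → ℝ} {F : ℝ → ℝ} {e k : Site n} {h t : ℝ}
    (hF : ∀ z : ℕ, φ (k + z • e) = F (t + z * h)) (r : ℕ) :
    (fwdDiff e)^[r] φ k = (fwdDiff h)^[r] F t := by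
  rw [fwdDiff_iter_eq_sum_shift, fwdDiff_iter_eq_sum_shift]
  refine Finset.sum_congr rfl fun z _ => ?_
  rw [hF, nsmul_eq_mul]

theorem pi_sq_lt_ten : Real.pi ^ 2 < 10 := by
  nlinarith [Real.pi_lt_d2, Real.pi_pos]

theorem eq_one_sub_of_ne : ∀ μ ν : Fin 2, ν ≠ μ → ν = 1 - μ := by decide

theorem one_sub_ne : ∀ μ : Fin 2, 1 - μ ≠ μ := by decide

/-- The numerators restricted to a coordinate line. -/
theorem IsNumerator.exists_line {j : ℕ} {num : Site n → ℝ} (hnum : IsNumerator N j num)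
    (hj : j ≤ N) {d : ℝ} (hd : 0 < d) (hd1 : d ≤ 1) {al be ga : ℝ} (hal : 0 ≤ al) (hbe : 1 ≤ be)
    (hga : 0 ≤ ga) (k : Site n) (μ : Fin 2) :
    ∃ f : ℝ → ℝ, (∀ z : ℕ, num (k + z • unitVec μ) = f (mom N k μ + z * (2 * Real.pi / side N n))) ∧
      ∀ t, d * 4 ^ j ≤ latDen N al be ga t (mom N k (1 - μ)) →
        GevreyAt f t (√(latDen N al be ga t (mom N k (1 - μ))) * (2 / d)) ((2 : ℝ) ^ j)⁻¹ := by
  set u := mom N k (1 - μ) with hu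
  have hvu := latVer_nonneg N u
  have h2 : (0 : ℝ) < 2 ^ N := by positivity
  have hb1 : ∀ t, 2 ^ N * latVer N t ≤ latDen N al be ga t u := fun t => by
    have := latVer_nonneg N t
    unfold latDen
    nlinarith [mul_nonneg hga (mul_nonneg this hvu), mul_nonneg h2.le hvu, mul_nonneg h2.le this]
  have hb2 : ∀ t, 2 ^ N * latVer N u ≤ latDen N al be ga t u := fun t => by
    have := latVer_nonneg N t
    unfold latDen
    nlinarith [mul_nonneg hga (mul_nonneg this hvu), mul_nonneg h2.le hvu, mul_nonneg h2.le this]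
  have hconst : ∀ e : ℝ, (∀ t, d * 4 ^ j ≤ latDen N al be ga t u →
      |e| ≤ √(latDen N al be ga t u) * (2 / d)) → ∀ t, d * 4 ^ j ≤ latDen N al be ga t u →
        GevreyAt (fun _ => e) t (√(latDen N al be ga t u) * (2 / d)) ((2 : ℝ) ^ j)⁻¹ :=
    fun e he t ht => (gevreyAt_const e t _ (by positivity)).mono (he t ht) (by positivity) le_rfl
  have hsqrt : ∀ e t : ℝ, e ^ 2 ≤ 2 * (2 ^ N * latVer N u) → d * 4 ^ j ≤ latDen N al be ga t u →
      |e| ≤ √(latDen N al be ga t u) * (2 / d) := fun e t he ht => by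
    have hD0 : 0 ≤ latDen N al be ga t u := le_trans (by positivity) ht
    have h1 : |e| ≤ √(2 ^ 2 * latDen N al be ga t u) :=
      Real.abs_le_sqrt (he.trans (by linarith [hb2 t]))
    rw [Real.sqrt_mul (by norm_num), Real.sqrt_sq (by norm_num)] at h1
    refine h1.trans ?_
    rw [mul_comm]
    gcongr
    rw [le_div_iff₀ hd]; linarith
  have hne : ∀ ν, ν ≠ μ → ν = 1 - μ := fun ν => eq_one_sub_of_ne μ ν
  rcases hnum with rfl | ⟨ν, rfl⟩ | ⟨ν, rfl⟩
  · refine ⟨fun _ => 2 ^ j, fun _ => rfl, hconst _ fun t ht => ?_⟩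
    rw [abs_of_pos (by positivity)]
    refine (scale_le_sqrt hd hd1 ht).trans ?_
    rw [div_eq_mul_inv, div_eq_mul_inv]
    gcongr
    have : 0 < d⁻¹ := by positivity
    linarith
  · by_cases hν : ν = μ
    · subst hν
      refine ⟨latSin N, fun z => ?_, fun t ht => gevreyAt_latSin hj hd hd1 ht (hb1 t)⟩
      obtain ⟨w, hw⟩ := exists_mom_add_nsmul (N := N) k ν z
      rw [hw, latSin_add_int_mul]
    · refine ⟨fun _ => latSin N u, fun z => ?_, hconst _ fun t ht =>
        hsqrt _ t (latSin_sq_le N u) ht⟩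
      rw [hu, ← hne ν hν]
      simp only [mom_add_nsmul_of_ne k hν z]
  · by_cases hν : ν = μ
    · subst hν
      refine ⟨latVer N, fun z => ?_, fun t ht => gevreyAt_latVer hj hd hd1 ht (hb1 t)⟩
      obtain ⟨w, hw⟩ := exists_mom_add_nsmul (N := N) k ν z
      rw [hw, latVer_add_int_mul]
    · refine ⟨fun _ => latVer N u, fun z => ?_, hconst _ fun t ht =>
        hsqrt _ t (latVer_sq_le N u) ht⟩
      rw [hu, ← hne ν hν]
      simp only [mom_add_nsmul_of_ne k hν z]

/-- From 1 - cos θ ≥ 2θ²/π² on |θ| ≤ π, together with 2/π² ≥ 1/5. -/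
theorem latDen_lower {al be ga t u : ℝ} (hal : 0 ≤ al) (hbe : 1 ≤ be) (hga : 0 ≤ ga)
    (hu : |u| ≤ momPeriod N / 2) :
    1 / 5 * ((centeredRep (momPeriod N) t) ^ 2 + u ^ 2) ≤ latDen N al be ga t u := by
  have h1 := sq_le_latVer N (abs_centeredRep_le_half (momPeriod N) t (momPeriod_pos N))
  have h2 := sq_le_latVer N hu
  rw [latVer_centeredRep] at h1
  have h3 : 1 / 5 ≤ 2 / Real.pi ^ 2 := by
    rw [div_le_div_iff₀ (by norm_num) (by positivity)]; linarith [pi_sq_lt_ten]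
  have h4 := latVer_nonneg N t
  have h5 := latVer_nonneg N u
  have h6 : (0 : ℝ) < 2 ^ N := by positivity
  have h7 : (1 / 5) * (centeredRep (momPeriod N) t) ^ 2 ≤ 2 ^ N * latVer N t :=
    le_trans (by gcongr) h1
  have h8 : (1 / 5) * u ^ 2 ≤ 2 ^ N * latVer N u := le_trans (by gcongr) h2
  have h9 : 0 ≤ 2 ^ N * (latVer N t + latVer N u) := by positivity
  have h10 : 0 ≤ ga * (latVer N t * latVer N u) := by positivity
  unfold latDen
  nlinarith

/-- For j > 0 the cutoff forces |k| > 2^j/4, hence a denominator of at least 4^j/80. For j = 0 it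
does not exclude k = 0, and the mass term must supply the bound. The constant 1/100 serves both
cases. -/
theorem IsCutoff.latDen_lower_of_ne {χ : ℝ → ℝ} (hχ : IsCutoff χ) {j : ℕ} {al be ga t u : ℝ}
    (hal : 0 ≤ al) (hal1 : j = 0 → 1 ≤ al)
    (hbe : 1 ≤ be) (hga : 0 ≤ ga) (hu : |u| ≤ momPeriod N / 2)
    (h : fullCutoff χ N j √((centeredRep (momPeriod N) t) ^ 2 + u ^ 2) ≠ 0) :
    1 / 100 * 4 ^ j ≤ latDen N al be ga t u := by
  have h2 := latDen_lower (N := N) (t := t) hal hbe hga hu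
  rcases Nat.eq_zero_or_pos j with rfl | hj0
  · have h3 : al ≤ latDen N al be ga t u := by
      have h4 := latVer_nonneg N t
      have h5 := latVer_nonneg N u
      unfold latDen
      have : 0 ≤ be * (2 ^ N * (latVer N t + latVer N u)) := by positivity
      have : 0 ≤ ga * (latVer N t * latVer N u) := by positivity
      linarith
    have := hal1 rfl
    norm_num
    linarith
  · set R := (centeredRep (momPeriod N) t) ^ 2 + u ^ 2 with hR
    have hR0 : 0 ≤ R := by positivity
    have h3 : (2 : ℝ) ^ j / 4 < √R := by
      by_contra hcon
      apply h
      rw [fullCutoff, if_neg hj0.ne']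
      exact hχ.scaleCutoff_eq_zero hj0 (Real.sqrt_nonneg _) (not_lt.1 hcon)
    have h4 : ((2 : ℝ) ^ j / 4) ^ 2 ≤ R := by
      rw [← Real.sq_sqrt hR0]
      exact pow_le_pow_left₀ (by positivity) h3.le 2
    have h24 : ((2 : ℝ) ^ j) ^ 2 = 4 ^ j := by rw [← pow_mul, mul_comm, pow_mul]; norm_num
    rw [div_pow, h24] at h4
    have : (0 : ℝ) < 4 ^ j := by positivity
    linarith

/-- Decay of single-scale kernels. -/
theorem IsCutoff.exists_kernel_decay {χ : ℝ → ℝ} (hχ : IsCutoff χ) : ∃ c C : ℝ, 0 < c ∧ 0 < C ∧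
    ∀ (N n : ℕ) [NeZero n], 1 ≤ N → 1 ≤ side N n → ∀ j ≤ N, ∀ al be ga : ℝ, 0 ≤ al →
      (j = 0 → 1 ≤ al) → 1 ≤ be → be ≤ 3 → 0 ≤ ga → ga ≤ 2 → ∀ num : Site n → ℝ,
      IsNumerator N j num → ∀ x : Site n,
        ‖dualInt N fun k : Site n => phase N k x *
          ((fullCutoff χ N j (momNorm N k) * (num k * (siteDen N al be ga k)⁻¹) : ℝ) : ℂ)‖ ≤
          C * 2 ^ j * Real.exp (-(c * stretch N j x)) := by
  obtain ⟨A, B, hA, hB, hcut⟩ := hχ.exists_gevreyAt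
  set d : ℝ := 1 / 100 with hd
  set B' := B + 2 + 8 / d with hB'
  set A' := A * (2 / d) * d⁻¹ with hA'
  have hB'0 : 0 < B' := by positivity
  have hA'0 : 0 ≤ A' := by positivity
  have hπ := Real.pi_pos
  -- The largest c with c² π B' ≤ 1/2, the condition of `norm_sum_phase_mul_exp_le`.
  set c := √(1 / (2 * (Real.pi * B'))) with hc
  have hc0 : 0 < c := Real.sqrt_pos.2 (by positivity)
  have hc2 : c ^ 2 * (Real.pi * B') ≤ 1 / 2 := by
    rw [hc, Real.sq_sqrt (by positivity)]
    apply le_of_eq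
    field_simp
  refine ⟨c / 2, 16 * A' + 1, by positivity, by positivity, ?_⟩
  intro N n _ hN hside j hj al be ga hal hal1 hbe hbe3 hga hga2 num hnum x
  have hs := side_pos N (n := n)
  set φ : Site n → ℝ := fun k =>
    fullCutoff χ N j (momNorm N k) * (num k * (siteDen N al be ga k)⁻¹) with hφ
  have hcard : ((Finset.univ.filter fun k => φ k ≠ 0).card : ℝ) ≤ 4 * (side N n ^ 2 * 4 ^ j) := by
    refine card_momNorm_le N hside _ fun k hk => ?_
    rcases hj.lt_or_eq with h | h
    · left
      by_contra hcon
      exact hk (by rw [hφ]; simp [hχ.fullCutoff_eq_zero_of_le h (not_le.1 hcon).le])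
    · right; exact h
  have hdiff : ∀ μ r k, |(fwdDiff (unitVec μ))^[r] φ k| ≤
      A' * ((2 : ℝ) ^ j)⁻¹ * (2 * Real.pi / side N n * (B' * ((2 : ℝ) ^ j)⁻¹)) ^ r *
        (r.factorial : ℝ) ^ 2 := by
    intro μ r k
    set u := mom N k (1 - μ) with hu
    have huP : |u| ≤ momPeriod N / 2 := abs_mom_le k _
    obtain ⟨f, hf1, hf2⟩ := hnum.exists_line (d := d) hj (by norm_num) (by norm_num) hal hbe hga k μ
    have hvu := latVer_nonneg N u
    have hvu2 := latVer_le N u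
    have h2N : (0 : ℝ) < 2 ^ N := by positivity
    set al' := al + be * (2 ^ N * latVer N u) with hal'
    set be' := be + ga * (latVer N u / 2 ^ N) with hbe'
    have hden : ∀ t, latDen N al be ga t u = al' + be' * (2 ^ N * latVer N t) := fun t =>
      latDen_eq N al be ga t u
    have hal'0 : 0 ≤ al' := by positivity
    have hbe'0 : 0 ≤ be' := by positivity
    have hbe'8 : be' ≤ 8 := by
      have h1 : latVer N u / 2 ^ N ≤ 2 := by rw [div_le_iff₀ h2N]; exact hvu2
      have h2 : ga * (latVer N u / 2 ^ N) ≤ 2 * 2 := by gcongr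
      rw [hbe']; linarith
    have hcontden : Continuous fun t => latDen N al be ga t u := by
      simp only [hden]
      exact continuous_const.add (continuous_const.mul
        (continuous_const.mul (contDiff_latVer N).continuous))
    have hF := gevreyAt_symbol (num := f) (K := 8 / d) (K' := 2 / d) (d := d) (j := j)
      (by positivity) (by positivity) (by positivity) (by norm_num) hB hcontden (hcut N j u hN hj)
      (fun t ht => hχ.latDen_lower_of_ne hal hal1 hbe hga huP ht)
      (fun t ht => by
        have := gevreyAt_denominator (N := N) (j := j) (d := d) (t := t) hj (by positivity)
          (by norm_num) hal'0 hbe'0 hbe'8 (by rw [← hden]; exact ht)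
        simpa only [hden] using this)
      hf2
    -- On the line through k in direction μ, with the other component u frozen, φ is the sampling of
    -- a smooth function with step 2π/L.
    rw [fwdDiff_iter_eq_of_sampling (F := fun s =>
      fullCutoff χ N j √((centeredRep (momPeriod N) s) ^ 2 + u ^ 2) *
        (f s * (latDen N al be ga s u)⁻¹)) (h := 2 * Real.pi / side N n) (t := mom N k μ)]
    · refine (abs_fwdDiff_iter_le (by positivity) r _ (contDiff_of_gevreyAt hF)
        (fun t => (hF t).2 r) _).trans (le_of_eq ?_)
      rw [hA', ← hB', mul_pow (2 * Real.pi / side N n)]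
      ring
    · intro z
      have hne : (1 - μ) ≠ μ := one_sub_ne μ
      obtain ⟨w, hw⟩ := exists_mom_add_nsmul (N := N) k μ z
      rw [hφ]
      simp only
      rw [hf1 z, siteDen_eq _ _ _ _ μ, momNorm_eq _ μ, mom_add_nsmul_of_ne k hne z, ← hu, hw]
      congr 2
      · congr 2
        rw [← sq_abs (centeredRep _ _), abs_centeredRep_add_int_mul (momPeriod_pos N) w
          (abs_mom_le _ _), sq_abs]
      · rw [hden, hden, latVer_add_int_mul]
  have h := norm_sum_phase_mul_exp_le N φ x (c := c) (by positivity) hB'0.le hc2 hcard hdiff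
  rw [dualInt, norm_smul, Real.norm_eq_abs, abs_of_pos (by positivity)]
  have h24 : ((2 : ℝ) ^ j) ^ 2 = 4 ^ j := by rw [← pow_mul, mul_comm, pow_mul]; norm_num
  rw [Real.exp_neg, ← div_eq_mul_inv, le_div_iff₀ (Real.exp_pos _), mul_assoc]
  -- About L² 4^j modes of size 2^{-j}, normalised by L^{-2}, give the amplitude 2^j.
  calc (side N n ^ 2)⁻¹ * (‖∑ k, phase N k x * (φ k : ℂ)‖ * Real.exp (c / 2 * stretch N j x))
      ≤ (side N n ^ 2)⁻¹ * (4 * (4 * (side N n ^ 2 * 4 ^ j) * (A' * ((2 : ℝ) ^ j)⁻¹))) := by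
        gcongr
    _ = 16 * A' * 2 ^ j := by rw [← h24]; field_simp; ring
    _ ≤ _ := by
        have : (0 : ℝ) < 2 ^ j := by positivity
        nlinarith

end Decay


/-! ### Algebra of the normalised lattice sums -/

section Integrals

variable (N : ℕ) {n : ℕ} [NeZero n]

theorem siteInt_mono {f g : Site n → ℝ} (h : ∀ x, f x ≤ g x) : siteInt N f ≤ siteInt N g := by
  unfold siteInt
  exact smul_le_smul_of_nonneg_left (Finset.sum_le_sum fun x _ => h x) (by positivity)

theorem siteInt_nonneg {f : Site n → ℝ} (h : ∀ x, 0 ≤ f x) : 0 ≤ siteInt N f :=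
  smul_nonneg (by positivity) (Finset.sum_nonneg fun x _ => h x)

theorem siteInt_const_mul (c : ℝ) (f : Site n → ℝ) :
    siteInt N (fun x => c * f x) = c * siteInt N f := by
  simp only [siteInt, smul_eq_mul, ← Finset.mul_sum]; ring

theorem siteInt_const_mul_complex (c : ℂ) (f : Site n → ℂ) :
    siteInt N (fun x => c * f x) = c * siteInt N f := by
  simp only [siteInt, Complex.real_smul, ← Finset.mul_sum]; ring

theorem siteInt_add {E : Type*} [AddCommMonoid E] [Module ℝ E] (f g : Site n → E) :
    siteInt N (fun x => f x + g x) = siteInt N f + siteInt N g := by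
  simp only [siteInt, Finset.sum_add_distrib, smul_add]

theorem siteInt_sum {E : Type*} [AddCommMonoid E] [Module ℝ E] {ι : Type*} (s : Finset ι)
    (f : ι → Site n → E) :
    siteInt N (fun x => ∑ i ∈ s, f i x) = ∑ i ∈ s, siteInt N (f i) := by
  simp only [siteInt, Finset.smul_sum]
  exact Finset.sum_comm

theorem siteInt_comm {E : Type*} [AddCommMonoid E] [Module ℝ E] (f : Site n → Site n → E) :
    siteInt N (fun x => siteInt N fun y => f x y) = siteInt N (fun y => siteInt N fun x => f x y) := by
  simp only [siteInt, ← Finset.smul_sum]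
  rw [Finset.sum_comm]

theorem siteInt_equiv {E : Type*} [AddCommMonoid E] [Module ℝ E] (e : Site n ≃ Site n)
    (f : Site n → E) : siteInt N (fun x => f (e x)) = siteInt N f := by
  simp only [siteInt, Equiv.sum_comp]

theorem siteInt_add_right {E : Type*} [AddCommMonoid E] [Module ℝ E] (y : Site n)
    (f : Site n → E) : siteInt N (fun x => f (x + y)) = siteInt N f :=
  siteInt_equiv N (Equiv.addRight y) f

theorem siteInt_sub_right {E : Type*} [AddCommMonoid E] [Module ℝ E] (y : Site n)
    (f : Site n → E) : siteInt N (fun x => f (x - y)) = siteInt N f :=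
  siteInt_equiv N (Equiv.subRight y) f

theorem siteInt_sub_left {E : Type*} [AddCommMonoid E] [Module ℝ E] (y : Site n)
    (f : Site n → E) : siteInt N (fun x => f (y - x)) = siteInt N f :=
  siteInt_equiv N (Equiv.subLeft y) f

theorem siteInt_neg {E : Type*} [AddCommMonoid E] [Module ℝ E]
    (f : Site n → E) : siteInt N (fun x => f (-x)) = siteInt N f :=
  siteInt_equiv N (Equiv.neg _) f

theorem norm_siteInt_le (f : Site n → ℂ) : ‖siteInt N f‖ ≤ siteInt N fun x => ‖f x‖ := by
  unfold siteInt
  rw [norm_smul, Real.norm_eq_abs, abs_of_nonneg (by positivity), smul_eq_mul]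
  gcongr
  exact norm_sum_le _ _

theorem dualInt_const_mul_complex (c : ℂ) (f : Site n → ℂ) :
    dualInt N (fun x => c * f x) = c * dualInt N f := by
  simp only [dualInt, Complex.real_smul, ← Finset.mul_sum]; ring

theorem dualInt_add {E : Type*} [AddCommMonoid E] [Module ℝ E] (f g : Site n → E) :
    dualInt N (fun x => f x + g x) = dualInt N f + dualInt N g := by
  simp only [dualInt, Finset.sum_add_distrib, smul_add]

theorem dualInt_sum {E : Type*} [AddCommMonoid E] [Module ℝ E] {ι : Type*} (s : Finset ι)
    (f : ι → Site n → E) :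
    dualInt N (fun x => ∑ i ∈ s, f i x) = ∑ i ∈ s, dualInt N (f i) := by
  simp only [dualInt, Finset.smul_sum]
  exact Finset.sum_comm

theorem norm_dualInt_le (f : Site n → ℂ) : ‖dualInt N f‖ ≤ dualInt N fun x => ‖f x‖ := by
  unfold dualInt
  have := side_pos N (n := n)
  rw [norm_smul, Real.norm_eq_abs, abs_of_nonneg (by positivity), smul_eq_mul]
  gcongr
  exact norm_sum_le _ _

theorem dualInt_mono {f g : Site n → ℝ} (h : ∀ x, f x ≤ g x) : dualInt N f ≤ dualInt N g := by
  unfold dualInt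
  have := side_pos N (n := n)
  exact smul_le_smul_of_nonneg_left (Finset.sum_le_sum fun x _ => h x) (by positivity)

end Integrals

/-! ### The lattice Dirac operator and the sum over scales -/

section Symbols

variable {N n : ℕ}

theorem sinMom_eq (k : Site n) (μ : Fin 2) : sinMom N k μ = latSin N (mom N k μ) := by
  rw [sinMom, latSin, div_eq_inv_mul]

theorem wilsonMass_eq (k : Site n) :
    wilsonMass N k = latVer N (mom N k 0) + latVer N (mom N k 1) := by
  have h : ∀ t : ℝ, 2 * (2 ^ N * Real.sin (t / 2 ^ (N + 1)) ^ 2) = latVer N t := fun t => by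
    have e : ((2 : ℝ) ^ N)⁻¹ * t = 2 * (t / 2 ^ (N + 1)) := by
      rw [pow_succ]; field_simp
    rw [latVer, e, Real.cos_two_mul, Real.cos_sq']
    ring
  rw [wilsonMass, Fin.sum_univ_two, mul_add, h, h]

/-- The mass term `m + M_N(k)` of the lattice Dirac operator. -/
noncomputable def massTerm (N : ℕ) (m : ℝ) (k : Site n) : ℝ :=
  m + (latVer N (mom N k 0) + latVer N (mom N k 1))

/-- The adjugate of the lattice Dirac operator. -/
noncomputable def diracAdj (N : ℕ) (m : ℝ) (k : Site n) : Matrix (Fin 2) (Fin 2) ℂ :=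
  !![(massTerm N m k : ℂ) + Complex.I * latSin N (mom N k 0), latSin N (mom N k 1);
     -latSin N (mom N k 1), massTerm N m k - Complex.I * latSin N (mom N k 0)]

/-- The determinant of the lattice Dirac operator. -/
noncomputable def diracDet (N : ℕ) (m : ℝ) (k : Site n) : ℝ :=
  latSin N (mom N k 0) ^ 2 + latSin N (mom N k 1) ^ 2 + massTerm N m k ^ 2

theorem diracDet_eq_siteDen (m : ℝ) (k : Site n) :
    diracDet N m k = siteDen N (m ^ 2) (2 + 2 * m / 2 ^ N) 2 k := by
  rw [diracDet, latSin_sq, latSin_sq, massTerm, siteDen, latDen]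
  field_simp
  ring

theorem diracOp_inv (m : ℝ) (k : Site n) :
    (diracOp N m k)⁻¹ = ((diracDet N m k)⁻¹ : ℂ) • diracAdj N m k := by
  have e : diracOp N m k = !![(massTerm N m k : ℂ) - Complex.I * latSin N (mom N k 0),
      -latSin N (mom N k 1); (latSin N (mom N k 1) : ℂ),
      massTerm N m k + Complex.I * latSin N (mom N k 0)] := by
    ext i j
    have hI := Complex.I_mul_I
    fin_cases i <;> fin_cases j <;>
      simp [diracOp, gam, sinMom_eq, wilsonMass_eq, massTerm, Fin.sum_univ_two] <;>
      first
        | ring1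
        | linear_combination (latSin N (mom N k 1) : ℂ) * hI
        | linear_combination (-(latSin N (mom N k 1) : ℂ)) * hI
  have hdet : (diracOp N m k).det = (diracDet N m k : ℂ) := by
    rw [e, Matrix.det_fin_two_of, diracDet]
    push_cast
    linear_combination (-(latSin N (mom N k 0) : ℂ) ^ 2) * Complex.I_mul_I
  -- If the determinant vanishes, both sides are 0 by the convention for inverses, so the zero mode
  -- at m = 0 needs no separate treatment.
  rw [Matrix.inv_def, hdet, Ring.inverse_eq_inv', e, Matrix.adjugate_fin_two_of, diracAdj]
  simp

/-- N ≥ 1 is essential: at N = 0 and m = -1 the coefficient of the versines would vanish. For N = 0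
there is no fermionic scale, so nothing is lost. -/
theorem mass_coeff_bounds {m : ℝ} (hm : |m| ≤ 1) (hN : 1 ≤ N) :
    1 ≤ 2 + 2 * m / 2 ^ N ∧ 2 + 2 * m / 2 ^ N ≤ 3 := by
  have h2 : (2 : ℝ) ≤ 2 ^ N := by
    calc (2 : ℝ) = 2 ^ 1 := by norm_num
      _ ≤ 2 ^ N := pow_le_pow_right₀ (by norm_num) hN
  have h1 := abs_le.1 hm
  have h3 : |2 * m / 2 ^ N| ≤ 1 := by
    rw [abs_div, abs_mul, abs_two, abs_of_pos (by positivity : (0 : ℝ) < 2 ^ N),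
      div_le_one (by positivity)]
    linarith
  have h4 := abs_le.1 h3
  constructor <;> linarith

theorem sum_scaleCutoff (χ : ℝ → ℝ) {h : ℕ} (hN : h < N) (t : ℝ) :
    ∑ j ∈ Finset.Icc (h + 1) N, scaleCutoff χ N j t = 1 - χ (t / 2 ^ h) := by
  have key : ∀ M, h + 1 ≤ M → M ≤ N → ∑ j ∈ Finset.Icc (h + 1) M, scaleCutoff χ N j t =
      (if M = N then 1 else χ (t / 2 ^ M)) - χ (t / 2 ^ h) := by
    intro M hM
    induction M, hM using Nat.le_induction with
    | base => intro _; simp [scaleCutoff]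
    | succ M hM ih =>
      intro hMN
      rw [Finset.sum_Icc_succ_top (by omega), ih (by omega), if_neg (by omega), scaleCutoff,
        Nat.add_sub_cancel]
      ring
  rw [key N hN le_rfl, if_pos rfl]

theorem sum_fullCutoff (χ : ℝ → ℝ) (hN : 1 ≤ N) (t : ℝ) :
    ∑ j ∈ Finset.range (N + 1), fullCutoff χ N j t = 1 := by
  have e : Finset.range (N + 1) = insert 0 (Finset.Icc (0 + 1) N) := by
    ext j; simp; omega
  have h0 : (0 : ℕ) ∉ Finset.Icc (0 + 1) N := by simp
  rw [e, Finset.sum_insert h0]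
  have : ∀ j ∈ Finset.Icc (0 + 1) N, fullCutoff χ N j t = scaleCutoff χ N j t := fun j hj => by
    have := (Finset.mem_Icc.1 hj).1
    rw [fullCutoff, if_neg (by omega)]
  rw [Finset.sum_congr rfl this, sum_scaleCutoff χ (by omega : 0 < N)]
  simp [fullCutoff]

end Symbols

/-! ### Propagators as combinations of scalar single-scale kernels -/

section Propagators

variable {N n : ℕ} [NeZero n]

/-- A scalar single-scale kernel. -/
noncomputable def scaleKernel (χ : ℝ → ℝ) (N j : ℕ) (al be ga : ℝ) (num : Site n → ℝ) (x : Site n) : ℂ :=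
  dualInt N fun k : Site n => phase N k x *
    ((fullCutoff χ N j (momNorm N k) * (num k * (siteDen N al be ga k)⁻¹) : ℝ) : ℂ)

/-- Each entry of the adjugate combines at most four admissible numerators with coefficients of
modulus at most 1; the bare mass enters as (m/2^j) · 2^j. -/
theorem norm_scaleProp_le {χ : ℝ → ℝ} {j : ℕ} (hj0 : 0 < j) {m K : ℝ} (hm : |m| ≤ 1) (x : Site n)
    (h : ∀ num : Site n → ℝ, IsNumerator N j num →
      ‖scaleKernel χ N j (m ^ 2) (2 + 2 * m / 2 ^ N) 2 num x‖ ≤ K) (s s' : Fin 2) :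
    ‖scaleProp χ N m j x s s'‖ ≤ 4 * K := by
  have h1 := h (fun _ => 2 ^ j) (Or.inl rfl)
  have hs := fun ν => h (fun k => latSin N (mom N k ν)) (Or.inr (Or.inl ⟨ν, rfl⟩))
  have hv := fun ν => h (fun k => latVer N (mom N k ν)) (Or.inr (Or.inr ⟨ν, rfl⟩))
  set T := scaleKernel χ N j (m ^ 2) (2 + 2 * m / 2 ^ N) 2 (n := n) with hT
  have hK : 0 ≤ K := (norm_nonneg _).trans h1
  have hentry : ∀ s s', scaleProp χ N m j x s s' = dualInt N fun k : Site n =>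
      (phase N k x * (fullCutoff χ N j (momNorm N k) * (diracDet N m k)⁻¹ : ℂ)) *
        diracAdj N m k s s' := by
    intro s s'
    simp only [scaleProp, dualInt, Matrix.smul_apply, Matrix.sum_apply, diracOp_inv, smul_eq_mul,
      fullCutoff, if_neg hj0.ne']
    congr 1
    refine Finset.sum_congr rfl fun k _ => by push_cast; ring
  have hlin : ∀ (num : Site n → ℝ), T num x = dualInt N fun k : Site n =>
      (phase N k x * (fullCutoff χ N j (momNorm N k) * (diracDet N m k)⁻¹ : ℂ)) * num k := by
    intro num
    rw [hT, scaleKernel]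
    congr 1
    ext k
    rw [diracDet_eq_siteDen]
    push_cast
    ring
  set a : Site n → ℂ := fun k =>
    phase N k x * (fullCutoff χ N j (momNorm N k) * (diracDet N m k)⁻¹ : ℂ) with ha
  have hdiag : ∀ c : ℂ, ‖c‖ ≤ 1 → ‖dualInt N fun k : Site n => a k *
      ((massTerm N m k : ℂ) + c * latSin N (mom N k 0))‖ ≤ 4 * K := by
    intro c hc
    have e : (dualInt N fun k : Site n => a k * ((massTerm N m k : ℂ) + c * latSin N (mom N k 0))) =
        (m / 2 ^ j : ℂ) * T (fun _ => 2 ^ j) x + (T (fun k => latVer N (mom N k 0)) x +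
          (T (fun k => latVer N (mom N k 1)) x + c * T (fun k => latSin N (mom N k 0)) x)) := by
      simp only [hlin]
      rw [← dualInt_const_mul_complex, ← dualInt_const_mul_complex, ← dualInt_add, ← dualInt_add,
        ← dualInt_add]
      congr 1
      ext k
      simp only [ha, massTerm]
      push_cast
      have : (2 : ℂ) ^ j ≠ 0 := pow_ne_zero _ two_ne_zero
      field_simp
      ring
    have hmj : ‖(m / 2 ^ j : ℂ)‖ ≤ 1 := by
      rw [norm_div, norm_pow, Complex.norm_real, Real.norm_eq_abs, Complex.norm_ofNat]
      exact div_le_one_of_le₀ (hm.trans (one_le_pow₀ (by norm_num))) (by positivity)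
    rw [e]
    refine (norm_add_le _ _).trans ((add_le_add le_rfl ((norm_add_le _ _).trans
      (add_le_add le_rfl (norm_add_le _ _)))).trans ?_)
    rw [norm_mul, norm_mul]
    have i1 := mul_le_mul hmj h1 (norm_nonneg _) zero_le_one
    have i2 := mul_le_mul hc (hs 0) (norm_nonneg _) zero_le_one
    linarith [hv 0, hv 1]
  rw [hentry]
  fin_cases s <;> fin_cases s'
  · exact hdiag Complex.I (by simp)
  · have := hs 1
    rw [hlin] at this
    exact this.trans (by linarith)
  · have := hs 1
    rw [hlin, ← norm_neg, ← neg_one_mul, ← dualInt_const_mul_complex] at this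
    refine le_trans (le_of_eq ?_) (this.trans (by linarith))
    congr 2
    ext k
    simp [diracAdj]
  · refine le_trans (le_of_eq ?_) (hdiag (-Complex.I) (by simp))
    congr 2
    ext k
    simp [diracAdj, ha, sub_eq_add_neg]

theorem sum_norm_sigmaMom_sq (M : ℝ) (k : Site n) :
    (∑ α, ‖sigmaMom N k α‖ ^ 2 + M ^ 2 : ℝ) = siteDen N (M ^ 2) 2 0 k := by
  have h : ∀ α, ‖sigmaMom N k α‖ ^ 2 = 2 * (2 ^ N * latVer N (mom N k α)) := fun α => by
    have e : -Complex.I * ((mom N k α / 2 ^ N : ℝ) : ℂ) =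
        Complex.I * ((-(mom N k α / 2 ^ N) : ℝ) : ℂ) := by push_cast; ring
    rw [sigmaMom, norm_mul, norm_mul, Complex.norm_I, one_mul, norm_pow, Complex.norm_ofNat, e,
      Complex.norm_exp_I_mul_ofReal_sub_one, mul_pow, Real.norm_eq_abs, sq_abs, mul_pow,
      Real.sin_sq_eq_half_sub, latVer, mul_div_cancel₀ _ (by norm_num : (2 : ℝ) ≠ 0), Real.cos_neg,
      div_eq_inv_mul]
    ring
  rw [Fin.sum_univ_two, h, h, siteDen, latDen]
  ring

/-- The cutoffs of the scales 0, …, N form a partition of unity. The numerator 1 is written as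
2^{-j} · 2^j to become admissible. -/
theorem bosonProp_eq (χ : ℝ → ℝ) (hN : 1 ≤ N) (M : ℝ) (μ ν : Fin 2) (x : Site n) :
    bosonProp N M μ ν x = (if μ = ν then 1 else 0) *
      ∑ j ∈ Finset.range (N + 1), ((2 : ℂ) ^ j)⁻¹ *
        scaleKernel χ N j (M ^ 2) 2 0 (fun _ => 2 ^ j) x := by
  simp only [scaleKernel, ← dualInt_const_mul_complex, ← dualInt_sum]
  rw [bosonProp]
  congr 1
  ext k
  rw [sum_norm_sigmaMom_sq]
  have h := sum_fullCutoff χ hN (momNorm N k)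
  have : ∀ j ∈ Finset.range (N + 1), ((2 : ℂ) ^ j)⁻¹ * (phase N k x *
      ((fullCutoff χ N j (momNorm N k) * (2 ^ j * (siteDen N (M ^ 2) 2 0 k)⁻¹) : ℝ) : ℂ)) =
      (fullCutoff χ N j (momNorm N k) : ℂ) * (phase N k x * ((siteDen N (M ^ 2) 2 0 k : ℝ) : ℂ)⁻¹) := by
    intro j _
    have : (2 : ℂ) ^ j ≠ 0 := pow_ne_zero _ two_ne_zero
    push_cast
    field_simp
  rw [Finset.sum_congr rfl this, ← Finset.sum_mul, ← Complex.ofReal_sum, h]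
  push_cast
  ring

theorem phase_unitVec_sub_one (k : Site n) (μ : Fin 2) :
    2 ^ N * (phase N k (unitVec μ) - 1) =
      -(latVer N (mom N k μ) : ℂ) - Complex.I * latSin N (mom N k μ) := by
  rw [phase_unitVec, show -Complex.I * ((mom N k μ / 2 ^ N : ℝ) : ℂ) =
    ((-(((2 : ℝ) ^ N)⁻¹ * mom N k μ) : ℝ) : ℂ) * Complex.I by push_cast; ring, Complex.exp_mul_I,
    ← Complex.ofReal_cos, ← Complex.ofReal_sin, Real.cos_neg, Real.sin_neg, latVer, latSin]
  push_cast
  ring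

/-- A forward difference multiplies the symbol by -latVer - i latSin. Both are admissible
numerators, so the gradient obeys the kernel bound 2^j scale by scale. -/
theorem latticeDeriv_bosonProp_eq (χ : ℝ → ℝ) (hN : 1 ≤ N) (M : ℝ) (α μ ν : Fin 2) (x : Site n) :
    latticeDeriv N α (bosonProp N M) μ ν x = (if μ = ν then 1 else 0) *
      ∑ j ∈ Finset.range (N + 1),
        (-scaleKernel χ N j (M ^ 2) 2 0 (fun k => latVer N (mom N k α)) x +
          -Complex.I * scaleKernel χ N j (M ^ 2) 2 0 (fun k => latSin N (mom N k α)) x) := by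
  have h : ∀ j, -scaleKernel χ N j (M ^ 2) 2 0 (fun k => latVer N (mom N k α)) x +
          -Complex.I * scaleKernel χ N j (M ^ 2) 2 0 (fun k => latSin N (mom N k α)) x =
      2 ^ N * (((2 : ℂ) ^ j)⁻¹ * scaleKernel χ N j (M ^ 2) 2 0 (fun _ => 2 ^ j) (x + unitVec α) -
        ((2 : ℂ) ^ j)⁻¹ * scaleKernel χ N j (M ^ 2) 2 0 (fun _ => 2 ^ j) x) := by
    intro j
    rw [← neg_one_mul (scaleKernel χ N j (M ^ 2) 2 0 (fun k => latVer N (mom N k α)) x),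
      sub_eq_add_neg, ← neg_one_mul (((2 : ℂ) ^ j)⁻¹ * _)]
    simp only [scaleKernel]
    simp only [← dualInt_const_mul_complex, ← dualInt_add]
    congr 1
    ext k
    have e := phase_unitVec_sub_one (N := N) k α
    have h2 : (2 : ℂ) ^ j ≠ 0 := pow_ne_zero _ two_ne_zero
    rw [phase_add_right]
    push_cast
    field_simp
    linear_combination (-phase N k x * fullCutoff χ N j (momNorm N k) *
      ((siteDen N (M ^ 2) 2 0 k : ℝ) : ℂ)⁻¹) * e
  rw [Finset.sum_congr rfl fun j _ => h j, ← Finset.mul_sum, Finset.sum_sub_distrib, latticeDeriv,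
    bosonProp_eq χ hN, bosonProp_eq χ hN]
  ring

end Propagators


/-! ### The stretched exponential weight -/

/-- The weight `exp ((κ / 2) √|x|)`. -/
noncomputable def weight (κ : ℝ) (N : ℕ) {n : ℕ} (x : Site n) : ℝ :=
  Real.exp (κ / 2 * √(torusNorm N x))

section Weight

variable {κ : ℝ} {N n : ℕ}

theorem weight_pos (x : Site n) : 0 < weight κ N x := Real.exp_pos _

theorem weight_neg (x : Site n) : weight κ N (-x) = weight κ N x := by
  rw [weight, torusNorm_neg, weight]

theorem sqrt_add_le_add_sqrt {a b : ℝ} (ha : 0 ≤ a) (hb : 0 ≤ b) : √(a + b) ≤ √a + √b := by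
  rw [Real.sqrt_le_left (by positivity)]
  nlinarith [Real.sq_sqrt ha, Real.sq_sqrt hb, Real.sqrt_nonneg a, Real.sqrt_nonneg b,
    mul_nonneg (Real.sqrt_nonneg a) (Real.sqrt_nonneg b)]

theorem weight_add_le (hκ : 0 ≤ κ) (x y : Site n) :
    weight κ N (x + y) ≤ weight κ N x * weight κ N y := by
  unfold weight
  rw [← Real.exp_add, ← mul_add]
  apply Real.exp_le_exp.2
  gcongr
  exact (Real.sqrt_le_sqrt (torusNorm_add_le N x y)).trans
    (sqrt_add_le_add_sqrt (torusNorm_nonneg N x) (torusNorm_nonneg N y))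

theorem weight_le_of_torusNorm_le (hκ : 0 ≤ κ) {x y : Site n} (h : torusNorm N x ≤ torusNorm N y) :
    weight κ N x ≤ weight κ N y := by
  unfold weight
  apply Real.exp_le_exp.2
  gcongr

theorem weight_le_exp_of_le_one (hκ : 0 ≤ κ) {x : Site n} (h : torusNorm N x ≤ 1) :
    weight κ N x ≤ Real.exp (κ / 2) := by
  unfold weight
  apply Real.exp_le_exp.2
  refine mul_le_of_le_one_right (by positivity) ?_
  rw [Real.sqrt_le_left zero_le_one]
  simpa using h

theorem weight_le_exp_stretch {c : ℝ} (hκ : 0 ≤ κ) (hκc : κ ≤ c) (j : ℕ) (x : Site n) :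
    weight κ N x ≤ Real.exp (c / 2 * stretch N j x) := by
  unfold weight
  apply Real.exp_le_exp.2
  have := sqrt_torusNorm_le_stretch N j x
  have h0 := Real.sqrt_nonneg (torusNorm N x)
  exact mul_le_mul (by linarith) this h0 (by linarith)

end Weight

theorem sum_Icc_pow_le {q : ℝ} (h0 : 0 ≤ q) (h1 : q < 1) (h N : ℕ) :
    ∑ j ∈ Finset.Icc (h + 1) N, q ^ j ≤ q ^ h / (1 - q) := by
  have e : Finset.Icc (h + 1) N = Finset.Ico (h + 1) (N + 1) := by ext; simp
  rw [e]
  refine (geom_sum_Ico_le_of_lt_one h0 h1).trans ?_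
  have : 0 < 1 - q := by linarith
  gcongr ?_ / _
  rw [pow_succ]
  exact mul_le_of_le_one_right (by positivity) h1.le

theorem sq_add_one_le_exp {c s : ℝ} (hc : 0 < c) (hs : 0 ≤ s) :
    s ^ 2 + 1 ≤ (1 + 8 / c ^ 2) * Real.exp (c / 2 * s) := by
  have hz : 0 ≤ c / 2 * s := by positivity
  have h1 := Real.pow_div_factorial_le_exp (c / 2 * s) hz 2
  have h2 : 1 ≤ Real.exp (c / 2 * s) := Real.one_le_exp hz
  have h3 : s ^ 2 = 8 / c ^ 2 * ((c / 2 * s) ^ 2 / (Nat.factorial 2 : ℝ)) := by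
    rw [Nat.factorial_two]; push_cast; field_simp; ring
  have h4 : s ^ 2 ≤ 8 / c ^ 2 * Real.exp (c / 2 * s) := by
    rw [h3]; gcongr
  linarith

/-! ### Weighted moments of the propagators -/

section Bounds

variable {N n : ℕ} [NeZero n] {κ c C : ℝ}

/-- Half of the decay pays for the weight, the other half for the integration. -/
theorem siteInt_weight_mul_le (hκ : 0 ≤ κ) (hκc : κ ≤ c) (hc : 0 < c)
    {j : ℕ} (hj : j ≤ N) {f : Site n → ℝ}
    {K : ℝ} (hK : 0 ≤ K) (hf : ∀ x, f x ≤ K * Real.exp (-(c * stretch N j x))) :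
    siteInt N (fun x => weight κ N x * f x) ≤
      K * ((4 * (2 + 48 / (c / 2) ^ 4)) ^ 2 * ((4 : ℝ) ^ j)⁻¹) := by
  have h1 := siteInt_exp_neg_stretch_le N (n := n) (half_pos hc) hj
  have h2 : siteInt N (fun x => weight κ N x * f x) ≤
      siteInt N (fun x : Site n => K * Real.exp (-(c / 2 * stretch N j x))) := by
    refine siteInt_mono N fun x => ?_
    calc weight κ N x * f x
        ≤ Real.exp (c / 2 * stretch N j x) * (K * Real.exp (-(c * stretch N j x))) :=
          (mul_le_mul_of_nonneg_left (hf x) (weight_pos x).le).trans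
            (mul_le_mul_of_nonneg_right (weight_le_exp_stretch hκ hκc j x) (by positivity))
      _ = K * (Real.exp (c / 2 * stretch N j x) * Real.exp (-(c * stretch N j x))) := by ring
      _ = _ := by rw [← Real.exp_add]; congr 2; ring
  rw [siteInt_const_mul] at h2
  exact h2.trans (mul_le_mul_of_nonneg_left h1 hK)

/-- Squaring doubles the exponential decay, and the surplus absorbs the polynomial `stretch`² + 1
that bounds 2^j (|x| + a). Amplitude squared, length and area give 4^j · 2^{-j} · 4^{-j}. -/
theorem siteInt_torusNorm_weight_sq_le (hκ : 0 ≤ κ) (hκc : κ ≤ c) (hc : 0 < c)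
    {j : ℕ} (hj : j ≤ N) {f : Site n → ℂ} {K : ℝ}
    (hf : ∀ x, ‖f x‖ ≤ K * 2 ^ j * Real.exp (-(c * stretch N j x))) :
    siteInt N (fun x => (torusNorm N x + ((2 : ℝ) ^ N)⁻¹) * weight κ N x * ‖f x‖ ^ 2) ≤
      K ^ 2 * (1 + 8 / c ^ 2) * (4 * (2 + 48 / (c / 2) ^ 4)) ^ 2 * ((2 : ℝ) ^ j)⁻¹ := by
  have h24 : ((2 : ℝ) ^ j) ^ 2 = 4 ^ j := by rw [← pow_mul, mul_comm, pow_mul]; norm_num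
  have h2 : ∀ x : Site n, (torusNorm N x + ((2 : ℝ) ^ N)⁻¹) * weight κ N x * ‖f x‖ ^ 2 =
      weight κ N x * ((torusNorm N x + ((2 : ℝ) ^ N)⁻¹) * ‖f x‖ ^ 2) := fun x => by ring
  simp only [h2]
  refine (siteInt_weight_mul_le hκ hκc hc hj (K := K ^ 2 * (1 + 8 / c ^ 2) * 2 ^ j)
    (by positivity) fun x => ?_).trans (le_of_eq ?_)
  · have h3 := two_pow_mul_torusNorm_le N j x
    have h4 := sq_add_one_le_exp hc (stretch_nonneg N j x)
    have h5 : torusNorm N x + ((2 : ℝ) ^ N)⁻¹ ≤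
        ((2 : ℝ) ^ j)⁻¹ * (stretch N j x ^ 2 + 1) := by
      rw [mul_add, mul_one]
      refine add_le_add ?_ ?_
      · rw [le_inv_mul_iff₀ (by positivity)]; exact h3
      · exact inv_anti₀ (by positivity) (pow_le_pow_right₀ (by norm_num) hj)
    have h6 : Real.exp (c / 2 * stretch N j x) * Real.exp (-(c * stretch N j x)) ^ 2 ≤
        Real.exp (-(c * stretch N j x)) := by
      rw [← Real.exp_nat_mul, ← Real.exp_add]
      apply Real.exp_le_exp.2
      have := mul_nonneg hc.le (stretch_nonneg N j x)
      push_cast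
      linarith
    calc (torusNorm N x + ((2 : ℝ) ^ N)⁻¹) * ‖f x‖ ^ 2
        ≤ (((2 : ℝ) ^ j)⁻¹ * ((1 + 8 / c ^ 2) * Real.exp (c / 2 * stretch N j x))) *
            (K * 2 ^ j * Real.exp (-(c * stretch N j x))) ^ 2 := by
          refine mul_le_mul (h5.trans ?_) (pow_le_pow_left₀ (norm_nonneg _) (hf x) 2)
            (by positivity) (by positivity)
          gcongr
      _ = K ^ 2 * (1 + 8 / c ^ 2) * 2 ^ j * (Real.exp (c / 2 * stretch N j x) *
            Real.exp (-(c * stretch N j x)) ^ 2) := by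
          field_simp
      _ ≤ _ := by gcongr
  · rw [← h24]; field_simp

end Bounds

/-- Weighted bounds of the fermion and boson propagators, uniform in the lattice. -/
theorem IsCutoff.exists_propagator_bounds {χ : ℝ → ℝ} (hχ : IsCutoff χ) :
    ∃ κ₀ C : ℝ, 0 < κ₀ ∧ 0 ≤ C ∧ ∀ (N n : ℕ) [NeZero n], 1 ≤ N → 1 ≤ side N n →
      ∀ κ : ℝ, 0 < κ → κ ≤ κ₀ →
      (∀ m : ℝ, |m| ≤ 1 → ∀ (h : ℕ) (s s' : Fin 2),
        siteInt N (fun x : Site n => (torusNorm N x + ((2 : ℝ) ^ N)⁻¹) * weight κ N x *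
          ‖fermiProp χ N m h x s s'‖ ^ 2) ≤ C * ((2 : ℝ) ^ h)⁻¹) ∧
      ∀ M : ℝ, 1 ≤ M → ∀ μ ν : Fin 2,
        siteInt N (fun x : Site n => weight κ N x * ‖bosonProp N M μ ν x‖) ≤ C ∧
        ∀ α, siteInt N (fun x : Site n =>
          weight κ N x * ‖latticeDeriv N α (bosonProp N M) μ ν x‖) ≤ C := by
  obtain ⟨c, C, hc, hC, hdecay⟩ := hχ.exists_kernel_decay
  set G := (4 * (2 + 48 / (c / 2) ^ 4)) ^ 2 with hG
  have hG0 : 0 ≤ G := by positivity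
  refine ⟨c, 12 * ((4 * C) ^ 2 * (1 + 8 / c ^ 2) * G) + 4 * (C * G), hc, by positivity, ?_⟩
  intro N n _ hN hside κ hκ hκc
  refine ⟨fun m hm h s s' => ?_, fun M hM μ ν => ⟨?_, fun α => ?_⟩⟩
  · obtain ⟨hb1, hb3⟩ := mass_coeff_bounds hm hN
    set E := (4 * C) ^ 2 * (1 + 8 / c ^ 2) * G with hE
    have hE0 : 0 ≤ E := by positivity
    have hj : ∀ j ∈ Finset.Icc (h + 1) N,
        siteInt N (fun x : Site n => (torusNorm N x + ((2 : ℝ) ^ N)⁻¹) * weight κ N x *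
          ‖scaleProp χ N m j x s s'‖ ^ 2) ≤ E * ((2 : ℝ) ^ j)⁻¹ := by
      intro j hj
      obtain ⟨hj1, hj2⟩ := Finset.mem_Icc.1 hj
      refine siteInt_torusNorm_weight_sq_le hκ.le hκc hc hj2 fun x => ?_
      refine (norm_scaleProp_le (by omega) hm x (fun num hnum =>
        hdecay N n hN hside j hj2 (m ^ 2) _ 2 (sq_nonneg m) (by omega) hb1 hb3 (by norm_num) le_rfl
          num hnum x) s s').trans (le_of_eq (by ring))
    -- Cauchy–Schwarz with weights (2/3)^j decouples the scales. Any ratio strictly between 1/2 and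
    -- 1 would do: here (2/3)(3/4) = 1/2 restores the rate 2^{-h}.
    have hpt : ∀ x : Site n, ‖fermiProp χ N m h x s s'‖ ^ 2 ≤
        (3 * (2 / 3) ^ h) * ∑ j ∈ Finset.Icc (h + 1) N, (3 / 2) ^ j *
          ‖scaleProp χ N m j x s s'‖ ^ 2 := by
      intro x
      have e : fermiProp χ N m h x s s' = ∑ j ∈ Finset.Icc (h + 1) N, scaleProp χ N m j x s s' := by
        rw [fermiProp, Matrix.sum_apply]
      have h1 : ‖fermiProp χ N m h x s s'‖ ≤
          ∑ j ∈ Finset.Icc (h + 1) N, ‖scaleProp χ N m j x s s'‖ := by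
        rw [e]; exact norm_sum_le _ _
      have h2 := Finset.sum_sq_le_sum_mul_sum_of_sq_le_mul (Finset.Icc (h + 1) N)
        (r := fun j => ‖scaleProp χ N m j x s s'‖) (f := fun j => (2 / 3 : ℝ) ^ j)
        (g := fun j => (3 / 2 : ℝ) ^ j * ‖scaleProp χ N m j x s s'‖ ^ 2)
        (fun j _ => by positivity) (fun j _ => by positivity) (fun j _ => by
          rw [← mul_assoc, ← mul_pow]; norm_num)
      have h3 := sum_Icc_pow_le (q := 2 / 3) (by norm_num) (by norm_num) h N
      refine (pow_le_pow_left₀ (norm_nonneg _) h1 2).trans (h2.trans ?_)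
      gcongr
      · exact h3.trans (le_of_eq (by ring))
    calc siteInt N (fun x : Site n => (torusNorm N x + ((2 : ℝ) ^ N)⁻¹) * weight κ N x *
          ‖fermiProp χ N m h x s s'‖ ^ 2)
        ≤ siteInt N (fun x : Site n => (3 * (2 / 3) ^ h) * ∑ j ∈ Finset.Icc (h + 1) N, (3 / 2) ^ j *
          ((torusNorm N x + ((2 : ℝ) ^ N)⁻¹) * weight κ N x * ‖scaleProp χ N m j x s s'‖ ^ 2)) := by
          refine siteInt_mono N fun x => ?_
          have hw : 0 ≤ (torusNorm N x + ((2 : ℝ) ^ N)⁻¹) * weight κ N x :=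
            mul_nonneg (add_nonneg (torusNorm_nonneg N x) (by positivity)) (weight_pos x).le
          refine (mul_le_mul_of_nonneg_left (hpt x) hw).trans (le_of_eq ?_)
          rw [mul_left_comm, Finset.mul_sum (s := Finset.Icc (h + 1) N)
            (a := (torusNorm N x + ((2 : ℝ) ^ N)⁻¹) * weight κ N x)]
          congr 1
          refine Finset.sum_congr rfl fun j _ => by ring
      _ = (3 * (2 / 3) ^ h) * ∑ j ∈ Finset.Icc (h + 1) N, (3 / 2) ^ j *
          siteInt N (fun x : Site n => (torusNorm N x + ((2 : ℝ) ^ N)⁻¹) * weight κ N x *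
            ‖scaleProp χ N m j x s s'‖ ^ 2) := by
          rw [siteInt_const_mul, siteInt_sum]
          simp only [siteInt_const_mul]
      _ ≤ (3 * (2 / 3) ^ h) * ∑ j ∈ Finset.Icc (h + 1) N, (3 / 2) ^ j * (E * ((2 : ℝ) ^ j)⁻¹) := by
          refine mul_le_mul_of_nonneg_left (Finset.sum_le_sum fun j hj' => ?_) (by positivity)
          exact mul_le_mul_of_nonneg_left (hj j hj') (by positivity)
      _ = (3 * (2 / 3) ^ h) * (E * ∑ j ∈ Finset.Icc (h + 1) N, (3 / 4) ^ j) := by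
          congr 1
          rw [Finset.mul_sum]
          refine Finset.sum_congr rfl fun j _ => ?_
          rw [mul_left_comm, ← inv_pow, ← mul_pow]
          norm_num
      _ ≤ (3 * (2 / 3) ^ h) * (E * ((3 / 4) ^ h / (1 - 3 / 4))) := by
          gcongr
          exact sum_Icc_pow_le (by norm_num) (by norm_num) h N
      _ = 12 * E * ((2 : ℝ) ^ h)⁻¹ := by
          have : ((2 : ℝ) ^ h)⁻¹ = (2 / 3) ^ h * (3 / 4) ^ h := by
            rw [← mul_pow, ← inv_pow]; norm_num
          rw [this]; ring
      _ ≤ _ := by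
          gcongr
          linarith [mul_nonneg hC.le hG0]
  all_goals
    have hgeom : ∑ j ∈ Finset.range (N + 1), ((2 : ℝ) ^ j)⁻¹ ≤ 2 := by
      have h1 : ∀ j, ((2 : ℝ) ^ j)⁻¹ = (1 / 2) ^ j := fun j => by rw [← inv_pow]; norm_num
      simp only [h1]
      exact sum_geometric_two_le _
    have hM2 : 1 ≤ M ^ 2 := one_le_pow₀ hM
    have hdec : ∀ j ∈ Finset.range (N + 1), ∀ num : Site n → ℝ, IsNumerator N j num →
        siteInt N (fun x : Site n => weight κ N x *
          ‖scaleKernel χ N j (M ^ 2) 2 0 num x‖) ≤ C * G * ((2 : ℝ) ^ j)⁻¹ := by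
      intro j hj num hnum
      have hj : j ≤ N := Nat.lt_succ_iff.1 (Finset.mem_range.1 hj)
      refine (siteInt_weight_mul_le hκ.le hκc hc hj (K := C * 2 ^ j) (by positivity) fun x =>
        hdecay N n hN hside j hj (M ^ 2) 2 0 (sq_nonneg M) (fun _ => hM2) (by norm_num)
          (by norm_num) le_rfl (by norm_num) num hnum x).trans (le_of_eq ?_)
      have h24 : ((2 : ℝ) ^ j) ^ 2 = 4 ^ j := by rw [← pow_mul, mul_comm, pow_mul]; norm_num
      rw [← hG, ← h24]
      field_simp
  · calc siteInt N (fun x : Site n => weight κ N x * ‖bosonProp N M μ ν x‖)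
        ≤ siteInt N (fun x : Site n => ∑ j ∈ Finset.range (N + 1), weight κ N x *
            ‖scaleKernel χ N j (M ^ 2) 2 0 (fun _ => 2 ^ j) x‖) := by
          refine siteInt_mono N fun x => ?_
          rw [← Finset.mul_sum]
          refine mul_le_mul_of_nonneg_left ?_ (weight_pos x).le
          rw [bosonProp_eq χ hN, norm_mul]
          refine (mul_le_of_le_one_left (norm_nonneg _) (by split_ifs <;> simp)).trans
            ((norm_sum_le _ _).trans (Finset.sum_le_sum fun j _ => ?_))
          rw [norm_mul]
          -- The factor 2^{-j} may be dropped, since the integrals of the kernels already decay like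
          -- 2^{-j}.
          refine mul_le_of_le_one_left (norm_nonneg _) ?_
          rw [norm_inv, norm_pow, Complex.norm_ofNat]
          exact inv_le_one_of_one_le₀ (one_le_pow₀ (by norm_num))
      _ ≤ ∑ j ∈ Finset.range (N + 1), C * G * ((2 : ℝ) ^ j)⁻¹ := by
          rw [siteInt_sum]
          exact Finset.sum_le_sum fun j hj => hdec j hj _ (Or.inl rfl)
      _ ≤ C * G * 2 := by
          rw [← Finset.mul_sum]; gcongr
      _ ≤ _ := by
          have : 0 ≤ 12 * ((4 * C) ^ 2 * (1 + 8 / c ^ 2) * G) := by positivity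
          linarith [mul_nonneg hC.le hG0]
  · calc siteInt N (fun x : Site n => weight κ N x * ‖latticeDeriv N α (bosonProp N M) μ ν x‖)
        ≤ siteInt N (fun x : Site n => ∑ j ∈ Finset.range (N + 1), (weight κ N x *
            ‖scaleKernel χ N j (M ^ 2) 2 0 (fun k => latVer N (mom N k α)) x‖ + weight κ N x *
            ‖scaleKernel χ N j (M ^ 2) 2 0 (fun k => latSin N (mom N k α)) x‖)) := by
          refine siteInt_mono N fun x => ?_
          simp only [← mul_add]
          rw [← Finset.mul_sum]
          refine mul_le_mul_of_nonneg_left ?_ (weight_pos x).le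
          rw [latticeDeriv_bosonProp_eq χ hN, norm_mul]
          refine (mul_le_of_le_one_left (norm_nonneg _) (by split_ifs <;> simp)).trans
            ((norm_sum_le _ _).trans (Finset.sum_le_sum fun j _ => ?_))
          refine (norm_add_le _ _).trans (le_of_eq ?_)
          rw [norm_neg, norm_mul, norm_neg, Complex.norm_I, one_mul]
      _ ≤ ∑ j ∈ Finset.range (N + 1), (C * G * ((2 : ℝ) ^ j)⁻¹ + C * G * ((2 : ℝ) ^ j)⁻¹) := by
          rw [siteInt_sum]
          refine Finset.sum_le_sum fun j hj => ?_
          rw [siteInt_add]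
          exact add_le_add (hdec j hj _ (Or.inr (Or.inr ⟨α, rfl⟩)))
            (hdec j hj _ (Or.inr (Or.inl ⟨α, rfl⟩)))
      _ ≤ C * G * 2 + C * G * 2 := by
          rw [Finset.sum_add_distrib, ← Finset.mul_sum]; gcongr
      _ ≤ _ := by
          have : 0 ≤ 12 * ((4 * C) ^ 2 * (1 + 8 / c ^ 2) * G) := by positivity
          linarith [mul_nonneg hC.le hG0]


/-! ### The bubble in position and momentum space -/

theorem sum_intUnits {E : Type*} [AddCommMonoid E] (f : ℤˣ → E) : ∑ ε, f ε = f 1 + f (-1) := by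
  rw [show (Finset.univ : Finset ℤˣ) = {1, -1} from rfl, Finset.sum_pair (by decide)]

/-- The position of the first leg of a vertex, relative to its base point. -/
def legOne {n : ℕ} : BubbleKind → Fin 2 → ℤˣ → Site n
  | BubbleKind.vector, μ, ε => if ε = 1 then 0 else unitVec μ
  | BubbleKind.chiral, _, _ => 0

/-- The position of the second leg of a vertex, relative to its base point. -/
def legTwo {n : ℕ} : BubbleKind → Fin 2 → ℤˣ → Site n
  | BubbleKind.vector, μ, ε => if ε = 1 then unitVec μ else 0
  | BubbleKind.chiral, _, _ => 0

/-- The spin matrix of a vertex. -/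
noncomputable def spinMat (Z : ℝ) : BubbleKind → Fin 2 → ℤˣ → Matrix (Fin 2) (Fin 2) ℂ
  | BubbleKind.vector, μ, ε =>
    if ε = 1 then (1 / 2 : ℂ) • (gam μ - 1) else (-(1 / 2) : ℂ) • (gam μ + 1)
  | BubbleKind.chiral, μ, ε => (1 / 2 * sgn ε * (Z : ℂ)) • (gam μ * gamFive)

theorem secondVertex_eq (N : ℕ) {n : ℕ} (Z : ℝ) (t : BubbleKind) (b : BLabel n) (η η' : FLabel n) :
    secondVertex N Z t b η η' = siteDelta N (η.1 - (b.1 + legOne t b.2.1 b.2.2)) *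
      (siteDelta N (η'.1 - (b.1 + legTwo t b.2.1 b.2.2)) * spinMat Z t b.2.1 b.2.2 η.2 η'.2) := by
  cases t
  · by_cases hε : b.2.2 = 1
    · simp only [secondVertex, vertex, legOne, legTwo, spinMat, if_pos hε, add_zero, sub_sub,
        Matrix.smul_apply, smul_eq_mul]
      ring
    · simp only [secondVertex, vertex, legOne, legTwo, spinMat, if_neg hε, add_zero, sub_sub,
        Matrix.smul_apply, smul_eq_mul]
      ring
  · simp only [secondVertex, chiralVertex, legOne, legTwo, spinMat, add_zero, Matrix.smul_apply,
      smul_eq_mul]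
    ring

theorem vertex_eq (N : ℕ) {n : ℕ} (Z : ℝ) (b : BLabel n) (η η' : FLabel n) :
    vertex N b η η' = secondVertex N Z BubbleKind.vector b η η' := rfl

section Bubble

variable {N n : ℕ} [NeZero n]

theorem siteInt_siteDelta_mul (y : Site n) (f : Site n → ℂ) :
    siteInt N (fun x => siteDelta N (x - y) * f x) = f y := by
  rw [siteInt, Finset.sum_eq_single y]
  · simp only [siteDelta, sub_self, if_true, Complex.real_smul]
    push_cast
    rw [← mul_assoc, pow_mul', ← mul_pow, inv_mul_cancel₀ (pow_ne_zero _ two_ne_zero), one_pow,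
      one_mul]
  · intro x _ hx
    simp [siteDelta, sub_eq_zero, hx]
  · simp

theorem fInt_siteDelta_mul (y : Site n) (f : FLabel n → ℂ) :
    fInt N (fun η => siteDelta N (η.1 - y) * f η) = ∑ s, f (y, s) := by
  simp only [fInt]
  exact Finset.sum_congr rfl fun s _ => siteInt_siteDelta_mul y fun x => f (x, s)

theorem fInt_const_mul (c : ℂ) (f : FLabel n → ℂ) :
    fInt N (fun η => c * f η) = c * fInt N f := by
  simp only [fInt, siteInt_const_mul_complex, Finset.mul_sum]

/-- The spin sum `tr (V X W Y)` of a bubble. -/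
noncomputable def spinSum (V W X Y : Matrix (Fin 2) (Fin 2) ℂ) : ℂ :=
  ∑ s₁, ∑ s₁', ∑ s₂, ∑ s₂', V s₁ s₁' * W s₂ s₂' * (X s₁' s₂ * Y s₂' s₁)

/-- The bubble as a function of the difference of the base points. -/
noncomputable def bubbleProfile (χ : ℝ → ℝ) (N : ℕ) {n : ℕ} [NeZero n] (m Z : ℝ) (h : ℕ)
    (t : BubbleKind) (μ : Fin 2) (ε : ℤˣ) (ν : Fin 2) (ε' : ℤˣ) (z : Site n) : ℂ :=
  1 / 2 * spinSum (spinMat Z BubbleKind.vector μ ε) (spinMat Z t ν ε')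
    (fermiProp χ N m h (z + (legTwo BubbleKind.vector μ ε - legOne t ν ε')))
    (fermiProp χ N m h (-z + (legTwo t ν ε' - legOne BubbleKind.vector μ ε)))

/-- The four delta functions pin the legs at fixed offsets from the base points, and the propagators
are translation invariant. -/
theorem bubble_eq (χ : ℝ → ℝ) (m Z : ℝ) (h : ℕ) (t : BubbleKind) (x y : Site n) (μ ν : Fin 2)
    (ε ε' : ℤˣ) : bubble χ N m Z h t (x, μ, ε) (y, ν, ε') =
      bubbleProfile χ N m Z h t μ ε ν ε' (x - y) := by
  have h1 : ∀ η₁ η₁' : FLabel n, (fInt N fun η₂ : FLabel n => fInt N fun η₂' : FLabel n =>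
      vertex N (x, μ, ε) η₁ η₁' * secondVertex N Z t (y, ν, ε') η₂ η₂' *
        fermiKernel χ N m h η₁' η₂ * fermiKernel χ N m h η₂' η₁) =
      siteDelta N (η₁.1 - (x + legOne BubbleKind.vector μ ε)) *
        (siteDelta N (η₁'.1 - (x + legTwo BubbleKind.vector μ ε)) *
          ∑ s₂, ∑ s₂', spinMat Z BubbleKind.vector μ ε η₁.2 η₁'.2 * spinMat Z t ν ε' s₂ s₂' *
            (fermiKernel χ N m h η₁' (y + legOne t ν ε', s₂) *
              fermiKernel χ N m h (y + legTwo t ν ε', s₂') η₁)) := by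
    intro η₁ η₁'
    rw [vertex_eq N Z, secondVertex_eq]
    have e : ∀ η₂ η₂' : FLabel n,
        siteDelta N (η₁.1 - (x + legOne BubbleKind.vector μ ε)) *
        (siteDelta N (η₁'.1 - (x + legTwo BubbleKind.vector μ ε)) *
          spinMat Z BubbleKind.vector μ ε η₁.2 η₁'.2) * secondVertex N Z t (y, ν, ε') η₂ η₂' *
          fermiKernel χ N m h η₁' η₂ * fermiKernel χ N m h η₂' η₁ =
        siteDelta N (η₂.1 - (y + legOne t ν ε')) * (siteDelta N (η₂'.1 - (y + legTwo t ν ε')) *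
          (siteDelta N (η₁.1 - (x + legOne BubbleKind.vector μ ε)) *
          siteDelta N (η₁'.1 - (x + legTwo BubbleKind.vector μ ε)) *
          (spinMat Z BubbleKind.vector μ ε η₁.2 η₁'.2 * spinMat Z t ν ε' η₂.2 η₂'.2 *
            (fermiKernel χ N m h η₁' η₂ * fermiKernel χ N m h η₂' η₁)))) := fun η₂ η₂' => by
      rw [secondVertex_eq]; ring
    simp only [e, fInt_const_mul, fInt_siteDelta_mul]
    simp only [Finset.mul_sum]
    refine Finset.sum_congr rfl fun s _ => Finset.sum_congr rfl fun s' _ => by ring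
  have h2 : ∀ η₁ : FLabel n, (fInt N fun η₁' : FLabel n =>
      siteDelta N (η₁.1 - (x + legOne BubbleKind.vector μ ε)) *
        (siteDelta N (η₁'.1 - (x + legTwo BubbleKind.vector μ ε)) *
          ∑ s₂, ∑ s₂', spinMat Z BubbleKind.vector μ ε η₁.2 η₁'.2 * spinMat Z t ν ε' s₂ s₂' *
            (fermiKernel χ N m h η₁' (y + legOne t ν ε', s₂) *
              fermiKernel χ N m h (y + legTwo t ν ε', s₂') η₁))) =
      siteDelta N (η₁.1 - (x + legOne BubbleKind.vector μ ε)) * ∑ s₁',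
          ∑ s₂, ∑ s₂', spinMat Z BubbleKind.vector μ ε η₁.2 s₁' * spinMat Z t ν ε' s₂ s₂' *
            (fermiKernel χ N m h (x + legTwo BubbleKind.vector μ ε, s₁') (y + legOne t ν ε', s₂) *
              fermiKernel χ N m h (y + legTwo t ν ε', s₂') η₁) := fun η₁ => by
    rw [fInt_const_mul]
    congr 1
    exact fInt_siteDelta_mul (x + legTwo BubbleKind.vector μ ε) fun η₁' : FLabel n =>
      ∑ s₂, ∑ s₂', spinMat Z BubbleKind.vector μ ε η₁.2 η₁'.2 * spinMat Z t ν ε' s₂ s₂' *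
            (fermiKernel χ N m h η₁' (y + legOne t ν ε', s₂) *
              fermiKernel χ N m h (y + legTwo t ν ε', s₂') η₁)
  have h3 := fInt_siteDelta_mul (N := N) (x + legOne BubbleKind.vector μ ε)
    fun η₁ : FLabel n => ∑ s₁',
          ∑ s₂, ∑ s₂', spinMat Z BubbleKind.vector μ ε η₁.2 s₁' * spinMat Z t ν ε' s₂ s₂' *
            (fermiKernel χ N m h (x + legTwo BubbleKind.vector μ ε, s₁') (y + legOne t ν ε', s₂) *
              fermiKernel χ N m h (y + legTwo t ν ε', s₂') η₁)
  rw [bubble, bubbleProfile, spinSum]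
  simp only [h1, h2]
  rw [h3]
  simp only [fermiKernel, add_sub_add_comm, neg_sub]

/-- The total cutoff of the propagator `g^{(h,N]}`. -/
noncomputable def fermiCut (χ : ℝ → ℝ) (N h : ℕ) (t : ℝ) : ℝ :=
  ∑ j ∈ Finset.Icc (h + 1) N, scaleCutoff χ N j t

theorem fermiProp_apply (χ : ℝ → ℝ) (m : ℝ) (h : ℕ) (x : Site n) (s s' : Fin 2) :
    fermiProp χ N m h x s s' = dualInt N fun k : Site n => phase N k x *
      ((fermiCut χ N h (momNorm N k) : ℂ) * ((diracDet N m k : ℂ))⁻¹ * diracAdj N m k s s') := by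
  have e : ∀ j, scaleProp χ N m j x s s' = dualInt N fun k : Site n => phase N k x *
      ((scaleCutoff χ N j (momNorm N k) : ℂ) * ((diracDet N m k : ℂ))⁻¹ * diracAdj N m k s s') := by
    intro j
    simp only [scaleProp, dualInt, Matrix.smul_apply, Matrix.sum_apply, diracOp_inv, smul_eq_mul]
    congr 1
    refine Finset.sum_congr rfl fun k _ => by ring
  rw [fermiProp, Matrix.sum_apply, Finset.sum_congr rfl fun j _ => e j, ← dualInt_sum]
  congr 1
  ext k
  rw [fermiCut, ← Finset.mul_sum]
  push_cast
  simp only [Finset.sum_mul]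

/-- Integration over the relative position sets the external momentum to zero: orthogonality of the
phases makes both propagators carry the same k. -/
theorem siteInt_dualInt_mul_dualInt (φ ψ : Site n → ℂ) (u u' : Site n) :
    (siteInt N fun z : Site n => (dualInt N fun k => phase N k (z + u) * φ k) *
      (dualInt N fun k => phase N k (-z + u') * ψ k)) =
      dualInt N fun k => phase N k (u + u') * (φ k * ψ k) := by
  have h1 : ∀ z : Site n, (∑ k, phase N k (z + u) * φ k) * (∑ k, phase N k (-z + u') * ψ k) =
      ∑ k, ∑ k', phase N (k - k') z * (phase N k u * phase N k' u' * (φ k * ψ k')) := by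
    intro z
    rw [Finset.sum_mul_sum]
    refine Finset.sum_congr rfl fun k _ => Finset.sum_congr rfl fun k' _ => ?_
    rw [sub_eq_add_neg, phase_add_left, phase_neg_left, phase_add_right, phase_add_right]
    ring
  have h2 : ∑ z : Site n, (∑ k, phase N k (z + u) * φ k) * (∑ k, phase N k (-z + u') * ψ k) =
      ∑ k, (n : ℂ) ^ 2 * (phase N k (u + u') * (φ k * ψ k)) := by
    simp only [h1]
    rw [Finset.sum_comm]
    refine Finset.sum_congr rfl fun k _ => ?_
    rw [Finset.sum_comm, Finset.sum_eq_single k]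
    · rw [← Finset.sum_mul, sum_phase, sub_self, if_pos rfl, phase_add_right]
    · intro k' _ hk'
      rw [← Finset.sum_mul, sum_phase, if_neg (sub_ne_zero.2 hk'.symm), zero_mul]
    · simp
  simp only [dualInt, siteInt, Complex.real_smul]
  have h3 : ∀ z : Site n, (((side N n ^ 2)⁻¹ : ℝ) : ℂ) * (∑ k, phase N k (z + u) * φ k) *
      ((((side N n ^ 2)⁻¹ : ℝ) : ℂ) * ∑ k, phase N k (-z + u') * ψ k) =
      (((side N n ^ 2)⁻¹ : ℝ) : ℂ) ^ 2 *
        ((∑ k, phase N k (z + u) * φ k) * (∑ k, phase N k (-z + u') * ψ k)) := fun z => by ring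
  simp only [h3]
  rw [← Finset.mul_sum, h2, ← Finset.mul_sum]
  have hn : (n : ℂ) ≠ 0 := by exact_mod_cast NeZero.ne n
  simp only [side]
  push_cast
  field_simp

/-- The integral of the bubble over one of its arguments. -/
theorem siteInt_bubbleProfile (χ : ℝ → ℝ) (m Z : ℝ) (h : ℕ) (t : BubbleKind) (μ ν : Fin 2)
    (ε ε' : ℤˣ) : siteInt N (bubbleProfile χ N (n := n) m Z h t μ ε ν ε') =
      dualInt N fun k : Site n =>
        1 / 2 * ((fermiCut χ N h (momNorm N k) : ℂ) * ((diracDet N m k : ℂ))⁻¹) ^ 2 *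
        spinSum (phase N k (legTwo BubbleKind.vector μ ε - legOne BubbleKind.vector μ ε) •
            spinMat Z BubbleKind.vector μ ε)
          (phase N k (legTwo t ν ε' - legOne t ν ε') • spinMat Z t ν ε')
          (diracAdj N m k) (diracAdj N m k) := by
  unfold bubbleProfile spinSum
  rw [siteInt_const_mul_complex]
  simp only [mul_assoc (1 / 2 : ℂ)]
  rw [dualInt_const_mul_complex]
  congr 1
  simp only [Finset.mul_sum, siteInt_sum, dualInt_sum]
  refine Finset.sum_congr rfl fun s₁ _ => Finset.sum_congr rfl fun s₁' _ =>
    Finset.sum_congr rfl fun s₂ _ => Finset.sum_congr rfl fun s₂' _ => ?_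
  simp only [siteInt_const_mul_complex, fermiProp_apply, siteInt_dualInt_mul_dualInt]
  rw [← dualInt_const_mul_complex]
  congr 1
  ext k
  have e : (legTwo BubbleKind.vector μ ε - legOne t ν ε' : Site n) +
      (legTwo t ν ε' - legOne BubbleKind.vector μ ε) =
      (legTwo BubbleKind.vector μ ε - legOne BubbleKind.vector μ ε) +
        (legTwo t ν ε' - legOne t ν ε') := by abel
  rw [e, phase_add_right]
  simp only [Matrix.smul_apply, smul_eq_mul]
  ring

theorem spinSum_add_left (V V' W X Y : Matrix (Fin 2) (Fin 2) ℂ) :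
    spinSum (V + V') W X Y = spinSum V W X Y + spinSum V' W X Y := by
  simp only [spinSum, Matrix.add_apply, add_mul, Finset.sum_add_distrib]

theorem spinSum_add_right (V W W' X Y : Matrix (Fin 2) (Fin 2) ℂ) :
    spinSum V (W + W') X Y = spinSum V W X Y + spinSum V W' X Y := by
  simp only [spinSum, Matrix.add_apply, mul_add, add_mul, Finset.sum_add_distrib]

theorem spinSum_smul_left (c : ℂ) (V W X Y : Matrix (Fin 2) (Fin 2) ℂ) :
    spinSum (c • V) W X Y = c * spinSum V W X Y := by
  simp only [spinSum, Matrix.smul_apply, smul_eq_mul, Finset.mul_sum, mul_assoc]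

theorem spinSum_smul_right (c : ℂ) (V W X Y : Matrix (Fin 2) (Fin 2) ℂ) :
    spinSum V (c • W) X Y = c * spinSum V W X Y := by
  simp only [spinSum, Matrix.smul_apply, smul_eq_mul, Finset.mul_sum]
  refine Finset.sum_congr rfl fun s₁ _ => Finset.sum_congr rfl fun s₁' _ =>
    Finset.sum_congr rfl fun s₂ _ => Finset.sum_congr rfl fun s₂' _ => by ring

/-- The momentum-space vertex with both orientations, `∑ ε, ε c_ε`. -/
noncomputable def oddVertex (N : ℕ) {n : ℕ} (Z : ℝ) (t : BubbleKind) (μ : Fin 2) (k : Site n) :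
    Matrix (Fin 2) (Fin 2) ℂ :=
  ∑ ε : ℤˣ, sgn ε • phase N k (legTwo t μ ε - legOne t μ ε) • spinMat Z t μ ε

/-- The momentum-space vertex summed over orientations without signs. -/
noncomputable def evenVertex (N : ℕ) {n : ℕ} (Z : ℝ) (t : BubbleKind) (μ : Fin 2) (k : Site n) :
    Matrix (Fin 2) (Fin 2) ℂ :=
  ∑ ε : ℤˣ, phase N k (legTwo t μ ε - legOne t μ ε) • spinMat Z t μ ε

/-- The squared scalar part of the propagator. -/
noncomputable def bubbleCoeff (χ : ℝ → ℝ) (N : ℕ) {n : ℕ} (m : ℝ) (h : ℕ) (k : Site n) : ℝ :=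
  (fermiCut χ N h (momNorm N k) * (diracDet N m k)⁻¹) ^ 2

theorem bubbleHat_zero_eq_sum (χ : ℝ → ℝ) (m Z : ℝ) (h : ℕ) (t : BubbleKind) (μ ν : Fin 2) :
    bubbleHat (n := n) χ N m Z h t 0 μ ν = 1 / 2 * ∑ ε : ℤˣ, ∑ ε' : ℤˣ, sgn ε * sgn ε' *
      siteInt N (bubbleProfile χ N (n := n) m Z h t μ ε ν ε') := by
  rw [bubbleHat]
  congr 1
  refine Finset.sum_congr rfl fun ε _ => Finset.sum_congr rfl fun ε' _ => ?_
  rw [mul_assoc (sgn ε * sgn ε')]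
  congr 1
  simp only [phase_zero_left, one_mul, bubble_eq, siteInt_sub_left]
  have hn : (n : ℂ) ≠ 0 := by exact_mod_cast NeZero.ne n
  generalize siteInt N (bubbleProfile χ N (n := n) m Z h t μ ε ν ε') = w
  simp only [siteInt, Finset.sum_const, Finset.card_univ, Complex.real_smul, nsmul_eq_mul,
    Fintype.card_pi, ZMod.card, Finset.prod_const, Fintype.card_fin, side]
  push_cast
  field_simp

theorem sum_sgn_mul_siteInt_bubbleProfile (χ : ℝ → ℝ) (m Z : ℝ) (h : ℕ) (t : BubbleKind)
    (μ ν : Fin 2) (ε' : ℤˣ) :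
    ∑ ε : ℤˣ, sgn ε * siteInt N (bubbleProfile χ N (n := n) m Z h t μ ε ν ε') =
      dualInt N fun k : Site n => 1 / 2 * ((bubbleCoeff χ N m h k : ℝ) : ℂ) *
        spinSum (oddVertex N Z BubbleKind.vector μ k)
          (phase N k (legTwo t ν ε' - legOne t ν ε') • spinMat Z t ν ε')
          (diracAdj N m k) (diracAdj N m k) := by
  simp only [siteInt_bubbleProfile, ← dualInt_const_mul_complex, ← dualInt_sum]
  congr 1
  ext k
  simp only [oddVertex, sum_intUnits, spinSum_add_left, spinSum_smul_left, bubbleCoeff]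
  push_cast
  ring

theorem bubbleHat_zero_eq (χ : ℝ → ℝ) (m Z : ℝ) (h : ℕ) (t : BubbleKind) (μ ν : Fin 2) :
    bubbleHat (n := n) χ N m Z h t 0 μ ν =
      1 / 4 * dualInt N fun k : Site n => ((bubbleCoeff χ N m h k : ℝ) : ℂ) *
        spinSum (oddVertex N Z BubbleKind.vector μ k) (oddVertex N Z t ν k)
          (diracAdj N m k) (diracAdj N m k) := by
  have e : ∑ ε : ℤˣ, ∑ ε' : ℤˣ, sgn ε * sgn ε' *
      siteInt N (bubbleProfile χ N (n := n) m Z h t μ ε ν ε') =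
      ∑ ε' : ℤˣ, sgn ε' * ∑ ε : ℤˣ, sgn ε *
        siteInt N (bubbleProfile χ N (n := n) m Z h t μ ε ν ε') := by
    rw [Finset.sum_comm]
    refine Finset.sum_congr rfl fun ε' _ => ?_
    rw [Finset.mul_sum]
    exact Finset.sum_congr rfl fun ε _ => by ring
  rw [bubbleHat_zero_eq_sum, e]
  simp only [sum_sgn_mul_siteInt_bubbleProfile, ← dualInt_const_mul_complex, ← dualInt_sum]
  congr 1
  ext k
  have e2 : oddVertex N Z t ν k = ∑ ε : ℤˣ,
      sgn ε • phase N k (legTwo t ν ε - legOne t ν ε) • spinMat Z t ν ε := rfl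
  rw [e2]
  simp only [sum_intUnits, spinSum_add_right, spinSum_smul_right]
  ring

/-- The second orientation is summed without its sign; charge conjugation will show that this
combination vanishes. -/
theorem sum_sum_sgn_mul_siteInt_bubbleProfile (χ : ℝ → ℝ) (m Z : ℝ) (h : ℕ) (t : BubbleKind)
    (μ ν : Fin 2) :
    ∑ ε' : ℤˣ, ∑ ε : ℤˣ, sgn ε * siteInt N (bubbleProfile χ N (n := n) m Z h t μ ε ν ε') =
      dualInt N fun k : Site n => 1 / 2 * (((bubbleCoeff χ N m h k : ℝ) : ℂ) *
        spinSum (oddVertex N Z BubbleKind.vector μ k) (evenVertex N Z t ν k)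
          (diracAdj N m k) (diracAdj N m k)) := by
  simp only [sum_sgn_mul_siteInt_bubbleProfile, ← dualInt_sum]
  congr 1
  ext k
  rw [evenVertex]
  simp only [sum_intUnits, spinSum_add_right]
  ring

end Bubble


/-! ### Spin traces, lattice symmetries and charge conjugation -/

section Symmetry

variable {N n : ℕ} [NeZero n]

theorem latSin_neg (N : ℕ) (t : ℝ) : latSin N (-t) = -latSin N t := by
  simp [latSin, Real.sin_neg]

theorem latVer_neg (N : ℕ) (t : ℝ) : latVer N (-t) = latVer N t := by
  simp [latVer, Real.cos_neg]

theorem exists_mom_neg {k k' : Site n} {μ : Fin 2} (h : k' μ = -k μ) : ∃ w : ℤ,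
    mom N k' μ = -mom N k μ + momPeriod N * w := by
  have hn : (n : ℝ) ≠ 0 := by exact_mod_cast NeZero.ne n
  have h1 : ((-(k μ).valMinAbs : ℤ) : ZMod n) = ((k' μ).valMinAbs : ℤ) := by
    push_cast [ZMod.coe_valMinAbs]
    exact h.symm
  obtain ⟨w, hw⟩ := (ZMod.intCast_eq_intCast_iff_dvd_sub _ _ _).1 h1
  refine ⟨w, ?_⟩
  have hw' : ((k' μ).valMinAbs : ℝ) = -(k μ).valMinAbs + n * w := by
    have : (k' μ).valMinAbs = -(k μ).valMinAbs + n * w := by linarith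
    exact_mod_cast this
  rw [mom, mom, hw', momPeriod, side]
  field_simp

theorem latSin_mom_neg {k k' : Site n} {μ : Fin 2} (h : k' μ = -k μ) :
    latSin N (mom N k' μ) = -latSin N (mom N k μ) := by
  obtain ⟨w, hw⟩ := exists_mom_neg (N := N) h
  rw [hw, latSin_add_int_mul, latSin_neg]

theorem latVer_mom_neg {k k' : Site n} {μ : Fin 2} (h : k' μ = -k μ) :
    latVer N (mom N k' μ) = latVer N (mom N k μ) := by
  obtain ⟨w, hw⟩ := exists_mom_neg (N := N) h
  rw [hw, latVer_add_int_mul, latVer_neg]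

theorem mom_sq_of_neg {k k' : Site n} {μ : Fin 2} (h : k' μ = -k μ) :
    mom N k' μ ^ 2 = mom N k μ ^ 2 := by
  have h2 : ((k' μ).valMinAbs : ℝ) ^ 2 = ((k μ).valMinAbs : ℝ) ^ 2 := by
    have := ZMod.natAbs_valMinAbs_neg (k μ)
    rw [← h, Int.natAbs_eq_iff_sq_eq] at this
    exact_mod_cast this
  rw [mom, mom, div_pow, div_pow, mul_pow _ ((k' μ).valMinAbs : ℝ), mul_pow _ ((k μ).valMinAbs : ℝ), h2]

theorem mom_congr {k k' : Site n} {μ ν : Fin 2} (h : k' μ = k ν) : mom N k' μ = mom N k ν := by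
  rw [mom, mom, h]

/-- The reflection of one coordinate. -/
def flipSite {n : ℕ} (μ : Fin 2) : Site n ≃ Site n :=
  Function.Involutive.toPerm (fun k => Function.update k μ (-k μ)) fun k => by simp

theorem flipSite_same (μ : Fin 2) (k : Site n) : flipSite μ k μ = -k μ :=
  Function.update_self _ _ _

theorem flipSite_of_ne {μ ν : Fin 2} (h : ν ≠ μ) (k : Site n) : flipSite μ k ν = k ν :=
  Function.update_of_ne h _ _

/-- The exchange of the two coordinates. -/
def swapSite {n : ℕ} : Site n ≃ Site n :=
  Function.Involutive.toPerm (fun k μ => k (1 - μ)) fun k => by ext μ; simp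

theorem swapSite_apply (k : Site n) (μ : Fin 2) : swapSite k μ = k (1 - μ) := rfl

theorem dualInt_equiv {E : Type*} [AddCommMonoid E] [Module ℝ E] (e : Site n ≃ Site n)
    (f : Site n → E) : (dualInt N fun k => f (e k)) = dualInt N f := by
  simp only [dualInt, Equiv.sum_comp e]

theorem dualInt_eq_zero_of_odd (e : Site n ≃ Site n) {f : Site n → ℂ}
    (h : ∀ k, f (e k) = -f k) : dualInt N f = 0 := by
  have h1 := dualInt_equiv (N := N) e f
  have h2 : (dualInt N fun k => f (e k)) = -dualInt N f := by
    rw [← neg_one_mul, ← dualInt_const_mul_complex]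
    simp only [h, neg_one_mul]
  rw [h2] at h1
  exact self_eq_neg.1 h1.symm

/-- Invariance of the scalar part under maps permuting and reflecting the coordinates. -/
theorem bubbleCoeff_congr (χ : ℝ → ℝ) (m : ℝ) (h : ℕ) {k k' : Site n} (ρ : Fin 2)
    (hk : ∀ μ, k' μ = k (ρ + μ) ∨ k' μ = -k (ρ + μ)) :
    bubbleCoeff χ N m h k' = bubbleCoeff χ N m h k := by
  have hk' : ∀ μ, ∃ q : Site n, q μ = k (ρ + μ) ∧ (k' μ = q μ ∨ k' μ = -q μ) := fun μ =>
    ⟨fun _ => k (ρ + μ), rfl, hk μ⟩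
  have hv : ∀ μ, latVer N (mom N k' μ) = latVer N (mom N k (ρ + μ)) := fun μ => by
    obtain ⟨q, h1, h2 | h2⟩ := hk' μ
    · rw [mom_congr (h2.trans h1)]
    · rw [latVer_mom_neg h2, mom_congr h1]
  have hs : ∀ μ, latSin N (mom N k' μ) ^ 2 = latSin N (mom N k (ρ + μ)) ^ 2 := fun μ => by
    rw [latSin_sq, latSin_sq, hv]
  have hm : ∀ μ, mom N k' μ ^ 2 = mom N k (ρ + μ) ^ 2 := fun μ => by
    obtain ⟨q, h1, h2 | h2⟩ := hk' μ
    · rw [mom_congr (h2.trans h1)]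
    · rw [mom_sq_of_neg h2, mom_congr h1]
  have e1 : momNorm N k' = momNorm N k := by
    rw [momNorm, momNorm, Finset.sum_congr rfl fun μ _ => hm μ]
    congr 1
    exact Equiv.sum_comp (Equiv.addLeft ρ) fun μ => mom N k μ ^ 2
  have e2 : massTerm N m k' = massTerm N m k := by
    have := Equiv.sum_comp (Equiv.addLeft ρ) fun μ => latVer N (mom N k μ)
    simp only [Equiv.coe_addLeft, ← hv, Fin.sum_univ_two] at this
    rw [massTerm, massTerm, this]
  have e3 : diracDet N m k' = diracDet N m k := by
    have := Equiv.sum_comp (Equiv.addLeft ρ) fun μ => latSin N (mom N k μ) ^ 2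
    simp only [Equiv.coe_addLeft, ← hs, Fin.sum_univ_two] at this
    rw [diracDet, diracDet, this, e2]
  rw [bubbleCoeff, bubbleCoeff, e1, e3]

theorem massTerm_neg (m : ℝ) (k : Site n) : massTerm N m (-k) = massTerm N m k := by
  rw [massTerm, massTerm, latVer_mom_neg (k := k) (μ := 0) rfl, latVer_mom_neg (k := k) (μ := 1) rfl]

theorem massTerm_flipSite (m : ℝ) (k : Site n) (μ : Fin 2) :
    massTerm N m (flipSite μ k) = massTerm N m k := by
  have h : ∀ ν, latVer N (mom N (flipSite μ k) ν) = latVer N (mom N k ν) := fun ν => by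
    by_cases h : ν = μ
    · subst h; exact latVer_mom_neg (flipSite_same _ _)
    · rw [mom_congr (flipSite_of_ne h k)]
  rw [massTerm, massTerm, h, h]

theorem massTerm_swapSite (m : ℝ) (k : Site n) : massTerm N m (swapSite k) = massTerm N m k := by
  rw [massTerm, massTerm, mom_congr (k := k) (swapSite_apply k 0),
    mom_congr (k := k) (swapSite_apply k 1), sub_zero, sub_self, add_comm (latVer N (mom N k 1))]

theorem bubbleCoeff_neg (χ : ℝ → ℝ) (m : ℝ) (h : ℕ) (k : Site n) :
    bubbleCoeff χ N m h (-k) = bubbleCoeff χ N m h k :=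
  bubbleCoeff_congr χ m h 0 fun μ => Or.inr (by rw [zero_add, Pi.neg_apply])

theorem bubbleCoeff_flipSite (χ : ℝ → ℝ) (m : ℝ) (h : ℕ) (k : Site n) (μ : Fin 2) :
    bubbleCoeff χ N m h (flipSite μ k) = bubbleCoeff χ N m h k :=
  bubbleCoeff_congr χ m h 0 fun ν => by
    rw [zero_add]
    by_cases h : ν = μ
    · subst h; exact Or.inr (flipSite_same _ _)
    · exact Or.inl (flipSite_of_ne h k)

theorem bubbleCoeff_swapSite (χ : ℝ → ℝ) (m : ℝ) (h : ℕ) (k : Site n) :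
    bubbleCoeff χ N m h (swapSite k) = bubbleCoeff χ N m h k :=
  bubbleCoeff_congr χ m h 1 fun ν => Or.inl (by
    rw [swapSite_apply, show ∀ ν : Fin 2, 1 - ν = 1 + ν by decide])

/-- The cosine of a lattice momentum. -/
noncomputable def momCos (N : ℕ) {n : ℕ} (k : Site n) (μ : Fin 2) : ℝ :=
  1 - latVer N (mom N k μ) / 2 ^ N

/-- The sine of a lattice momentum. -/
noncomputable def momSin (N : ℕ) {n : ℕ} (k : Site n) (μ : Fin 2) : ℝ :=
  latSin N (mom N k μ) / 2 ^ N

theorem phase_unitVec_eq (k : Site n) (μ : Fin 2) :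
    phase N k (unitVec μ) = momCos N k μ - Complex.I * momSin N k μ := by
  have h := phase_unitVec_sub_one (N := N) k μ
  have h2 : (2 : ℂ) ^ N ≠ 0 := pow_ne_zero _ two_ne_zero
  rw [momCos, momSin]
  push_cast
  field_simp
  linear_combination h

theorem momCos_neg (k : Site n) (μ : Fin 2) : momCos N (-k) μ = momCos N k μ := by
  rw [momCos, momCos, latVer_mom_neg (k := k) rfl]

theorem momSin_neg (k : Site n) (μ : Fin 2) : momSin N (-k) μ = -momSin N k μ := by
  rw [momSin, momSin, latSin_mom_neg (k := k) rfl, neg_div]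

theorem phase_neg_unitVec_eq (k : Site n) (μ : Fin 2) :
    phase N k (-unitVec μ) = momCos N k μ + Complex.I * momSin N k μ := by
  rw [← phase_neg_left, phase_unitVec_eq, momCos_neg, momSin_neg]
  push_cast
  ring

theorem oddVertex_vector (Z : ℝ) (μ : Fin 2) (k : Site n) :
    oddVertex N Z BubbleKind.vector μ k =
      (momCos N k μ : ℂ) • gam μ + (Complex.I * momSin N k μ) • 1 := by
  ext s s'
  simp only [oddVertex, sum_intUnits, legOne, legTwo, spinMat, if_true, if_neg (by decide : ¬(-1 : ℤˣ) = 1),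
    sub_zero, zero_sub, phase_unitVec_eq, phase_neg_unitVec_eq, sgn, Matrix.add_apply,
    Matrix.smul_apply, Matrix.sub_apply, smul_eq_mul]
  push_cast
  ring

theorem evenVertex_vector (Z : ℝ) (μ : Fin 2) (k : Site n) :
    evenVertex N Z BubbleKind.vector μ k =
      (-(momCos N k μ : ℂ)) • 1 + (-(Complex.I * momSin N k μ)) • gam μ := by
  ext s s'
  simp only [evenVertex, sum_intUnits, legOne, legTwo, spinMat, if_true, if_neg (by decide : ¬(-1 : ℤˣ) = 1),
    sub_zero, zero_sub, phase_unitVec_eq, phase_neg_unitVec_eq, Matrix.add_apply,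
    Matrix.smul_apply, Matrix.sub_apply, smul_eq_mul]
  ring

theorem oddVertex_chiral (Z : ℝ) (μ : Fin 2) (k : Site n) :
    oddVertex N Z BubbleKind.chiral μ k = (Z : ℂ) • (gam μ * gamFive) := by
  ext s s'
  simp only [oddVertex, sum_intUnits, legOne, legTwo, spinMat, sub_self, phase_zero_right, sgn,
    Matrix.add_apply, Matrix.smul_apply, smul_eq_mul]
  push_cast
  ring

theorem evenVertex_chiral (Z : ℝ) (μ : Fin 2) (k : Site n) :
    evenVertex N Z BubbleKind.chiral μ k = 0 := by
  ext s s'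
  simp only [evenVertex, sum_intUnits, legOne, legTwo, spinMat, sub_self, phase_zero_right, sgn,
    Matrix.add_apply, Matrix.smul_apply, smul_eq_mul, Matrix.zero_apply]
  push_cast
  ring

/-- The spin trace of the transformed bubble. -/
noncomputable def loopTrace (N : ℕ) {n : ℕ} (m Z : ℝ) (t : BubbleKind) (μ ν : Fin 2)
    (k : Site n) : ℂ :=
  spinSum (oddVertex N Z BubbleKind.vector μ k) (oddVertex N Z t ν k) (diracAdj N m k)
    (diracAdj N m k)

/-- The spin trace for the vertex summed over orientations without signs. -/
noncomputable def evenLoopTrace (N : ℕ) {n : ℕ} (m Z : ℝ) (t : BubbleKind) (μ ν : Fin 2)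
    (k : Site n) : ℂ :=
  spinSum (oddVertex N Z BubbleKind.vector μ k) (evenVertex N Z t ν k) (diracAdj N m k)
    (diracAdj N m k)

theorem gam_zero : gam 0 = !![1, 0; 0, -1] := rfl

theorem gam_one : gam 1 = !![0, -Complex.I; Complex.I, 0] := rfl

theorem gam_zero_mul_gamFive : gam 0 * gamFive = !![0, 1; -1, 0] := by
  ext i j
  fin_cases i <;> fin_cases j <;> simp [gam, gamFive]

theorem gam_one_mul_gamFive : gam 1 * gamFive = !![-Complex.I, 0; 0, Complex.I] := by
  ext i j
  fin_cases i <;> fin_cases j <;> simp [gam, gamFive]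

/-- The matrix `W + i ∑ μ, s_μ γ_μ`. -/
def slashMat (W : ℂ) (s : Fin 2 → ℂ) : Matrix (Fin 2) (Fin 2) ℂ :=
  !![W + Complex.I * s 0, s 1; -s 1, W - Complex.I * s 0]

theorem spinSum_gam_gam (W : ℂ) (s : Fin 2 → ℂ) (μ ν : Fin 2) :
    spinSum (gam μ) (gam ν) (slashMat W s) (slashMat W s) =
      2 * (W ^ 2 + (s 0 ^ 2 + s 1 ^ 2)) * (if μ = ν then 1 else 0) - 4 * (s μ * s ν) := by
  fin_cases μ <;> fin_cases ν <;>
    simp [spinSum, Fin.sum_univ_two, gam_zero, gam_one, slashMat] <;> ring_nf <;>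
    simp only [Complex.I_sq] <;> ring

theorem spinSum_gam_one (W : ℂ) (s : Fin 2 → ℂ) (μ : Fin 2) :
    spinSum (gam μ) 1 (slashMat W s) (slashMat W s) = Complex.I * (4 * (W * s μ)) := by
  fin_cases μ <;>
    simp [spinSum, Fin.sum_univ_two, gam_zero, gam_one, slashMat] <;> ring

theorem spinSum_one_gam (W : ℂ) (s : Fin 2 → ℂ) (μ : Fin 2) :
    spinSum 1 (gam μ) (slashMat W s) (slashMat W s) = Complex.I * (4 * (W * s μ)) := by
  fin_cases μ <;>
    simp [spinSum, Fin.sum_univ_two, gam_zero, gam_one, slashMat] <;> ring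

theorem spinSum_one_one (W : ℂ) (s : Fin 2 → ℂ) :
    spinSum 1 1 (slashMat W s) (slashMat W s) = 2 * (W ^ 2 - (s 0 ^ 2 + s 1 ^ 2)) := by
  simp [spinSum, Fin.sum_univ_two, slashMat]
  ring_nf
  simp only [Complex.I_sq]
  ring

theorem diracAdj_eq (m : ℝ) (k : Site n) : diracAdj N m k =
    slashMat (massTerm N m k) fun μ => ((latSin N (mom N k μ) : ℝ) : ℂ) := rfl

/-- The trace with a gamma matrix inserted at the second vertex. -/
noncomputable def gammaTrace (N : ℕ) {n : ℕ} (m : ℝ) (μ ν : Fin 2) (k : Site n) : ℝ :=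
  momCos N k μ * (2 * (massTerm N m k ^ 2 +
    (latSin N (mom N k 0) ^ 2 + latSin N (mom N k 1) ^ 2)) * (if μ = ν then 1 else 0) -
      4 * (latSin N (mom N k μ) * latSin N (mom N k ν))) -
    4 * (momSin N k μ * massTerm N m k * latSin N (mom N k ν))

/-- The trace (up to a factor `i`) with the identity inserted at the second vertex. -/
noncomputable def unitTrace (N : ℕ) {n : ℕ} (m : ℝ) (μ : Fin 2) (k : Site n) : ℝ :=
  4 * (momCos N k μ * massTerm N m k * latSin N (mom N k μ)) +
    2 * (momSin N k μ * (massTerm N m k ^ 2 -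
      (latSin N (mom N k 0) ^ 2 + latSin N (mom N k 1) ^ 2)))

theorem spinSum_oddVertex_gam (m Z : ℝ) (μ ν : Fin 2) (k : Site n) :
    spinSum (oddVertex N Z BubbleKind.vector μ k) (gam ν) (diracAdj N m k) (diracAdj N m k) =
      gammaTrace N m μ ν k := by
  rw [oddVertex_vector, spinSum_add_left, spinSum_smul_left, spinSum_smul_left, diracAdj_eq,
    spinSum_gam_gam, spinSum_one_gam, gammaTrace]
  have h : ((if μ = ν then 1 else 0 : ℝ) : ℂ) = if μ = ν then 1 else 0 := by split_ifs <;> simp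
  push_cast [h]
  linear_combination 4 * (momSin N k μ * massTerm N m k * latSin N (mom N k ν)) * Complex.I_sq

theorem spinSum_oddVertex_one (m Z : ℝ) (μ : Fin 2) (k : Site n) :
    spinSum (oddVertex N Z BubbleKind.vector μ k) 1 (diracAdj N m k) (diracAdj N m k) =
      Complex.I * unitTrace N m μ k := by
  rw [oddVertex_vector, spinSum_add_left, spinSum_smul_left, spinSum_smul_left, diracAdj_eq,
    spinSum_gam_one, spinSum_one_one, unitTrace]
  push_cast
  ring

theorem loopTrace_vector (m Z : ℝ) (μ ν : Fin 2) (k : Site n) :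
    loopTrace N m Z BubbleKind.vector μ ν k =
      ((momCos N k ν * gammaTrace N m μ ν k - momSin N k ν * unitTrace N m μ k : ℝ) : ℂ) := by
  rw [loopTrace, oddVertex_vector (μ := ν), spinSum_add_right, spinSum_smul_right,
    spinSum_smul_right, spinSum_oddVertex_gam, spinSum_oddVertex_one]
  push_cast
  linear_combination momSin N k ν * unitTrace N m μ k * Complex.I_sq

/-- In two dimensions γ₅ only exchanges the gamma matrices, γ₀γ₅ = iγ₁ and γ₁γ₅ = -iγ₀. The chiral
loop is thus a `gammaTrace` with exchanged second index. -/
theorem loopTrace_chiral_zero (m Z : ℝ) (μ : Fin 2) (k : Site n) :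
    loopTrace N m Z BubbleKind.chiral μ 0 k = Complex.I * Z * (gammaTrace N m μ 1 k : ℝ) := by
  have e : gam 0 * gamFive = Complex.I • gam 1 := by
    rw [gam_zero_mul_gamFive, gam_one]
    ext i j
    fin_cases i <;> fin_cases j <;> simp
  rw [loopTrace, oddVertex_chiral, e, spinSum_smul_right, spinSum_smul_right,
    spinSum_oddVertex_gam]
  ring

theorem loopTrace_chiral_one (m Z : ℝ) (μ : Fin 2) (k : Site n) :
    loopTrace N m Z BubbleKind.chiral μ 1 k = -(Complex.I * Z * (gammaTrace N m μ 0 k : ℝ)) := by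
  have e : gam 1 * gamFive = (-Complex.I) • gam 0 := by
    rw [gam_one_mul_gamFive, gam_zero]
    ext i j
    fin_cases i <;> fin_cases j <;> simp
  rw [loopTrace, oddVertex_chiral, e, spinSum_smul_right, spinSum_smul_right,
    spinSum_oddVertex_gam]
  ring

theorem gammaTrace_neg (m : ℝ) (μ ν : Fin 2) (k : Site n) :
    gammaTrace N m μ ν (-k) = gammaTrace N m μ ν k := by
  have hs : ∀ μ, latSin N (mom N (-k) μ) = -latSin N (mom N k μ) := fun μ => latSin_mom_neg rfl
  simp only [gammaTrace, hs, momCos_neg, momSin_neg, massTerm_neg]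
  ring

theorem unitTrace_neg (m : ℝ) (μ : Fin 2) (k : Site n) :
    unitTrace N m μ (-k) = -unitTrace N m μ k := by
  have hs : ∀ μ, latSin N (mom N (-k) μ) = -latSin N (mom N k μ) := fun μ => latSin_mom_neg rfl
  simp only [unitTrace, hs, momCos_neg, momSin_neg, massTerm_neg]
  ring

/-- Under k → -k the cosines and `gammaTrace` are even, the sines and `unitTrace` odd, and every
term pairs one of each parity. In the chiral case the unsigned vertex is zero. -/
theorem evenLoopTrace_neg (m Z : ℝ) (t : BubbleKind) (μ ν : Fin 2) (k : Site n) :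
    evenLoopTrace N m Z t μ ν (-k) = -evenLoopTrace N m Z t μ ν k := by
  have h : ∀ k : Site n, evenLoopTrace N m Z BubbleKind.vector μ ν k =
      -(Complex.I * (momCos N k ν * unitTrace N m μ k + momSin N k ν * gammaTrace N m μ ν k)) := by
    intro k
    rw [evenLoopTrace, evenVertex_vector, spinSum_add_right, spinSum_smul_right,
      spinSum_smul_right, spinSum_oddVertex_gam, spinSum_oddVertex_one]
    ring
  cases t
  · rw [h, h, momCos_neg, momSin_neg, gammaTrace_neg, unitTrace_neg]
    push_cast
    ring
  · rw [evenLoopTrace, evenLoopTrace, evenVertex_chiral, evenVertex_chiral]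
    simp [spinSum]

/-- For μ ≠ ν each surviving term contains exactly one sine of the reflected component. -/
theorem gammaTrace_flipSite_of_ne (m : ℝ) {μ ν : Fin 2} (h : μ ≠ ν) (k : Site n) :
    gammaTrace N m μ ν (flipSite μ k) = -gammaTrace N m μ ν k := by
  have h1 : latSin N (mom N (flipSite μ k) μ) = -latSin N (mom N k μ) :=
    latSin_mom_neg (flipSite_same _ _)
  have h2 : latVer N (mom N (flipSite μ k) μ) = latVer N (mom N k μ) :=
    latVer_mom_neg (flipSite_same _ _)
  have h3 : mom N (flipSite μ k) ν = mom N k ν := mom_congr (flipSite_of_ne h.symm k)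
  simp only [gammaTrace, if_neg h, momCos, momSin, h1, h2, h3, massTerm_flipSite]
  ring

theorem unitTrace_flipSite (m : ℝ) (μ : Fin 2) (k : Site n) :
    unitTrace N m μ (flipSite μ k) = -unitTrace N m μ k := by
  have h1 : latSin N (mom N (flipSite μ k) μ) = -latSin N (mom N k μ) :=
    latSin_mom_neg (flipSite_same _ _)
  have h2 : latVer N (mom N (flipSite μ k) μ) = latVer N (mom N k μ) :=
    latVer_mom_neg (flipSite_same _ _)
  have h3 : ∀ ν, latSin N (mom N (flipSite μ k) ν) ^ 2 = latSin N (mom N k ν) ^ 2 := fun ν => by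
    by_cases h : ν = μ
    · subst h; rw [h1, neg_sq]
    · rw [mom_congr (flipSite_of_ne h k)]
  simp only [unitTrace, momCos, momSin, h1, h2, h3, massTerm_flipSite]
  ring

theorem loopTrace_vector_flipSite (m Z : ℝ) {μ ν : Fin 2} (h : μ ≠ ν) (k : Site n) :
    loopTrace N m Z BubbleKind.vector μ ν (flipSite μ k) =
      -loopTrace N m Z BubbleKind.vector μ ν k := by
  have h3 : mom N (flipSite μ k) ν = mom N k ν := mom_congr (flipSite_of_ne h.symm k)
  rw [loopTrace_vector, loopTrace_vector, gammaTrace_flipSite_of_ne m h, unitTrace_flipSite,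
    momCos, momSin, h3, ← momCos, ← momSin]
  push_cast
  ring

theorem gammaTrace_swapSite (m : ℝ) (μ ν : Fin 2) (k : Site n) :
    gammaTrace N m μ ν (swapSite k) = gammaTrace N m (1 - μ) (1 - ν) k := by
  have h : ∀ μ, mom N (swapSite k) μ = mom N k (1 - μ) := fun μ => mom_congr rfl
  have hi : (μ = ν) = (1 - μ = 1 - ν) := by simp
  simp only [gammaTrace, momCos, momSin, h, massTerm_swapSite, hi, sub_zero, sub_self]
  ring

theorem unitTrace_swapSite (m : ℝ) (μ : Fin 2) (k : Site n) :
    unitTrace N m μ (swapSite k) = unitTrace N m (1 - μ) k := by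
  have h : ∀ μ, mom N (swapSite k) μ = mom N k (1 - μ) := fun μ => mom_congr rfl
  simp only [unitTrace, momCos, momSin, h, massTerm_swapSite, sub_zero, sub_self]
  ring

theorem loopTrace_vector_swapSite (m Z : ℝ) (μ ν : Fin 2) (k : Site n) :
    loopTrace N m Z BubbleKind.vector μ ν (swapSite k) =
      loopTrace N m Z BubbleKind.vector (1 - μ) (1 - ν) k := by
  have h : ∀ μ, mom N (swapSite k) μ = mom N k (1 - μ) := fun μ => mom_congr rfl
  rw [loopTrace_vector, loopTrace_vector, gammaTrace_swapSite, unitTrace_swapSite]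
  simp only [momCos, momSin, h]

theorem bubbleHat_zero_eq_loopTrace (χ : ℝ → ℝ) (m Z : ℝ) (h : ℕ) (t : BubbleKind) (μ ν : Fin 2) :
    bubbleHat (n := n) χ N m Z h t 0 μ ν =
      1 / 4 * dualInt N fun k : Site n => (bubbleCoeff χ N m h k : ℂ) * loopTrace N m Z t μ ν k :=
  bubbleHat_zero_eq χ m Z h t μ ν

/-- The exchange of the coordinates identifies the diagonal entries; a reflection makes the
off-diagonal integrands odd. -/
theorem bubbleHat_vector_zero (χ : ℝ → ℝ) (m Z : ℝ) (h : ℕ) (μ ν : Fin 2) :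
    bubbleHat (n := n) χ N m Z h BubbleKind.vector 0 μ ν =
      (if μ = ν then 1 else 0) * bubbleHat (n := n) χ N m Z h BubbleKind.vector 0 0 0 := by
  by_cases hμν : μ = ν
  · subst hμν
    rw [if_pos rfl, one_mul]
    rcases (show ∀ μ : Fin 2, μ = 0 ∨ μ = 1 - 0 by decide) μ with rfl | rfl
    · rfl
    · rw [bubbleHat_zero_eq_loopTrace, bubbleHat_zero_eq_loopTrace, ← dualInt_equiv swapSite]
      simp only [bubbleCoeff_swapSite, loopTrace_vector_swapSite, sub_sub_cancel]
  · rw [if_neg hμν, zero_mul, bubbleHat_zero_eq_loopTrace,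
      dualInt_eq_zero_of_odd (flipSite μ), mul_zero]
    intro k
    rw [bubbleCoeff_flipSite, loopTrace_vector_flipSite m Z hμν, mul_neg]

/-- The entries (0,1) and (1,0) are opposite multiples of the traces (0,0) and (1,1), which the
exchange of the coordinates identifies; the diagonal entries involve off-diagonal traces and vanish
by reflection. -/
theorem bubbleHat_chiral_zero (χ : ℝ → ℝ) (m Z : ℝ) (h : ℕ) (μ ν : Fin 2) :
    bubbleHat (n := n) χ N m Z h BubbleKind.chiral 0 μ ν =
      epsTensor μ ν * bubbleHat (n := n) χ N m Z h BubbleKind.chiral 0 0 1 := by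
  have h01 : (0 : Fin 2) ≠ 1 := by decide
  fin_cases μ <;> fin_cases ν <;> simp only [Fin.zero_eta, Fin.mk_one, epsTensor, Matrix.of_apply,
    Matrix.cons_val_zero, Matrix.cons_val_one, Matrix.cons_val', Matrix.cons_val_fin_one, zero_mul,
    one_mul]
  · rw [bubbleHat_zero_eq_loopTrace, dualInt_eq_zero_of_odd (flipSite 0), mul_zero]
    intro k
    rw [bubbleCoeff_flipSite, loopTrace_chiral_zero, loopTrace_chiral_zero,
      gammaTrace_flipSite_of_ne m h01]
    push_cast
    ring
  · rw [bubbleHat_zero_eq_loopTrace, bubbleHat_zero_eq_loopTrace, ← dualInt_equiv swapSite,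
      mul_left_comm]
    congr 1
    rw [← dualInt_const_mul_complex]
    congr 1
    funext k
    rw [bubbleCoeff_swapSite, loopTrace_chiral_zero, loopTrace_chiral_one, gammaTrace_swapSite,
      sub_self]
    ring
  · rw [bubbleHat_zero_eq_loopTrace, dualInt_eq_zero_of_odd (flipSite 1), mul_zero]
    intro k
    rw [bubbleCoeff_flipSite, loopTrace_chiral_one, loopTrace_chiral_one,
      gammaTrace_flipSite_of_ne m h01.symm]
    push_cast
    ring

/-- Charge conjugation: the bubble integrated over its first argument is odd in the orientation
of the second one. -/
theorem sum_sgn_mul_siteInt_bubbleProfile_eq (χ : ℝ → ℝ) (m Z : ℝ) (h : ℕ) (t : BubbleKind)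
    (μ ν : Fin 2) (ε' : ℤˣ) :
    ∑ ε : ℤˣ, sgn ε * siteInt N (bubbleProfile χ N (n := n) m Z h t μ ε ν ε') =
      sgn ε' * bubbleHat (n := n) χ N m Z h t 0 μ ν := by
  have h0 := sum_sum_sgn_mul_siteInt_bubbleProfile (N := N) (n := n) χ m Z h t μ ν
  -- Writing P(ε') for the left-hand side, oddness in k gives P(1) + P(-1) = 0, while Π̂(0) = (P(1)
  -- - P(-1))/2. Hence P(ε') = ε' Π̂(0).
  rw [dualInt_const_mul_complex, dualInt_eq_zero_of_odd (Equiv.neg _), mul_zero] at h0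
  · have e : ∑ ε : ℤˣ, ∑ ε' : ℤˣ, sgn ε * sgn ε' *
        siteInt N (bubbleProfile χ N (n := n) m Z h t μ ε ν ε') =
        ∑ ε' : ℤˣ, sgn ε' * ∑ ε : ℤˣ, sgn ε *
          siteInt N (bubbleProfile χ N (n := n) m Z h t μ ε ν ε') := by
      rw [Finset.sum_comm]
      refine Finset.sum_congr rfl fun ε' _ => ?_
      rw [Finset.mul_sum]
      exact Finset.sum_congr rfl fun ε _ => by ring
    rw [bubbleHat_zero_eq_sum, e]
    generalize hP : (fun ε' : ℤˣ => ∑ ε : ℤˣ, sgn ε *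
          siteInt N (bubbleProfile χ N (n := n) m Z h t μ ε ν ε')) = P at h0 ⊢
    have hP' : ∀ ε', ∑ ε : ℤˣ, sgn ε *
          siteInt N (bubbleProfile χ N (n := n) m Z h t μ ε ν ε') = P ε' := fun ε' => by rw [← hP]
    simp only [hP'] at h0 ⊢
    rw [sum_intUnits] at h0 ⊢
    rcases Int.units_eq_one_or ε' with rfl | rfl
    · simp only [sgn]
      push_cast
      linear_combination (1 / 2) * h0
    · simp only [sgn]
      push_cast
      linear_combination (1 / 2) * h0
  · intro k
    have := evenLoopTrace_neg (N := N) m Z t μ ν k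
    rw [evenLoopTrace, evenLoopTrace] at this
    rw [Equiv.neg_apply, bubbleCoeff_neg, this, mul_neg]

end Symmetry


/-! ### Cancellation of the logarithmic divergence and the bound on Π̂(0) -/

section HatBound

variable {N n : ℕ} [NeZero n]

theorem IsCutoff.le_one {χ : ℝ → ℝ} (hχ : IsCutoff χ) {t : ℝ} (ht : 0 ≤ t) : χ t ≤ 1 := by
  rw [← hχ.eq_one 0 ⟨le_rfl, by norm_num⟩]
  exact hχ.antitone (Set.mem_Ici.2 le_rfl) (Set.mem_Ici.2 ht) ht

theorem IsCutoff.scaleCutoff_mem {χ : ℝ → ℝ} (hχ : IsCutoff χ) {j : ℕ} (t : ℝ) (ht : 0 ≤ t) :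
    0 ≤ scaleCutoff χ N j t ∧ scaleCutoff χ N j t ≤ 1 := by
  have h1 : 0 ≤ χ (t / 2 ^ (j - 1)) := hχ.nonneg _ (by positivity)
  have h2 : χ (t / 2 ^ (j - 1)) ≤ 1 := hχ.le_one (by positivity)
  have h3 : χ (t / 2 ^ j) ≤ 1 := hχ.le_one (by positivity)
  have h4 : χ (t / 2 ^ (j - 1)) ≤ χ (t / 2 ^ j) := by
    refine hχ.antitone (Set.mem_Ici.2 (by positivity)) (Set.mem_Ici.2 (by positivity)) ?_
    exact div_le_div_of_nonneg_left ht (by positivity)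
      (pow_le_pow_right₀ (by norm_num) (Nat.sub_le _ _))
  unfold scaleCutoff
  split_ifs <;> constructor <;> linarith

theorem IsCutoff.fermiCut_mem {χ : ℝ → ℝ} (hχ : IsCutoff χ) {h : ℕ} (t : ℝ) (ht : 0 ≤ t) :
    0 ≤ fermiCut χ N h t ∧ fermiCut χ N h t ≤ 1 := by
  refine ⟨Finset.sum_nonneg fun j _ => (hχ.scaleCutoff_mem t ht).1, ?_⟩
  by_cases hN : h < N
  · rw [fermiCut, sum_scaleCutoff χ hN]
    linarith [hχ.nonneg (t / 2 ^ h) (by positivity)]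
  · rw [fermiCut, Finset.Icc_eq_empty (by omega), Finset.sum_empty]
    exact zero_le_one

theorem momNorm_sq_le_diracDet {m : ℝ} (hm : |m| ≤ 1) (hN : 1 ≤ N) (k : Site n) :
    1 / 5 * momNorm N k ^ 2 ≤ diracDet N m k := by
  have hb := mass_coeff_bounds (N := N) hm hN
  have h1 := sq_le_latVer N (abs_mom_le (N := N) k 0)
  have h2 := sq_le_latVer N (abs_mom_le (N := N) k 1)
  have h3 : 1 / 5 ≤ 2 / Real.pi ^ 2 := by
    rw [div_le_div_iff₀ (by norm_num) (by positivity)]; linarith [pi_sq_lt_ten]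
  have h4 := latVer_nonneg N (mom N k 0)
  have h5 := latVer_nonneg N (mom N k 1)
  have h6 : (0 : ℝ) < 2 ^ N := by positivity
  rw [diracDet_eq_siteDen, siteDen, latDen, momNorm, Real.sq_sqrt (by positivity), Fin.sum_univ_two]
  nlinarith [mul_nonneg h4 h5, mul_nonneg h6.le h4, mul_nonneg h6.le h5, sq_nonneg m,
    mul_le_mul_of_nonneg_right h3 (sq_nonneg (mom N k 0)),
    mul_le_mul_of_nonneg_right h3 (sq_nonneg (mom N k 1)), mul_nonneg (sub_nonneg.2 hb.1)
      (mul_nonneg h6.le (add_nonneg h4 h5))]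

theorem latVer_mul_le_diracDet {m : ℝ} (hm : |m| ≤ 1) (hN : 1 ≤ N) (k : Site n) :
    2 ^ N * (latVer N (mom N k 0) + latVer N (mom N k 1)) ≤ diracDet N m k := by
  have hb := mass_coeff_bounds (N := N) hm hN
  have h4 := latVer_nonneg N (mom N k 0)
  have h5 := latVer_nonneg N (mom N k 1)
  have h6 : (0 : ℝ) < 2 ^ N := by positivity
  rw [diracDet_eq_siteDen, siteDen, latDen]
  nlinarith [mul_nonneg h4 h5, sq_nonneg m, mul_nonneg (sub_nonneg.2 hb.1)
      (mul_nonneg h6.le (add_nonneg h4 h5))]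

/-- Elementary estimates for the numerators of the loop traces in terms of the denominator. -/
theorem numerator_bounds {m : ℝ} (hm : |m| ≤ 1) (hN : 1 ≤ N) (k : Site n) {a D : ℝ}
    (ha : a = ((2 : ℝ) ^ N)⁻¹) (hD : D = diracDet N m k) :
    |1 - momCos N k 0| ≤ a ^ 2 * D ∧ |momCos N k 0| ≤ 1 ∧
    massTerm N m k ^ 2 ≤ 2 + 2 * (a ^ 2 * D ^ 2) ∧
    |momSin N k 0 * massTerm N m k * latSin N (mom N k 0)| ≤ 1 + 2 * (a ^ 2 * D ^ 2) ∧
    momSin N k 0 ^ 2 ≤ a ^ 2 * D := by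
  have h4 := latVer_nonneg N (mom N k 0)
  have h5 := latVer_nonneg N (mom N k 1)
  have h6 : (0 : ℝ) < 2 ^ N := by positivity
  have ha0 : 0 < a := by rw [ha]; positivity
  have hv := latVer_mul_le_diracDet hm hN k
  rw [← hD, ← le_div_iff₀' h6, div_eq_inv_mul, ← ha] at hv
  have hm' := abs_le.1 hm
  have hs0 : latSin N (mom N k 0) ^ 2 ≤ D := by
    rw [hD, diracDet]; nlinarith [sq_nonneg (latSin N (mom N k 1)), sq_nonneg (massTerm N m k)]
  have hD0 : 0 ≤ D := (sq_nonneg _).trans hs0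
  have e1 : momSin N k 0 = a * latSin N (mom N k 0) := by rw [momSin, ha, div_eq_inv_mul]
  have e2 : 1 - momCos N k 0 = a * latVer N (mom N k 0) := by
    rw [momCos, ha, div_eq_inv_mul]; ring
  have hc : a * latVer N (mom N k 0) ≤ 2 := by
    rw [ha, inv_mul_le_iff₀ h6, mul_comm]; exact latVer_le N _
  have hW : |massTerm N m k| ≤ 1 + a * D := by
    rw [massTerm]
    exact (abs_add_le _ _).trans (add_le_add hm (by rw [abs_of_nonneg (by positivity)]; exact hv))
  have haD : 0 ≤ a * D := by positivity
  refine ⟨?_, ?_, ?_, ?_, ?_⟩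
  · rw [e2, abs_of_nonneg (by positivity)]
    nlinarith
  · have : 0 ≤ a * latVer N (mom N k 0) := by positivity
    exact abs_le.2 ⟨by linarith, by linarith⟩
  · rw [← sq_abs]
    nlinarith [sq_nonneg (1 - a * D), abs_nonneg (massTerm N m k)]
  · rw [e1, show a * latSin N (mom N k 0) * massTerm N m k * latSin N (mom N k 0) =
      a * latSin N (mom N k 0) ^ 2 * massTerm N m k by ring, abs_mul,
      abs_of_nonneg (by positivity : 0 ≤ a * latSin N (mom N k 0) ^ 2)]
    have := mul_le_mul (mul_le_mul_of_nonneg_left hs0 ha0.le) hW (abs_nonneg _) haD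
    nlinarith [sq_nonneg (1 - a * D)]
  · rw [e1, mul_pow]
    gcongr

/-- The leading part of the diagonal loop traces, odd under exchange of the coordinates. -/
noncomputable def swapOddPart (N : ℕ) {n : ℕ} (k : Site n) : ℝ :=
  2 * (latSin N (mom N k 1) ^ 2 - latSin N (mom N k 0) ^ 2)

theorem swapOddPart_swapSite (k : Site n) : swapOddPart N (swapSite k) = -swapOddPart N k := by
  have h : ∀ μ, mom N (swapSite k) μ = mom N k (1 - μ) := fun μ => mom_congr rfl
  simp only [swapOddPart, h, sub_zero, sub_self]
  ring

/-- Replacing the cosine by 1 costs a²D · D, and the terms containing the mass are O(1 + a²D²)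
because |`massTerm`| ≤ 1 + aD. -/
theorem abs_gammaTrace_sub_le {m : ℝ} (hm : |m| ≤ 1) (hN : 1 ≤ N) (k : Site n) {a D : ℝ}
    (ha : a = ((2 : ℝ) ^ N)⁻¹) (hD : D = diracDet N m k) :
    |gammaTrace N m 0 0 k - swapOddPart N k| ≤ 8 + 14 * (a ^ 2 * D ^ 2) := by
  obtain ⟨h1, h2, h3, h4, h5⟩ := numerator_bounds hm hN k ha hD
  have hs : |latSin N (mom N k 1) ^ 2 - latSin N (mom N k 0) ^ 2| ≤ D := by
    rw [hD, diracDet]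
    exact abs_le.2 ⟨by nlinarith [sq_nonneg (latSin N (mom N k 1)), sq_nonneg (massTerm N m k)],
      by nlinarith [sq_nonneg (latSin N (mom N k 0)), sq_nonneg (massTerm N m k)]⟩
  have hD0 : 0 ≤ D := (abs_nonneg _).trans hs
  have e : gammaTrace N m 0 0 k - swapOddPart N k =
      -2 * ((1 - momCos N k 0) * (latSin N (mom N k 1) ^ 2 - latSin N (mom N k 0) ^ 2)) +
      2 * (momCos N k 0 * massTerm N m k ^ 2) -
      4 * (momSin N k 0 * massTerm N m k * latSin N (mom N k 0)) := by
    rw [gammaTrace, swapOddPart, if_pos rfl]; ring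
  have i1 : |(1 - momCos N k 0) * (latSin N (mom N k 1) ^ 2 - latSin N (mom N k 0) ^ 2)| ≤
      a ^ 2 * D ^ 2 := by
    rw [abs_mul]
    exact (mul_le_mul h1 hs (abs_nonneg _) (by positivity)).trans (by ring_nf; exact le_rfl)
  have i2 : |momCos N k 0 * massTerm N m k ^ 2| ≤ 2 + 2 * (a ^ 2 * D ^ 2) := by
    rw [abs_mul, abs_of_nonneg (sq_nonneg (massTerm N m k))]
    exact (mul_le_mul_of_nonneg_right h2 (sq_nonneg _)).trans (by linarith)
  rw [e]
  have j1 := abs_le.1 i1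
  have j2 := abs_le.1 i2
  have j4 := abs_le.1 h4
  have : 0 ≤ a ^ 2 * D ^ 2 := by positivity
  exact abs_le.2 ⟨by linarith [j1.1, j1.2, j2.1, j2.2, j4.1, j4.2],
    by linarith [j1.1, j1.2, j2.1, j2.2, j4.1, j4.2]⟩

theorem abs_loopTrace_sub_le {m : ℝ} (hm : |m| ≤ 1) (hN : 1 ≤ N) (k : Site n) {a D : ℝ}
    (ha : a = ((2 : ℝ) ^ N)⁻¹) (hD : D = diracDet N m k) :
    |momCos N k 0 * gammaTrace N m 0 0 k - momSin N k 0 * unitTrace N m 0 k - swapOddPart N k| ≤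
      24 + 40 * (a ^ 2 * D ^ 2) := by
  obtain ⟨h1, h2, h3, h4, h5⟩ := numerator_bounds hm hN k ha hD
  have h0 := abs_gammaTrace_sub_le hm hN k ha hD
  have hs : |swapOddPart N k| ≤ 2 * D := by
    rw [hD, diracDet, swapOddPart]
    exact abs_le.2 ⟨by nlinarith [sq_nonneg (latSin N (mom N k 1)), sq_nonneg (massTerm N m k)],
      by nlinarith [sq_nonneg (latSin N (mom N k 0)), sq_nonneg (massTerm N m k)]⟩
  have hw : |massTerm N m k ^ 2 - (latSin N (mom N k 0) ^ 2 + latSin N (mom N k 1) ^ 2)| ≤ D := by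
    rw [hD, diracDet]
    exact abs_le.2 ⟨by nlinarith [sq_nonneg (massTerm N m k)],
      by nlinarith [sq_nonneg (latSin N (mom N k 0)), sq_nonneg (latSin N (mom N k 1))]⟩
  have hD0 : 0 ≤ D := (abs_nonneg _).trans hw
  have e : momCos N k 0 * gammaTrace N m 0 0 k - momSin N k 0 * unitTrace N m 0 k -
      swapOddPart N k = momCos N k 0 * (gammaTrace N m 0 0 k - swapOddPart N k) -
      (1 - momCos N k 0) * swapOddPart N k -
      4 * (momCos N k 0 * (momSin N k 0 * massTerm N m k * latSin N (mom N k 0))) -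
      2 * (momSin N k 0 ^ 2 *
        (massTerm N m k ^ 2 - (latSin N (mom N k 0) ^ 2 + latSin N (mom N k 1) ^ 2))) := by
    rw [unitTrace]; ring
  have i0 := mul_le_mul h2 h0 (abs_nonneg _) zero_le_one
  have i1 := mul_le_mul h1 hs (abs_nonneg _) (by positivity)
  have i2 := mul_le_mul h2 h4 (abs_nonneg _) zero_le_one
  have i3 := mul_le_mul h5 hw (abs_nonneg _) (by positivity)
  rw [← abs_mul] at i0 i1 i2
  rw [← abs_of_nonneg (sq_nonneg (momSin N k 0)), ← abs_mul] at i3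
  rw [e]
  have j0 := abs_le.1 i0
  have j1 := abs_le.1 i1
  have j2 := abs_le.1 i2
  have j3 := abs_le.1 i3
  have : 0 ≤ a ^ 2 * D ^ 2 := by positivity
  have e3 : a ^ 2 * D * D = a ^ 2 * D ^ 2 := by ring
  have e4 : a ^ 2 * D * (2 * D) = 2 * (a ^ 2 * D ^ 2) := by ring
  rw [e3] at j3
  rw [e4] at j1
  exact abs_le.2 ⟨by linarith [j0.1, j0.2, j1.1, j1.2, j2.1, j2.2, j3.1, j3.2],
    by linarith [j0.1, j0.2, j1.1, j1.2, j2.1, j2.2, j3.1, j3.2]⟩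

theorem sum_range_four_pow_le (N : ℕ) : ∑ j ∈ Finset.range (N + 1), (4 : ℝ) ^ j ≤ 2 * 4 ^ N := by
  induction N with
  | zero => norm_num
  | succ N ih =>
    rw [Finset.sum_range_succ, pow_succ]
    have : (0 : ℝ) < 4 ^ N := by positivity
    linarith

/-- The sum over momenta of the remainder of the loop traces. -/
theorem IsCutoff.dualInt_bubbleCoeff_mul_le {χ : ℝ → ℝ} (hχ : IsCutoff χ) (hL : 1 ≤ side N n)
    {m : ℝ} (hm : |m| ≤ 1) (h : ℕ) :
    dualInt N (fun k : Site n =>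
      bubbleCoeff χ N m h k * (24 + 40 * ((((2 : ℝ) ^ N)⁻¹) ^ 2 * diracDet N m k ^ 2))) ≤
        1000000 := by
  classical
  have hs := side_pos N (n := n)
  set a : ℝ := ((2 : ℝ) ^ N)⁻¹ with ha
  -- On the support of scale j one has D ≥ 4^j/80, and 24 · 80² = 153600.
  let w : ℕ → ℝ := fun j => 153600 * ((16 : ℝ) ^ j)⁻¹ + 40 * a ^ 2
  have hw : ∀ j, 0 ≤ w j := fun j => by positivity
  have hpt : ∀ k : Site n, bubbleCoeff χ N m h k * (24 + 40 * (a ^ 2 * diracDet N m k ^ 2)) ≤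
      ∑ j ∈ Finset.Icc (h + 1) N, if scaleCutoff χ N j (momNorm N k) ≠ 0 then w j else 0 := by
    intro k
    have hk0 : 0 ≤ momNorm N k := Real.sqrt_nonneg _
    obtain ⟨hF0, hF1⟩ := hχ.fermiCut_mem (N := N) (h := h) (momNorm N k) hk0
    set D := diracDet N m k with hD
    have h1 : bubbleCoeff χ N m h k * (24 + 40 * (a ^ 2 * D ^ 2)) ≤
        fermiCut χ N h (momNorm N k) * (24 * (D⁻¹) ^ 2 + 40 * a ^ 2) := by
      have e : bubbleCoeff χ N m h k * (24 + 40 * (a ^ 2 * D ^ 2)) =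
          fermiCut χ N h (momNorm N k) ^ 2 * (24 * (D⁻¹) ^ 2 + 40 * a ^ 2 * (D⁻¹ * D) ^ 2) := by
        rw [bubbleCoeff]; ring
      -- An inequality only: D vanishes at the zero mode when m = 0.
      have h2 : (D⁻¹ * D) ^ 2 ≤ 1 := by
        by_cases h0 : D = 0
        · simp [h0]
        · rw [inv_mul_cancel₀ h0, one_pow]
      have h3 : fermiCut χ N h (momNorm N k) ^ 2 ≤ fermiCut χ N h (momNorm N k) := by
        nlinarith
      rw [e]
      refine mul_le_mul h3 ?_ (by positivity) hF0
      nlinarith [sq_nonneg a]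
    refine h1.trans ?_
    rw [fermiCut, Finset.sum_mul]
    refine Finset.sum_le_sum fun j hj => ?_
    have hj1 := Finset.mem_Icc.1 hj
    obtain ⟨hc0, hc1⟩ := hχ.scaleCutoff_mem (N := N) (j := j) (momNorm N k) hk0
    split_ifs with hc
    · have h4 : 2 ^ j / 4 ≤ momNorm N k := by
        by_contra hlt
        exact hc (hχ.scaleCutoff_eq_zero (by omega) hk0 (not_le.1 hlt).le)
      have h5 : 1 / 80 * (4 : ℝ) ^ j ≤ D := by
        refine le_trans ?_ (momNorm_sq_le_diracDet hm (by omega) k)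
        have h6 := pow_le_pow_left₀ (by positivity) h4 2
        have h7 : ((2 : ℝ) ^ j / 4) ^ 2 = 4 ^ j / 16 := by
          rw [div_pow, ← pow_mul, mul_comm, pow_mul]; norm_num
        rw [h7] at h6
        linarith
      have h8 : (D⁻¹) ^ 2 ≤ 6400 * ((16 : ℝ) ^ j)⁻¹ := by
        have h9 : D⁻¹ ≤ 80 * ((4 : ℝ) ^ j)⁻¹ := by
          refine (inv_anti₀ (by positivity) h5).trans (le_of_eq ?_)
          rw [mul_inv]; norm_num
        have hD0 : 0 ≤ D⁻¹ := inv_nonneg.2 (le_trans (by positivity) h5)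
        refine (pow_le_pow_left₀ hD0 h9 2).trans (le_of_eq ?_)
        rw [mul_pow, inv_pow, ← pow_mul, mul_comm j 2, pow_mul]
        norm_num
      have h10 : 24 * (D⁻¹) ^ 2 + 40 * a ^ 2 ≤ w j := by simp only [w]; linarith
      exact (mul_le_of_le_one_left (by positivity) hc1).trans h10
    · rw [not_not.1 hc, zero_mul]
  refine (dualInt_mono N hpt).trans ?_
  rw [dualInt_sum]
  have hj : ∀ j ∈ Finset.Icc (h + 1) N, dualInt N (fun k : Site n =>
      if scaleCutoff χ N j (momNorm N k) ≠ 0 then w j else 0) ≤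
      614400 * (1 / 4 : ℝ) ^ j + 160 * (a ^ 2 * 4 ^ j) := by
    intro j hj
    have hj1 := Finset.mem_Icc.1 hj
    have hcard := card_momNorm_le N hL (j := j)
      (fun k : Site n => scaleCutoff χ N j (momNorm N k) ≠ 0) fun k hk => by
        by_contra hcon
        push Not at hcon
        refine hk ?_
        have := hχ.fullCutoff_eq_zero_of_le (N := N) (j := j) (by omega) hcon.1.le
        rwa [fullCutoff, if_neg (by omega)] at this
    rw [dualInt, ← Finset.sum_filter, Finset.sum_const, nsmul_eq_mul, smul_eq_mul]
    calc (side N n ^ 2)⁻¹ * (_ * w j) ≤ (side N n ^ 2)⁻¹ * (4 * (side N n ^ 2 * 4 ^ j) * w j) := by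
          gcongr
      _ = 614400 * (4 ^ j * ((16 : ℝ) ^ j)⁻¹) + 160 * (a ^ 2 * 4 ^ j) := by
          simp only [w]
          field_simp
          ring
      _ = _ := by
          rw [show (16 : ℝ) = 4 * 4 by norm_num, mul_pow, one_div_pow]
          have : (4 : ℝ) ^ j ≠ 0 := by positivity
          field_simp
  refine (Finset.sum_le_sum hj).trans ?_
  rw [Finset.sum_add_distrib, ← Finset.mul_sum, ← Finset.mul_sum, ← Finset.mul_sum]
  have s1 := sum_Icc_pow_le (q := 1 / 4) (by norm_num) (by norm_num) h N
  have s2 : (1 / 4 : ℝ) ^ h ≤ 1 := pow_le_one₀ (by norm_num) (by norm_num)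
  have s3 : a ^ 2 * ∑ j ∈ Finset.Icc (h + 1) N, (4 : ℝ) ^ j ≤ 2 := by
    have h1 : ∑ j ∈ Finset.Icc (h + 1) N, (4 : ℝ) ^ j ≤ 2 * 4 ^ N := by
      refine le_trans ?_ (sum_range_four_pow_le N)
      refine Finset.sum_le_sum_of_subset_of_nonneg (fun j hj => ?_) fun j _ _ => by positivity
      have := Finset.mem_Icc.1 hj
      exact Finset.mem_range.2 (by omega)
    have h2 : a ^ 2 * 4 ^ N = 1 := by
      rw [ha, inv_pow, ← pow_mul, mul_comm N 2, pow_mul]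
      norm_num
    calc _ ≤ a ^ 2 * (2 * 4 ^ N) := by gcongr
      _ = 2 := by linear_combination 2 * h2
  have s4 : (1 / 4 : ℝ) ^ h / (1 - 1 / 4) ≤ 4 / 3 := by
    rw [div_le_iff₀ (by norm_num)]; linarith
  -- 614400 · 4/3 + 160 · 2 = 819520. The first sum converges in the ultraviolet, while the second
  -- is dominated by the top scale, where a² 4^N = 1.
  linarith

/-- The scalar factor is invariant under the exchange of the coordinates, so `swapOddPart` sums to
zero and may be subtracted for free. Without it no logarithmic sum over scales remains. -/
theorem IsCutoff.norm_quarter_dualInt_le {χ : ℝ → ℝ} (hχ : IsCutoff χ) (hL : 1 ≤ side N n)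
    {m : ℝ} (hm : |m| ≤ 1) (h : ℕ) (f : Site n → ℝ)
    (hf : 1 ≤ N → ∀ k, |f k - swapOddPart N k| ≤
      24 + 40 * ((((2 : ℝ) ^ N)⁻¹) ^ 2 * diracDet N m k ^ 2)) :
    ‖dualInt N fun k : Site n => (bubbleCoeff χ N m h k : ℂ) * (f k : ℂ)‖ ≤ 1000000 := by
  have e0 : (dualInt N fun k : Site n => (bubbleCoeff χ N m h k : ℂ) * (swapOddPart N k : ℂ)) = 0 := by
    refine dualInt_eq_zero_of_odd swapSite fun k => ?_
    rw [bubbleCoeff_swapSite, swapOddPart_swapSite]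
    push_cast
    ring
  have e1 : (dualInt N fun k : Site n => (bubbleCoeff χ N m h k : ℂ) * (f k : ℂ)) =
      dualInt N fun k : Site n => (bubbleCoeff χ N m h k : ℂ) * ((f k - swapOddPart N k : ℝ) : ℂ) := by
    have e2 : (fun k : Site n => (bubbleCoeff χ N m h k : ℂ) * (f k : ℂ)) = fun k =>
        (bubbleCoeff χ N m h k : ℂ) * ((f k - swapOddPart N k : ℝ) : ℂ) +
          (bubbleCoeff χ N m h k : ℂ) * (swapOddPart N k : ℂ) := by
      funext k
      push_cast
      ring
    rw [e2, dualInt_add, e0, add_zero]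
  rw [e1]
  refine (norm_dualInt_le N _).trans (le_trans (dualInt_mono N fun k => ?_)
    (hχ.dualInt_bubbleCoeff_mul_le hL hm h))
  rw [norm_mul, Complex.norm_real, Complex.norm_real, Real.norm_eq_abs, Real.norm_eq_abs,
    abs_of_nonneg (sq_nonneg _)]
  by_cases hN : 1 ≤ N
  · exact mul_le_mul_of_nonneg_left (hf hN k) (sq_nonneg _)
  · have : bubbleCoeff χ N m h k = 0 := by
      rw [bubbleCoeff, fermiCut, Finset.Icc_eq_empty (by omega), Finset.sum_empty, zero_mul,
        zero_pow two_ne_zero]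
    rw [this, zero_mul, zero_mul]

theorem IsCutoff.norm_bubbleHat_zero_le {χ : ℝ → ℝ} (hχ : IsCutoff χ) (hL : 1 ≤ side N n)
    {m Z : ℝ} (hm : |m| ≤ 1) (hZ : |Z - 1| ≤ 1 / 2) (h : ℕ) (t : BubbleKind) (μ ν : Fin 2) :
    ‖bubbleHat (n := n) χ N m Z h t 0 μ ν‖ ≤ 1000000 := by
  have h0 : ‖(1 / 4 : ℂ)‖ = 1 / 4 := by norm_num
  cases t
  · have key : ‖bubbleHat (n := n) χ N m Z h BubbleKind.vector 0 0 0‖ ≤ 1000000 := by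
      rw [bubbleHat_zero_eq_loopTrace, norm_mul, h0]
      simp only [loopTrace_vector]
      have := hχ.norm_quarter_dualInt_le hL hm h _
        fun hN k => abs_loopTrace_sub_le hm hN k rfl rfl
      linarith [norm_nonneg (dualInt N fun k : Site n => (bubbleCoeff χ N m h k : ℂ) *
        ((momCos N k 0 * gammaTrace N m 0 0 k - momSin N k 0 * unitTrace N m 0 k : ℝ) : ℂ))]
    rw [bubbleHat_vector_zero, norm_mul]
    refine (mul_le_of_le_one_left (norm_nonneg _) ?_).trans key
    split_ifs <;> simp
  · have hZ' : |Z| ≤ 3 / 2 := by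
      have := abs_le.1 hZ
      exact abs_le.2 ⟨by linarith, by linarith⟩
    have key : ‖bubbleHat (n := n) χ N m Z h BubbleKind.chiral 0 0 1‖ ≤ 1000000 := by
      have e : (dualInt N fun k : Site n =>
          (bubbleCoeff χ N m h k : ℂ) * loopTrace N m Z BubbleKind.chiral 0 1 k) =
          -(Complex.I * Z) * dualInt N fun k : Site n =>
            (bubbleCoeff χ N m h k : ℂ) * (gammaTrace N m 0 0 k : ℂ) := by
        rw [← dualInt_const_mul_complex]
        congr 1
        funext k
        rw [loopTrace_chiral_one]
        ring
      have := hχ.norm_quarter_dualInt_le hL hm h (gammaTrace N m 0 0) fun hN k =>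
        (abs_gammaTrace_sub_le hm hN k rfl rfl).trans (by
          have : 0 ≤ (((2 : ℝ) ^ N)⁻¹) ^ 2 * diracDet N m k ^ 2 := by positivity
          linarith)
      rw [bubbleHat_zero_eq_loopTrace, norm_mul, h0, e, norm_mul, norm_neg, norm_mul,
        Complex.norm_I, one_mul, Complex.norm_real, Real.norm_eq_abs]
      nlinarith [norm_nonneg (dualInt N fun k : Site n =>
            (bubbleCoeff χ N m h k : ℂ) * (gammaTrace N m 0 0 k : ℂ)), abs_nonneg Z]
    rw [bubbleHat_chiral_zero, norm_mul]
    refine (mul_le_of_le_one_left (norm_nonneg _) ?_).trans key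
    fin_cases μ <;> fin_cases ν <;> simp [epsTensor]

end HatBound


/-! ### Weighted norms and increments of kernels -/

section Norms

variable {N n : ℕ} [NeZero n] {κ : ℝ}

theorem bInt_mono {f g : BLabel n → ℝ} (h : ∀ b, f b ≤ g b) : bInt N f ≤ bInt N g :=
  Finset.sum_le_sum fun _ _ => Finset.sum_le_sum fun _ _ => siteInt_mono N fun _ => h _

theorem bInt_add (f g : BLabel n → ℝ) :
    bInt N (fun b => f b + g b) = bInt N f + bInt N g := by
  simp only [bInt, siteInt_add, Finset.sum_add_distrib]

theorem wNorm_le_sub_add (V W : BLabel n → BLabel n → ℂ) :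
    wNorm κ N V ≤ wNorm κ N (fun b b' => V b b' - W b b') + wNorm κ N W := by
  rw [wNorm, wNorm, wNorm, ← mul_add, ← bInt_add]
  refine mul_le_mul_of_nonneg_left (bInt_mono fun b => ?_) (by positivity)
  rw [← bInt_add]
  refine bInt_mono fun b' => ?_
  rw [← mul_add]
  refine mul_le_mul_of_nonneg_left ?_ (Real.exp_pos _).le
  calc ‖V b b'‖ = ‖(V b b' - W b b') + W b b'‖ := by rw [sub_add_cancel]
    _ ≤ _ := norm_add_le _ _

theorem siteInt_const (c : ℝ) : siteInt N (fun _ : Site n => c) = side N n ^ 2 * c := by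
  simp only [siteInt, Finset.sum_const, Finset.card_univ, nsmul_eq_mul, smul_eq_mul,
    Fintype.card_pi, ZMod.card, Finset.prod_const, Fintype.card_fin, side]
  push_cast
  field_simp

/-- The weighted norm of a translation invariant kernel. -/
theorem wNorm_eq_of_forall {V : BLabel n → BLabel n → ℂ}
    (k : Fin 2 → ℤˣ → Fin 2 → ℤˣ → Site n → ℂ)
    (h : ∀ x μ ε y ν ε', V (x, μ, ε) (y, ν, ε') = k μ ε ν ε' (x - y)) :
    wNorm κ N V = ∑ μ, ∑ ε, ∑ ν, ∑ ε', siteInt N fun z => weight κ N z * ‖k μ ε ν ε' z‖ := by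
  have hs := (side_pos N (n := n)).ne'
  have h1 : ∀ x μ ε, (bInt N fun b' : BLabel n =>
      Real.exp (κ / 2 * Real.sqrt (torusNorm N (x - b'.1))) * ‖V (x, μ, ε) b'‖) =
      ∑ ν, ∑ ε', siteInt N fun z => weight κ N z * ‖k μ ε ν ε' z‖ := by
    intro x μ ε
    rw [bInt]
    refine Finset.sum_congr rfl fun ν _ => Finset.sum_congr rfl fun ε' _ => ?_
    rw [← siteInt_sub_left N x]
    simp only [h, weight, sub_sub_cancel]
  rw [wNorm, bInt]
  simp only [h1, siteInt_const, ← Finset.mul_sum]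
  rw [← mul_assoc, inv_mul_cancel₀ (pow_ne_zero 2 hs), one_mul]

theorem norm_sgn (ε : ℤˣ) : ‖sgn ε‖ = 1 := by
  rcases Int.units_eq_one_or ε with rfl | rfl <;> simp [sgn]

theorem wNorm_signKernel (v : Fin 2 → Fin 2 → Site n → ℂ) :
    wNorm κ N (signKernel v) =
      4 * ∑ μ, ∑ ν, siteInt N fun z => weight κ N z * ‖v μ ν z‖ := by
  rw [wNorm_eq_of_forall (fun μ ε ν ε' z => sgn ε * sgn ε' * v μ ν z) fun x μ ε y ν ε' => rfl]
  simp only [norm_mul, norm_sgn, one_mul, Finset.sum_const, Finset.card_univ, Fintype.card_units_int,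
    nsmul_eq_mul, ← Finset.mul_sum]
  push_cast
  ring

theorem siteInt_weight_shift_le (hκ : 0 ≤ κ) {f : Site n → ℝ} (hf : ∀ z, 0 ≤ f z) (p : Site n) :
    siteInt N (fun z => weight κ N z * f (z + p)) ≤
      weight κ N p * siteInt N fun z => weight κ N z * f z := by
  rw [← siteInt_const_mul, ← siteInt_sub_right N p]
  refine siteInt_mono N fun z => ?_
  rw [sub_add_cancel, sub_eq_add_neg, ← mul_assoc]
  refine mul_le_mul_of_nonneg_right ?_ (hf z)
  refine (weight_add_le hκ _ _).trans (le_of_eq ?_)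
  rw [weight_neg, mul_comm]

/-- Telescoping along multiples of a fixed step. -/
theorem siteInt_weight_nsmul_sub_le (hκ : 0 ≤ κ) (f : Site n → ℂ) {e : Site n} {B W : ℝ}
    (hB : siteInt N (fun z => weight κ N z * ‖f (z + e) - f z‖) ≤ B) (r : ℕ)
    (hW : ∀ i < r, weight κ N (i • e) ≤ W) :
    siteInt N (fun z => weight κ N z * ‖f (z + r • e) - f z‖) ≤ r * (W * B) := by
  induction r with
  | zero => simp [siteInt]
  | succ r ih =>
    have h1 := ih fun i hi => hW i (by omega)
    have h2 := siteInt_weight_shift_le (N := N) hκ (f := fun z => ‖f (z + e) - f z‖)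
      (fun _ => norm_nonneg _) (r • e)
    have h3 := h2.trans (mul_le_mul (hW r (by omega)) hB
      (siteInt_nonneg N fun z => mul_nonneg (weight_pos z).le (norm_nonneg _))
      ((weight_pos _).le.trans (hW r (by omega))))
    have h4 : siteInt N (fun z => weight κ N z * ‖f (z + (r + 1) • e) - f z‖) ≤
        siteInt N (fun z => weight κ N z * ‖f (z + r • e) - f z‖) +
        siteInt N (fun z => weight κ N z * ‖f (z + r • e + e) - f (z + r • e)‖) := by
      rw [← siteInt_add]
      refine siteInt_mono N fun z => ?_
      rw [← mul_add]
      refine mul_le_mul_of_nonneg_left ?_ (weight_pos z).le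
      rw [succ_nsmul, ← add_assoc, add_comm ‖f (z + r • e) - f z‖]
      exact norm_sub_le_norm_sub_add_norm_sub _ _ _
    push_cast
    linarith

theorem torusNorm_nsmul_le (e : Site n) (i : ℕ) : torusNorm N (i • e) ≤ i * torusNorm N e := by
  induction i with
  | zero => simp
  | succ i ih =>
    rw [succ_nsmul]
    push_cast
    have := torusNorm_add_le N (i • e) e
    linarith

theorem abs_coord_le_torusNorm (x : Site n) (μ : Fin 2) : |coord N x μ| ≤ torusNorm N x := by
  rw [torusNorm, ← Real.sqrt_sq_eq_abs]
  exact Real.sqrt_le_sqrt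
    (Finset.single_le_sum (f := fun ν => coord N x ν ^ 2) (fun _ _ => sq_nonneg _) (Finset.mem_univ μ))

/-- The weighted difference along one coordinate of a site. -/
theorem siteInt_weight_single_sub_le (hκ : 0 ≤ κ) (f : Site n → ℂ) (μ : Fin 2) (u : Site n) :
    siteInt N (fun z => weight κ N z * ‖f (z + Pi.single μ (u μ)) - f z‖) ≤
      |coord N u μ| * (weight κ N u * (Real.exp (κ / 2) *
        siteInt N fun z => weight κ N z * ‖2 ^ N * (f (z + unitVec μ) - f z)‖)) := by
  set a : ℝ := ((2 : ℝ) ^ N)⁻¹ with ha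
  have ha0 : 0 < a := by rw [ha]; positivity
  have ha1 : a ≤ 1 := inv_le_one_of_one_le₀ (one_le_pow₀ (by norm_num))
  set G := siteInt N fun z => weight κ N z * ‖2 ^ N * (f (z + unitVec μ) - f z)‖ with hG
  have hG0 : 0 ≤ G := siteInt_nonneg N fun z => mul_nonneg (weight_pos z).le (norm_nonneg _)
  have hexp : 1 ≤ Real.exp (κ / 2) := Real.one_le_exp (by positivity)
  have hplus : siteInt N (fun z => weight κ N z * ‖f (z + unitVec μ) - f z‖) = a * G := by
    rw [hG, ← siteInt_const_mul]
    congr 1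
    funext z
    rw [norm_mul, norm_pow, Complex.norm_ofNat, ha]
    field_simp
  -- A backward difference is a forward difference shifted by one site; the shift costs the weight
  -- of one lattice step, at most e^{κ/2}.
  have hminus : siteInt N (fun z => weight κ N z * ‖f (z + -unitVec μ) - f z‖) ≤
      Real.exp (κ / 2) * (a * G) := by
    have h1 := siteInt_weight_shift_le (N := N) hκ (f := fun z => ‖f (z + unitVec μ) - f z‖)
      (fun _ => norm_nonneg _) (-unitVec μ)
    rw [hplus, weight_neg] at h1
    have h2 : weight κ N (unitVec μ : Site n) ≤ Real.exp (κ / 2) :=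
      weight_le_exp_of_le_one hκ ((torusNorm_unitVec_le N μ).trans ha1)
    refine le_trans (le_of_eq ?_) (h1.trans (mul_le_mul_of_nonneg_right h2 (by positivity)))
    congr 1
    funext z
    rw [neg_add_cancel_right, norm_sub_rev]
  set r := (u μ).valMinAbs.natAbs with hr
  have hcr : |coord N u μ| = r * a := by
    rw [coord, abs_div, abs_of_pos (by positivity : (0 : ℝ) < 2 ^ N), hr, Nat.cast_natAbs,
      Int.cast_abs, ha, div_eq_mul_inv]
  -- The points before the end of the path stay within |u_μ| of the origin, so their weights are
  -- dominated by that of u.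
  have hstep : ∀ e : Site n, torusNorm N e ≤ a → ∀ i < r, weight κ N (i • e) ≤ weight κ N u := by
    intro e he i hi
    refine weight_le_of_torusNorm_le hκ ((torusNorm_nsmul_le e i).trans ?_)
    refine le_trans ?_ (abs_coord_le_torusNorm u μ)
    rw [hcr]
    have : (i : ℝ) ≤ r := by exact_mod_cast hi.le
    exact mul_le_mul this he (torusNorm_nonneg N e) (by positivity)
  have hfin : ∀ e : Site n, torusNorm N e ≤ a →
      siteInt N (fun z => weight κ N z * ‖f (z + e) - f z‖) ≤ Real.exp (κ / 2) * (a * G) →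
      r • e = Pi.single μ (u μ) →
      siteInt N (fun z => weight κ N z * ‖f (z + Pi.single μ (u μ)) - f z‖) ≤
        |coord N u μ| * (weight κ N u * (Real.exp (κ / 2) * G)) := by
    intro e he hB hre
    have := siteInt_weight_nsmul_sub_le hκ f hB r (hstep e he)
    rw [hre] at this
    refine this.trans (le_of_eq ?_)
    rw [hcr]
    ring
  have hu : ((u μ).valMinAbs : ZMod n) = u μ := ZMod.coe_valMinAbs _
  rcases Int.natAbs_eq (u μ).valMinAbs with h | h
  · refine hfin (unitVec μ) (torusNorm_unitVec_le N μ) ?_ ?_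
    · rw [hplus]
      exact le_mul_of_one_le_left (by positivity) hexp
    · rw [unitVec, ← Pi.single_smul', ← hu, h, hr]
      simp
  · refine hfin (-unitVec μ) ?_ hminus ?_
    · rw [torusNorm_neg]; exact torusNorm_unitVec_le N μ
    · rw [unitVec, ← Pi.single_neg, ← Pi.single_smul', ← hu, h, hr]
      simp

theorem weight_sq (x : Site n) : weight κ N x * weight κ N x = weight (2 * κ) N x := by
  rw [weight, weight, ← Real.exp_add]
  congr 1
  ring

theorem one_le_weight (hκ : 0 ≤ κ) (x : Site n) : 1 ≤ weight κ N x :=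
  Real.one_le_exp (by positivity)

/-- The increment is telescoped along a path parallel to the axes. One factor of the weight of u
comes from the points of a segment, another from translating the second segment by the first; hence
2κ. -/
theorem siteInt_weight_sub_le (hκ : 0 ≤ κ) (v : Fin 2 → Fin 2 → Site n → ℂ) (μ ν : Fin 2)
    (u : Site n) :
    siteInt N (fun z => weight κ N z * ‖v μ ν (z - u) - v μ ν z‖) ≤
      torusNorm N u * weight (2 * κ) N u * (Real.exp (κ / 2) *
        ∑ α, siteInt N fun z => weight κ N z * ‖latticeDeriv N α v μ ν z‖) := by
  have key : ∀ u : Site n, siteInt N (fun z => weight κ N z * ‖v μ ν (z + u) - v μ ν z‖) ≤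
      torusNorm N u * weight (2 * κ) N u * (Real.exp (κ / 2) *
        ∑ α, siteInt N fun z => weight κ N z * ‖latticeDeriv N α v μ ν z‖) := by
    intro u
    have h0 := siteInt_weight_single_sub_le (N := N) hκ (v μ ν) 0 u
    have h1 := siteInt_weight_single_sub_le (N := N) hκ (v μ ν) 1 u
    set G : Fin 2 → ℝ := fun α => siteInt N fun z => weight κ N z * ‖latticeDeriv N α v μ ν z‖
      with hG
    have hG0 : ∀ α, 0 ≤ G α := fun α =>
      siteInt_nonneg N fun z => mul_nonneg (weight_pos z).le (norm_nonneg _)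
    change _ ≤ _ * (_ * (_ * G 0)) at h0
    change _ ≤ _ * (_ * (_ * G 1)) at h1
    set p : Site n := Pi.single 0 (u 0) with hp
    set q : Site n := Pi.single 1 (u 1) with hq
    have hu : u = p + q := by
      ext i
      fin_cases i <;> simp [hp, hq]
    have hpn : torusNorm N p ≤ torusNorm N u := by
      refine le_trans ?_ (abs_coord_le_torusNorm u 0)
      refine (torusNorm_le_abs_add_abs N p).trans (le_of_eq ?_)
      simp [coord, hp]
    have hwp := weight_le_of_torusNorm_le hκ hpn
    have h2 := siteInt_weight_shift_le (N := N) hκ (f := fun z => ‖v μ ν (z + q) - v μ ν z‖)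
      (fun _ => norm_nonneg _) p
    have h3 : siteInt N (fun z => weight κ N z * ‖v μ ν (z + u) - v μ ν z‖) ≤
        siteInt N (fun z => weight κ N z * ‖v μ ν (z + p) - v μ ν z‖) +
        siteInt N (fun z => weight κ N z * ‖v μ ν (z + p + q) - v μ ν (z + p)‖) := by
      rw [← siteInt_add]
      refine siteInt_mono N fun z => ?_
      rw [← mul_add]
      refine mul_le_mul_of_nonneg_left ?_ (weight_pos z).le
      rw [hu, ← add_assoc, add_comm ‖v μ ν (z + p) - v μ ν z‖]
      exact norm_sub_le_norm_sub_add_norm_sub _ _ _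
    have hw1 := one_le_weight (N := N) hκ u
    have hR := torusNorm_nonneg N u
    have hW0 : 0 ≤ weight κ N u := (weight_pos u).le
    have hE : 0 ≤ Real.exp (κ / 2) := (Real.exp_pos _).le
    have h4 : siteInt N (fun z => weight κ N z * ‖v μ ν (z + p) - v μ ν z‖) ≤
        torusNorm N u * (weight κ N u * weight κ N u) * (Real.exp (κ / 2) * G 0) := by
      refine h0.trans ?_
      have e : torusNorm N u * (weight κ N u * weight κ N u) * (Real.exp (κ / 2) * G 0) =
        torusNorm N u * (weight κ N u * (weight κ N u * (Real.exp (κ / 2) * G 0))) := by ring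
      rw [e]
      have hEG : 0 ≤ Real.exp (κ / 2) * G 0 := mul_nonneg hE (hG0 0)
      exact mul_le_mul (abs_coord_le_torusNorm u 0) (mul_le_mul_of_nonneg_left
        (le_mul_of_one_le_left hEG hw1) hW0) (mul_nonneg hW0 hEG) hR
    have h5 : siteInt N (fun z => weight κ N z * ‖v μ ν (z + p + q) - v μ ν (z + p)‖) ≤
        torusNorm N u * (weight κ N u * weight κ N u) * (Real.exp (κ / 2) * G 1) := by
      have hEG : 0 ≤ Real.exp (κ / 2) * G 1 := mul_nonneg hE (hG0 1)
      refine h2.trans ((mul_le_mul hwp (h1.trans (mul_le_mul_of_nonneg_right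
        (abs_coord_le_torusNorm u 1) (mul_nonneg hW0 hEG)))
        (siteInt_nonneg N fun z => mul_nonneg (weight_pos z).le (norm_nonneg _)) hW0).trans
        (le_of_eq ?_))
      ring
    rw [Fin.sum_univ_two, ← weight_sq]
    change _ ≤ _ * (_ * (G 0 + G 1))
    linarith
  have := key (-u)
  rw [torusNorm_neg, weight_neg] at this
  simpa only [sub_eq_add_neg] using this

end Norms


/-! ### Convolution with the bubble -/

section Convolution

variable {N n : ℕ} [NeZero n] {κ : ℝ}

theorem norm_gam_apply_le (μ s s' : Fin 2) : ‖gam μ s s'‖ ≤ 1 := by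
  fin_cases μ <;> fin_cases s <;> fin_cases s' <;> simp [gam]

theorem norm_spinMat_le {Z : ℝ} (hZ : |Z - 1| ≤ 1 / 2) (t : BubbleKind) (μ : Fin 2) (ε : ℤˣ)
    (s s' : Fin 2) : ‖spinMat Z t μ ε s s'‖ ≤ 1 := by
  have h1 : ‖(1 : Matrix (Fin 2) (Fin 2) ℂ) s s'‖ ≤ 1 := by
    rw [Matrix.one_apply]; split_ifs <;> simp
  have h2 : ‖(1 / 2 : ℂ)‖ = 1 / 2 := by norm_num
  cases t
  · have h3 := norm_gam_apply_le μ s s'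
    simp only [spinMat]
    split_ifs
    · rw [Matrix.smul_apply, Matrix.sub_apply, smul_eq_mul, norm_mul, h2]
      linarith [norm_sub_le (gam μ s s') ((1 : Matrix (Fin 2) (Fin 2) ℂ) s s')]
    · rw [Matrix.smul_apply, Matrix.add_apply, smul_eq_mul, norm_mul, norm_neg, h2]
      linarith [norm_add_le (gam μ s s') ((1 : Matrix (Fin 2) (Fin 2) ℂ) s s')]
  · have hZ' : |Z| ≤ 3 / 2 := by
      have := abs_le.1 hZ
      exact abs_le.2 ⟨by linarith, by linarith⟩
    have h3 : ‖(gam μ * gamFive) s s'‖ ≤ 1 := by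
      rcases (show ∀ μ : Fin 2, μ = 0 ∨ μ = 1 by decide) μ with rfl | rfl
      · rw [gam_zero_mul_gamFive]
        fin_cases s <;> fin_cases s' <;> simp
      · rw [gam_one_mul_gamFive]
        fin_cases s <;> fin_cases s' <;> simp
    simp only [spinMat]
    rw [Matrix.smul_apply, smul_eq_mul, norm_mul, norm_mul, norm_mul, h2, norm_sgn,
      Complex.norm_real, Real.norm_eq_abs]
    nlinarith [norm_nonneg ((gam μ * gamFive) s s'), abs_nonneg Z]

theorem torusNorm_legOne_le (t : BubbleKind) (μ : Fin 2) (ε : ℤˣ) :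
    torusNorm N (legOne t μ ε : Site n) ≤ ((2 : ℝ) ^ N)⁻¹ := by
  have h0 : torusNorm N (0 : Site n) ≤ ((2 : ℝ) ^ N)⁻¹ := by
    rw [torusNorm_zero]; positivity
  cases t
  · simp only [legOne]
    split_ifs
    exacts [h0, torusNorm_unitVec_le N μ]
  · exact h0

theorem torusNorm_legTwo_le (t : BubbleKind) (μ : Fin 2) (ε : ℤˣ) :
    torusNorm N (legTwo t μ ε : Site n) ≤ ((2 : ℝ) ^ N)⁻¹ := by
  have h0 : torusNorm N (0 : Site n) ≤ ((2 : ℝ) ^ N)⁻¹ := by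
    rw [torusNorm_zero]; positivity
  cases t
  · simp only [legTwo]
    split_ifs
    exacts [torusNorm_unitVec_le N μ, h0]
  · exact h0

/-- Effect of a short translation on the first weighted moment. -/
theorem siteInt_torusNorm_weight_shift_le (hκ : 0 ≤ κ) (hN : 1 ≤ N) {d : Site n}
    (hd : torusNorm N d ≤ 2 * ((2 : ℝ) ^ N)⁻¹) {f : Site n → ℝ} (hf : ∀ z, 0 ≤ f z) :
    siteInt N (fun u => torusNorm N u * weight κ N u * f (u + d)) ≤ 2 * Real.exp (κ / 2) *
      siteInt N fun u => (torusNorm N u + ((2 : ℝ) ^ N)⁻¹) * weight κ N u * f u := by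
  have ha : ((2 : ℝ) ^ N)⁻¹ ≤ 1 / 2 := by
    rw [one_div]
    refine inv_anti₀ (by norm_num) ?_
    calc (2 : ℝ) = 2 ^ 1 := by norm_num
      _ ≤ 2 ^ N := pow_le_pow_right₀ (by norm_num) hN
  rw [← siteInt_sub_right N d, ← siteInt_const_mul]
  refine siteInt_mono N fun u => ?_
  rw [sub_add_cancel]
  have h1 : torusNorm N (u - d) ≤ 2 * (torusNorm N u + ((2 : ℝ) ^ N)⁻¹) := by
    linarith [torusNorm_sub_le N u d, torusNorm_nonneg N u]
  have h2 : weight κ N (u - d) ≤ weight κ N u * Real.exp (κ / 2) := by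
    rw [sub_eq_add_neg]
    refine (weight_add_le hκ _ _).trans ?_
    rw [weight_neg]
    exact mul_le_mul_of_nonneg_left (weight_le_exp_of_le_one hκ (by linarith)) (weight_pos u).le
  have h3 := mul_le_mul h1 h2 (weight_pos _).le
    (by linarith [torusNorm_nonneg N u, inv_nonneg.2 (by positivity : (0 : ℝ) ≤ 2 ^ N)])
  refine (mul_le_mul_of_nonneg_right h3 (hf u)).trans (le_of_eq ?_)
  ring

/-- The inequality 2|XY| ≤ |X|² + |Y|² separates the two propagators; each of the sixteen spin terms
contributes at most e^{κ/2} K. Their arguments are displaced by at most 2a, which is why the moment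
carries |x| + a instead of |x|. -/
theorem siteInt_torusNorm_weight_mul_bubbleProfile_le (χ : ℝ → ℝ) (hκ : 0 ≤ κ) (hN : 1 ≤ N)
    {m Z K : ℝ} (hZ : |Z - 1| ≤ 1 / 2) (h : ℕ)
    (hK : ∀ s s', siteInt N (fun x : Site n => (torusNorm N x + ((2 : ℝ) ^ N)⁻¹) * weight κ N x *
          ‖fermiProp χ N m h x s s'‖ ^ 2) ≤ K) (t : BubbleKind) (μ ν : Fin 2) (ε ε' : ℤˣ) :
    siteInt N (fun u : Site n => torusNorm N u * weight κ N u *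
      ‖bubbleProfile χ N m Z h t μ ε ν ε' u‖) ≤ 16 * Real.exp (κ / 2) * K := by
  set d : Site n := legTwo BubbleKind.vector μ ε - legOne t ν ε' with hd
  set d' : Site n := legTwo t ν ε' - legOne BubbleKind.vector μ ε with hd'
  have hdn : torusNorm N d ≤ 2 * ((2 : ℝ) ^ N)⁻¹ := by
    linarith [torusNorm_sub_le N (legTwo BubbleKind.vector μ ε : Site n) (legOne t ν ε'),
      torusNorm_legTwo_le (N := N) (n := n) BubbleKind.vector μ ε,
      torusNorm_legOne_le (N := N) (n := n) t ν ε']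
  have hdn' : torusNorm N d' ≤ 2 * ((2 : ℝ) ^ N)⁻¹ := by
    linarith [torusNorm_sub_le N (legTwo t ν ε' : Site n) (legOne BubbleKind.vector μ ε),
      torusNorm_legTwo_le (N := N) (n := n) t ν ε',
      torusNorm_legOne_le (N := N) (n := n) BubbleKind.vector μ ε]
  set g := fermiProp χ N (n := n) m h with hg
  have hE := (Real.exp_pos (κ / 2)).le
  have h1 : ∀ s s', siteInt N (fun u => torusNorm N u * weight κ N u * ‖g (u + d) s s'‖ ^ 2) ≤
      2 * Real.exp (κ / 2) * K := fun s s' =>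
    (siteInt_torusNorm_weight_shift_le hκ hN hdn (f := fun u => ‖g u s s'‖ ^ 2)
      fun _ => by positivity).trans (mul_le_mul_of_nonneg_left (hK s s') (by positivity))
  have h2 : ∀ s s', siteInt N (fun u => torusNorm N u * weight κ N u * ‖g (-u + d') s s'‖ ^ 2) ≤
      2 * Real.exp (κ / 2) * K := fun s s' => by
    refine le_trans (le_of_eq ?_) ((siteInt_torusNorm_weight_shift_le hκ hN hdn'
      (f := fun u => ‖g u s s'‖ ^ 2) fun _ => by positivity).trans
      (mul_le_mul_of_nonneg_left (hK s s') (by positivity)))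
    rw [← siteInt_neg]
    simp only [torusNorm_neg, weight_neg, neg_neg]
  have hpt : ∀ u : Site n, torusNorm N u * weight κ N u *
      ‖bubbleProfile χ N m Z h t μ ε ν ε' u‖ ≤ ∑ _s₁ : Fin 2, ∑ s₁' : Fin 2, ∑ s₂ : Fin 2,
        ∑ s₂' : Fin 2, 1 / 4 * (torusNorm N u * weight κ N u * ‖g (u + d) s₁' s₂‖ ^ 2 +
          torusNorm N u * weight κ N u * ‖g (-u + d') s₂' _s₁‖ ^ 2) := by
    intro u
    have hw : 0 ≤ torusNorm N u * weight κ N u := mul_nonneg (torusNorm_nonneg N u) (weight_pos u).le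
    have h3 : ‖bubbleProfile χ N m Z h t μ ε ν ε' u‖ ≤ ∑ s₁ : Fin 2, ∑ s₁' : Fin 2, ∑ s₂ : Fin 2,
        ∑ s₂' : Fin 2, 1 / 4 * (‖g (u + d) s₁' s₂‖ ^ 2 + ‖g (-u + d') s₂' s₁‖ ^ 2) := by
      rw [bubbleProfile, spinSum, norm_mul, show ‖(1 / 2 : ℂ)‖ = 1 / 2 by norm_num]
      simp only [← Finset.mul_sum]
      rw [show (1 / 4 : ℝ) = 1 / 2 * (1 / 2) by norm_num, mul_assoc]
      refine mul_le_mul_of_nonneg_left ?_ (by norm_num)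
      simp only [Finset.mul_sum]
      refine norm_sum_le_of_le _ fun s₁ _ => norm_sum_le_of_le _ fun s₁' _ =>
        norm_sum_le_of_le _ fun s₂ _ => norm_sum_le_of_le _ fun s₂' _ => ?_
      rw [norm_mul, norm_mul, norm_mul]
      have i1 := mul_le_mul (norm_spinMat_le hZ BubbleKind.vector μ ε s₁ s₁')
        (norm_spinMat_le hZ t ν ε' s₂ s₂') (norm_nonneg _) zero_le_one
      refine (mul_le_mul_of_nonneg_right i1 (by positivity)).trans ?_
      rw [one_mul, one_mul]
      nlinarith [two_mul_le_add_sq ‖g (u + d) s₁' s₂‖ ‖g (-u + d') s₂' s₁‖]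
    refine (mul_le_mul_of_nonneg_left h3 hw).trans (le_of_eq ?_)
    simp only [Finset.mul_sum]
    refine Finset.sum_congr rfl fun s₁ _ => Finset.sum_congr rfl fun s₁' _ =>
      Finset.sum_congr rfl fun s₂ _ => Finset.sum_congr rfl fun s₂' _ => by ring
  refine (siteInt_mono N hpt).trans ?_
  simp only [siteInt_sum]
  calc _ ≤ ∑ _s₁ : Fin 2, ∑ _s₁' : Fin 2, ∑ _s₂ : Fin 2, ∑ _s₂' : Fin 2,
        Real.exp (κ / 2) * K := by
        refine Finset.sum_le_sum fun s₁ _ => Finset.sum_le_sum fun s₁' _ =>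
          Finset.sum_le_sum fun s₂ _ => Finset.sum_le_sum fun s₂' _ => ?_
        rw [siteInt_const_mul, siteInt_add]
        linarith [h1 s₁' s₂, h2 s₂' s₁]
    _ = _ := by
        simp only [Finset.sum_const, Finset.card_univ, Fintype.card_fin, nsmul_eq_mul]
        push_cast
        ring

theorem conv_eq (χ : ℝ → ℝ) (m Z : ℝ) (h : ℕ) (t : BubbleKind)
    (v : Fin 2 → Fin 2 → Site n → ℂ) (x y : Site n) (μ ν : Fin 2) (ε ε' : ℤˣ) :
    conv N (signKernel v) (bubble χ N m Z h t) (x, μ, ε) (y, ν, ε') =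
      ∑ α, ∑ δ : ℤˣ, siteInt N fun u : Site n => sgn ε * sgn δ * (v μ α (x - y - u) *
        bubbleProfile χ N m Z h t α δ ν ε' u) := by
  rw [conv, bInt]
  refine Finset.sum_congr rfl fun α _ => Finset.sum_congr rfl fun δ _ => ?_
  rw [← siteInt_add_right N y]
  congr 1
  funext w
  rw [bubble_eq, signKernel]
  simp only [sub_add_eq_sub_sub_swap, add_sub_cancel_right, mul_assoc]

/-- Charge conjugation rewrites ε' Π̂(0) as an integral of the profile, which puts this kernel in
the same form as `conv_eq` with v(x - y - u) replaced by v(x - y). -/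
theorem mulBubbleZero_eq (χ : ℝ → ℝ) (m Z : ℝ) (h : ℕ) (t : BubbleKind)
    (v : Fin 2 → Fin 2 → Site n → ℂ) (x y : Site n) (μ ν : Fin 2) (ε ε' : ℤˣ) :
    mulBubbleZero χ N m Z h t v (x, μ, ε) (y, ν, ε') =
      ∑ α, ∑ δ : ℤˣ, siteInt N fun u : Site n => sgn ε * sgn δ * (v μ α (x - y) *
        bubbleProfile χ N m Z h t α δ ν ε' u) := by
  rw [mulBubbleZero, signKernel]
  simp only [Finset.mul_sum]
  refine Finset.sum_congr rfl fun α _ => ?_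
  have e := sum_sgn_mul_siteInt_bubbleProfile_eq (N := N) (n := n) χ m Z h t α ν ε'
  simp only [siteInt_const_mul_complex]
  have e2 : ∑ δ : ℤˣ, sgn ε * sgn δ * (v μ α (x - y) *
      siteInt N (bubbleProfile χ N (n := n) m Z h t α δ ν ε')) = sgn ε * v μ α (x - y) *
      ∑ δ : ℤˣ, sgn δ * siteInt N (bubbleProfile χ N (n := n) m Z h t α δ ν ε') := by
    rw [Finset.mul_sum]
    exact Finset.sum_congr rfl fun δ _ => by ring
  rw [e2, e]
  ring

/-- The difference is the integral of v(z - u) - v(z) against the profile. After exchanging the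
integrals, the increment bound leaves the first moment of the profile. The factor 4 is 16/4: sixteen
choices of ε, ν, ε', δ against the factor 4 inside `gradNorm`. -/
theorem wNorm_conv_sub_le (χ : ℝ → ℝ) (hκ : 0 ≤ κ) {m Z K : ℝ} (h : ℕ) (t : BubbleKind)
    (hK : ∀ μ ε ν ε', siteInt N (fun u : Site n => torusNorm N u * weight (2 * κ) N u *
      ‖bubbleProfile χ N m Z h t μ ε ν ε' u‖) ≤ K) (v : Fin 2 → Fin 2 → Site n → ℂ) :
    wNorm κ N (fun b b' => conv N (signKernel v) (bubble χ N m Z h t) b b' -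
      mulBubbleZero χ N m Z h t v b b') ≤ 4 * Real.exp (κ / 2) * K * gradNorm κ N v := by
  set P := bubbleProfile χ N (n := n) m Z h t with hP
  set G : Fin 2 → Fin 2 → ℝ := fun μ α =>
    ∑ β, siteInt N fun z => weight κ N z * ‖latticeDeriv N β v μ α z‖ with hG
  have hG0 : ∀ μ α, 0 ≤ G μ α := fun μ α => Finset.sum_nonneg fun β _ =>
    siteInt_nonneg N fun z => mul_nonneg (weight_pos z).le (norm_nonneg _)
  have hgrad : gradNorm κ N v = 4 * ∑ μ, ∑ α, G μ α := by
    rw [gradNorm]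
    simp only [wNorm_signKernel, ← Finset.mul_sum, hG]
    rw [Finset.sum_comm]
    congr 1
    exact Finset.sum_congr rfl fun μ _ => Finset.sum_comm
  rw [wNorm_eq_of_forall (fun μ ε ν ε' z => ∑ α, ∑ δ : ℤˣ, siteInt N fun u => sgn ε * sgn δ *
    ((v μ α (z - u) - v μ α z) * P α δ ν ε' u)) fun x μ ε y ν ε' => by
      rw [conv_eq, mulBubbleZero_eq, ← Finset.sum_sub_distrib]
      refine Finset.sum_congr rfl fun α _ => ?_
      rw [← Finset.sum_sub_distrib]
      refine Finset.sum_congr rfl fun δ _ => ?_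
      rw [sub_eq_iff_eq_add, ← siteInt_add]
      congr 1
      funext u
      ring]
  have hterm : ∀ μ ε ν ε', siteInt N (fun z => weight κ N z *
      ‖∑ α, ∑ δ : ℤˣ, siteInt N fun u => sgn ε * sgn δ *
        ((v μ α (z - u) - v μ α z) * P α δ ν ε' u)‖) ≤
      ∑ α, 2 * (Real.exp (κ / 2) * K * G μ α) := by
    intro μ ε ν ε'
    have h1 : ∀ z, weight κ N z * ‖∑ α, ∑ δ : ℤˣ, siteInt N fun u => sgn ε * sgn δ *
        ((v μ α (z - u) - v μ α z) * P α δ ν ε' u)‖ ≤ ∑ α, ∑ δ : ℤˣ, siteInt N fun u =>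
          ‖P α δ ν ε' u‖ * (weight κ N z * ‖v μ α (z - u) - v μ α z‖) := by
      intro z
      have h2 : ‖∑ α, ∑ δ : ℤˣ, siteInt N fun u => sgn ε * sgn δ *
        ((v μ α (z - u) - v μ α z) * P α δ ν ε' u)‖ ≤ ∑ α, ∑ δ : ℤˣ, siteInt N fun u =>
          ‖v μ α (z - u) - v μ α z‖ * ‖P α δ ν ε' u‖ := by
        refine norm_sum_le_of_le _ fun α _ => norm_sum_le_of_le _ fun δ _ =>
          (norm_siteInt_le N _).trans (le_of_eq ?_)
        simp only [norm_mul, norm_sgn, one_mul]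
      refine (mul_le_mul_of_nonneg_left h2 (weight_pos z).le).trans (le_of_eq ?_)
      simp only [Finset.mul_sum]
      refine Finset.sum_congr rfl fun α _ => Finset.sum_congr rfl fun δ _ => ?_
      rw [← siteInt_const_mul]
      congr 1
      funext u
      ring
    refine (siteInt_mono N h1).trans ?_
    simp only [siteInt_sum]
    refine Finset.sum_le_sum fun α _ => ?_
    have h3 : ∀ δ : ℤˣ, siteInt N (fun z => siteInt N fun u =>
        ‖P α δ ν ε' u‖ * (weight κ N z * ‖v μ α (z - u) - v μ α z‖)) ≤
        Real.exp (κ / 2) * K * G μ α := by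
      intro δ
      rw [siteInt_comm]
      simp only [siteInt_const_mul]
      have h4 : ∀ u, ‖P α δ ν ε' u‖ *
          siteInt N (fun z => weight κ N z * ‖v μ α (z - u) - v μ α z‖) ≤
          Real.exp (κ / 2) * G μ α * (torusNorm N u * weight (2 * κ) N u * ‖P α δ ν ε' u‖) := by
        intro u
        refine (mul_le_mul_of_nonneg_left (siteInt_weight_sub_le hκ v μ α u)
          (norm_nonneg _)).trans (le_of_eq ?_)
        simp only [hG]
        ring
      refine (siteInt_mono N h4).trans ?_
      rw [siteInt_const_mul]
      refine (mul_le_mul_of_nonneg_left (hK α δ ν ε')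
        (mul_nonneg (Real.exp_pos _).le (hG0 μ α))).trans (le_of_eq ?_)
      ring
    refine (Finset.sum_le_sum fun δ _ => h3 δ).trans (le_of_eq ?_)
    rw [Finset.sum_const, Finset.card_univ, Fintype.card_units_int, nsmul_eq_mul]
    norm_num
  refine (Finset.sum_le_sum fun μ _ => Finset.sum_le_sum fun ε _ => Finset.sum_le_sum fun ν _ =>
    Finset.sum_le_sum fun ε' _ => hterm μ ε ν ε').trans (le_of_eq ?_)
  rw [hgrad]
  simp only [Finset.sum_const, Finset.card_univ, Fintype.card_units_int, Fintype.card_fin,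
    nsmul_eq_mul, ← Finset.mul_sum]
  push_cast
  ring

theorem wNorm_mulBubbleZero_le (χ : ℝ → ℝ) {m Z K : ℝ} (h : ℕ) (t : BubbleKind)
    (hK : ∀ μ ν, ‖bubbleHat (n := n) χ N m Z h t 0 μ ν‖ ≤ K) (v : Fin 2 → Fin 2 → Site n → ℂ) :
    wNorm κ N (mulBubbleZero χ N m Z h t v) ≤
      8 * K * ∑ μ, ∑ α, siteInt N fun z => weight κ N z * ‖v μ α z‖ := by
  rw [mulBubbleZero, wNorm_signKernel]
  have h1 : ∀ μ ν, siteInt N (fun z => weight κ N z *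
      ‖∑ α, v μ α z * bubbleHat χ N m Z h t (0 : Site n) α ν‖) ≤
      K * ∑ α, siteInt N fun z => weight κ N z * ‖v μ α z‖ := by
    intro μ ν
    rw [← siteInt_sum, ← siteInt_const_mul]
    refine siteInt_mono N fun z => ?_
    have h2 : ‖∑ α, v μ α z * bubbleHat χ N m Z h t (0 : Site n) α ν‖ ≤ ∑ α, ‖v μ α z‖ * K :=
      norm_sum_le_of_le _ fun α _ => by
        rw [norm_mul]
        exact mul_le_mul_of_nonneg_left (hK α ν) (norm_nonneg _)
    refine (mul_le_mul_of_nonneg_left h2 (weight_pos z).le).trans (le_of_eq ?_)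
    rw [← Finset.sum_mul, ← Finset.mul_sum]
    ring
  have h3 := Finset.sum_le_sum fun (μ : Fin 2) (_ : μ ∈ Finset.univ) =>
    Finset.sum_le_sum fun (ν : Fin 2) (_ : ν ∈ Finset.univ) => h1 μ ν
  refine (mul_le_mul_of_nonneg_left h3 (by norm_num)).trans (le_of_eq ?_)
  simp only [Finset.sum_const, Finset.card_univ, Fintype.card_fin, nsmul_eq_mul, ← Finset.mul_sum]
  push_cast
  ring

theorem gradNorm_nonneg (v : Fin 2 → Fin 2 → Site n → ℂ) : 0 ≤ gradNorm κ N v := by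
  simp only [gradNorm, wNorm_signKernel]
  exact Finset.sum_nonneg fun _ _ => mul_nonneg (by norm_num) (Finset.sum_nonneg fun _ _ =>
    Finset.sum_nonneg fun _ _ => siteInt_nonneg N fun z => mul_nonneg (weight_pos z).le
      (norm_nonneg _))

theorem bubbleProfile_eq_zero (χ : ℝ → ℝ) (m Z : ℝ) {h : ℕ} (hN : N ≤ h) (t : BubbleKind)
    (μ ν : Fin 2) (ε ε' : ℤˣ) (u : Site n) : bubbleProfile χ N m Z h t μ ε ν ε' u = 0 := by
  have h0 : ∀ x : Site n, fermiProp χ N m h x = 0 := fun x => by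
    rw [fermiProp, Finset.Icc_eq_empty (by omega), Finset.sum_empty]
  simp [bubbleProfile, spinSum, h0]

end Convolution

end LatticeQED

/-! ### Assembly of the four estimates -/

theorem lemmaC1 (χ : ℝ → ℝ) (hχ : IsCutoff χ) :
    ∃ κ₀ : ℝ, 0 < κ₀ ∧ ∃ C C' : ℝ, 1 ≤ C ∧ 1 ≤ C' ∧
      ∀ κ : ℝ, 0 < κ → κ ≤ κ₀ →
      ∀ (N n : ℕ) [NeZero n], 1 ≤ side N n →
      ∀ m : ℝ, |m| ≤ 1 → ∀ Z : ℝ, |Z - 1| ≤ 1 / 2 →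
      ∀ h : ℕ, h ≤ N →
        (∀ μ ν : Fin 2,
          bubbleHat (n := n) χ N m Z h BubbleKind.vector 0 μ ν =
            (if μ = ν then 1 else 0) * bubbleHat (n := n) χ N m Z h BubbleKind.vector 0 0 0) ∧
        (∀ μ ν : Fin 2,
          bubbleHat (n := n) χ N m Z h BubbleKind.chiral 0 μ ν =
            epsTensor μ ν * bubbleHat (n := n) χ N m Z h BubbleKind.chiral 0 0 1) ∧
        ∀ t : BubbleKind,
          (∀ μ ν : Fin 2, ‖bubbleHat (n := n) χ N m Z h t 0 μ ν‖ ≤ C) ∧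
          (∀ v : Fin 2 → Fin 2 → Site n → ℂ,
            wNorm κ N (fun b b' =>
              conv N (signKernel v) (bubble χ N m Z h t) b b' -
                mulBubbleZero χ N m Z h t v b b') ≤
              C * ((2 : ℝ) ^ h)⁻¹ * gradNorm κ N v) ∧
          (∀ M : ℝ, 1 ≤ M → M < 2 →
            wNorm κ N (conv N (bosonKernel N M) (bubble (n := n) χ N m Z h t)) ≤ C') := by
  obtain ⟨κ₁, K, hκ₁, hK, hprop⟩ := hχ.exists_propagator_bounds
  set E := Real.exp (κ₁ / 2) with hE
  have hE0 : 0 < E := Real.exp_pos _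
  have hC : 0 ≤ 64 * E * E * K := by positivity
  -- The threshold is halved since the moment bound is applied at 2κ. The constant 64 is 4 · 16,
  -- from `wNorm_conv_sub_le` and the profile moment; 32000000 is 8 · 10⁶ times the four entries of
  -- g^A, and 32 is 4 times its eight first derivatives.
  refine ⟨κ₁ / 2, half_pos hκ₁, 1000000 + 64 * E * E * K,
    1 + 32000000 * K + 64 * E * E * K * (32 * K), by linarith, ?_, ?_⟩
  · have : 0 ≤ 64 * E * E * K * (32 * K) := by positivity
    linarith
  intro κ hκ hκ' N n _ hL m hm Z hZ h hh
  refine ⟨fun μ ν => bubbleHat_vector_zero χ m Z h μ ν,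
    fun μ ν => bubbleHat_chiral_zero χ m Z h μ ν, fun t => ?_⟩
  have hhat := hχ.norm_bubbleHat_zero_le (N := N) (n := n) hL hm hZ h t
  have h2h : (0 : ℝ) < ((2 : ℝ) ^ h)⁻¹ := by positivity
  have hprof : ∀ μ ε ν ε', siteInt N (fun u : Site n => torusNorm N u * weight (2 * κ) N u *
      ‖bubbleProfile χ N m Z h t μ ε ν ε' u‖) ≤ 16 * E * (K * ((2 : ℝ) ^ h)⁻¹) := by
    intro μ ε ν ε'
    by_cases hN : 1 ≤ N
    · have h1 := siteInt_torusNorm_weight_mul_bubbleProfile_le χ (κ := 2 * κ) (by linarith) hN hZ h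
        ((hprop N n hN hL (2 * κ) (by linarith) (by linarith)).1 m hm h) t μ ν ε ε'
      refine h1.trans ?_
      have h3 : Real.exp (2 * κ / 2) ≤ E := Real.exp_le_exp.2 (by linarith)
      gcongr
    -- For N = 0 also h = N, so there is no scale and the bubble vanishes.
    · simp only [bubbleProfile_eq_zero χ m Z (by omega : N ≤ h), norm_zero, mul_zero]
      rw [siteInt_const, mul_zero]
      positivity
  have hdiff : ∀ v : Fin 2 → Fin 2 → Site n → ℂ, wNorm κ N (fun b b' =>
      conv N (signKernel v) (bubble χ N m Z h t) b b' - mulBubbleZero χ N m Z h t v b b') ≤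
      64 * E * E * K * ((2 : ℝ) ^ h)⁻¹ * gradNorm κ N v := by
    intro v
    refine (wNorm_conv_sub_le χ hκ.le h t hprof v).trans ?_
    have h3 : Real.exp (κ / 2) ≤ E := Real.exp_le_exp.2 (by linarith)
    have h4 : 0 ≤ gradNorm κ N v := gradNorm_nonneg v
    calc 4 * Real.exp (κ / 2) * (16 * E * (K * ((2 : ℝ) ^ h)⁻¹)) * gradNorm κ N v
        ≤ 4 * E * (16 * E * (K * ((2 : ℝ) ^ h)⁻¹)) * gradNorm κ N v := by gcongr
      _ = _ := by ring
  refine ⟨fun μ ν => (hhat μ ν).trans (by linarith), fun v => (hdiff v).trans ?_, ?_⟩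
  · have h4 : 0 ≤ gradNorm κ N v := gradNorm_nonneg v
    gcongr
    linarith
  · intro M hM _
    have hpos : 0 ≤ 1 + 32000000 * K + 64 * E * E * K * (32 * K) := by positivity
    by_cases hN : 1 ≤ N
    · have hb := (hprop N n hN hL κ hκ (by linarith)).2 M hM
      have h1 : wNorm κ N (mulBubbleZero χ N m Z h t (bosonProp N M (n := n))) ≤ 32000000 * K := by
        refine (wNorm_mulBubbleZero_le χ h t hhat _).trans ?_
        have := Finset.sum_le_sum fun (μ : Fin 2) (_ : μ ∈ Finset.univ) =>
          Finset.sum_le_sum fun (ν : Fin 2) (_ : ν ∈ Finset.univ) => (hb μ ν).1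
        simp only [Fin.sum_univ_two] at this ⊢
        linarith
      have h2 : gradNorm κ N (bosonProp N M (n := n)) ≤ 32 * K := by
        rw [gradNorm]
        simp only [wNorm_signKernel, Fin.sum_univ_two]
        linarith [(hb 0 0).2 0, (hb 0 0).2 1, (hb 0 1).2 0, (hb 0 1).2 1, (hb 1 0).2 0,
          (hb 1 0).2 1, (hb 1 1).2 0, (hb 1 1).2 1]
      have h3 := hdiff (bosonProp N M)
      have h4 : ((2 : ℝ) ^ h)⁻¹ ≤ 1 := inv_le_one_of_one_le₀ (one_le_pow₀ (by norm_num))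
      have h5 : 64 * E * E * K * ((2 : ℝ) ^ h)⁻¹ * gradNorm κ N (bosonProp N M (n := n)) ≤
          64 * E * E * K * (32 * K) :=
        mul_le_mul (mul_le_of_le_one_right hC h4) h2 (gradNorm_nonneg _) hC
      -- The convolution is split into its deviation from g^A Π̂(0), controlled by the gradient of
      -- g^A, and g^A Π̂(0) itself.
      refine (wNorm_le_sub_add _ (mulBubbleZero χ N m Z h t (bosonProp N M))).trans ?_
      rw [bosonKernel]
      linarith
    · rw [wNorm_eq_of_forall (fun _ _ _ _ _ => 0) fun x μ ε y ν ε' => ?_]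
      · simp only [norm_zero, mul_zero, siteInt_const, Finset.sum_const_zero]
        exact hpos
      · rw [bosonKernel, conv_eq]
        simp only [bubbleProfile_eq_zero χ m Z (by omega : N ≤ h), mul_zero]
        simp [siteInt]
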